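/- All structures are finite. For $n\ge 1$, $P_n$ is the path on $\{0,\dots,n-1\}$ with edges $\{k,k+1\}$. For a hypergraph $H$ (vertex set $V(H)$, edge set $E(H)$, $v(H)=|V(H)|$) and $W\subseteq V(H)$, let $H-W$ be the hypergraph on $V(H)\setminus W$ whose edges are the $e\in E(H)$ with $e\cap W=\emptyset$. A set $M\subseteq V(H)$ is a *module* of $H$ if for each $e\in E(H)$ with $e\cap M\ne\emptyset$ and $e\setminus M\neq\emptyset$ there is $m\in M$ such that $e\cap M=\{m\}$ and $(e\setminus\{m\})\cup\{n\}\in E(H)$ for all $n\in M$. It is *trivial* if it is $\emptyset$, $V(H)$ or a one-element set. $H$ is *decomposable* if it has a nontrivial module, *prime* if it is not decomposable and $v(H)\ge 3$, and *critical* if it is prime and $H-\{v\}$ is decomposable for each $v\in V(H)$. The *primality graph* $\mathscr P(H)$ is the graph on $V(H)$ in which distinct $v,w$ are adjacent iff $H-\{v,w\}$ is prime. A set is a module of a hypergraph all of whose edges have size 2 or 3 if it is a module both of the hypergraph of its edges of size 2 and of the hypergraph of its edges of size 3. A hypergraph is *connected* if it has a vertex and any two vertices are joined by a sequence of vertices in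 which consecutive ones lie in a common edge; a vertex is *isolated* if it lies in no edge. Let $\Gamma$ be a graph all of whose components are paths. Let $\mathfrak C(\Gamma)$ be the set of its components, and let $\mathfrak C_{\rm even}(\Gamma)$, $\mathfrak C_{\rm odd}(\Gamma)$, $\mathfrak C_1(\Gamma)$ be the sets of components $C$ whose number of vertices $v(C)$ is even, odd, equal to $1$. Put $w(C)=\lfloor v(C)/2\rfloor$ and $V_1(\Gamma)=\{v:\{v\}\in\mathfrak C_1(\Gamma)\}$. Suppose that * $\mathfrak C(\Gamma)\setminus\mathfrak C_1(\Gamma)\ne\emptyset$; * for each $C\in\mathfrak C_{\rm odd}(\Gamma)$ with $V(\Gamma)\setminus V(C)\ne\emptyset$, we have $(\mathfrak C(\Gamma)\setminus\mathfrak C_1(\Gamma))\setminus\{C\}\neq\emptyset$; * for each $C\in\mathfrak C_{\rm even}(\Gamma)$ with $|V(\Gamma)\setminus V(C)|\ge 2$, we have $(\mathfrak C(\Gamma)\setminus\mathfrak C_1(\Gamma))\setminus\{C\}\neq\emptyset$. Let $\mathbb H$ be a hypergraph with vertex set $\mathfrak C(\Gamma)$, all of whose edges have size 2 or 3, such that each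 edge of size 2 consists of one element of $\mathfrak C_{\rm even}(\Gamma)$ and one of $\mathfrak C_{\rm odd}(\Gamma)$, and each edge of size 3 is contained in $\mathfrak C_{\rm odd}(\Gamma)$. For each $C\in\mathfrak C(\Gamma)$ fix an isomorphism $\varphi_C$ from $P_{v(C)}$ onto $C$. Let $U_{2n+1}$ be the tournament on $\{0,\dots,2n\}$ obtained from the linear order $0<1<\dots<2n$ by reversing the arcs between even vertices. The 3-hypergraph $\Gamma\bullet\mathbb H$ has vertex set $V(\Gamma)$ and the following edges: * for $C\in\mathfrak C_{\rm odd}(\Gamma)\setminus\mathfrak C_1(\Gamma)$, the images under $\varphi_C$ of the vertex sets of the 3-cycles of $U_{v(C)}$; * for an edge $CD$ of $\mathbb H$ with $C\in\mathfrak C_{\rm even}(\Gamma)$ and $D\in\mathfrak C_{\rm odd}(\Gamma)$, the sets $\{\varphi_C(2i),\varphi_C(2j+1),\varphi_D(2k)\}$ with $0\le i\le j\le w(C)-1$ and $0\le k\le w(D)$; * for an edge $IJK$ of $\mathbb H$ of size 3, the sets $\{\varphi_I(2i),\varphi_J(2j),\varphi_K(2k)\}$ with $0\le i\le w(I)$,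 $0\le j\le w(J)$, $0\le k\le w(K)$. **Theorem.** Assume that $v(\Gamma\bullet\mathbb H)\ge 5$ and that $|V(\Gamma)\setminus V(C)|\ge 2$ for each $C\in\mathfrak C_{\rm even}(\Gamma)$ (that is, $\Gamma$ is neither a path with an even number of vertices, nor the disjoint union of such a path and one isolated vertex). Then $\Gamma\bullet\mathbb H$ is critical and $\mathscr P(\Gamma\bullet\mathbb H)=\Gamma$ if and only if the following six assertions hold. * (C1) $\mathbb H$ is connected. * (C2) For every nontrivial module $\mathbb M$ of $\mathbb H$, $\mathbb M\setminus\mathfrak C_1(\Gamma)\ne\emptyset$. * (C3) For each $v\in V_1(\Gamma)$, if $\mathbb H-\{\{v\}\}$ (the hypergraph $\mathbb H$ with its vertex $\{v\}$ deleted) is connected, then it admits a nontrivial module contained in $\mathfrak C_1(\Gamma)\setminus\{\{v\}\}$. * (C4) For each $C\in\mathfrak C_{\rm even}(\Gamma)$ with $v(C)=2$: $\mathbb H-\{C\}$ is connected, and $\mathbb M\setminus\mathfrak C_1(\Gamma)\ne\emptyset$ for every nontrivial module $\mathbb M$ of $\mathbb H-\{C\}$. * (C5) For each $C\in\mathfrak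 C_{\rm odd}(\Gamma)$ with $v(C)=3$, let $\mathbb H_C$ be obtained from $\mathbb H$ by replacing the vertex $C$ by $\{\varphi_C(0)\}$: $\mathbb H_C$ is connected, and $\mathbb M\setminus(\mathfrak C_1(\Gamma)\cup\{\{\varphi_C(0)\}\})\neq\emptyset$ for every nontrivial module $\mathbb M$ of $\mathbb H_C$. * (C6) For all distinct $C,D\in\mathfrak C_1(\Gamma)$ such that $D$ is an isolated vertex of $\mathbb H-\{C\}$ and $\mathbb H-\{C,D\}$ is connected, $\mathbb H-\{C,D\}$ admits a nontrivial module contained in $\mathfrak C_1(\Gamma)\setminus\{C,D\}$. -/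

import Mathlib

namespace Hypergraph

/-- The subhypergraph `H[W]` induced by a set `W` of vertices. -/
def induce {α : Type*} (H : Hypergraph α) (W : Set α) : Hypergraph α where
  vertexSet := H.vertexSet ∩ W
  edgeSet := {e ∈ H.edgeSet | e ⊆ W}
  subset_vertexSet_of_mem_edgeSet' := fun _ he =>
    Set.subset_inter (H.subset_vertexSet_of_mem_edgeSet he.1) he.2

/-- `H - X`: the subhypergraph induced by the vertices outside `X`. -/
def deleteVerts {α : Type*} (H : Hypergraph α) (X : Set α) : Hypergraph α :=
  H.induce (H.vertexSet \ X)

/-- The hypergraph with the same vertices as `H` whose edges are the edges of `H` of size `k`. -/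
def sizePart {α : Type*} (H : Hypergraph α) (k : ℕ) : Hypergraph α where
  vertexSet := H.vertexSet
  edgeSet := {e ∈ H.edgeSet | e.ncard = k}
  subset_vertexSet_of_mem_edgeSet' := fun _ he => H.subset_vertexSet_of_mem_edgeSet he.1

/-- `M` is a module of `H`. -/
def IsModule {α : Type*} (H : Hypergraph α) (M : Set α) : Prop :=
  M ⊆ H.vertexSet ∧
    ∀ e ∈ H.edgeSet, (e ∩ M).Nonempty → (e \ M).Nonempty →
      ∃ m ∈ M, e ∩ M = {m} ∧ ∀ n ∈ M, (e \ {m}) ∪ {n} ∈ H.edgeSet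

/-- `M` is one of the sets `∅`, `V(H)`, `{v}` with `v ∈ V(H)`. -/
def IsTrivialModule {α : Type*} (H : Hypergraph α) (M : Set α) : Prop :=
  M = ∅ ∨ M = H.vertexSet ∨ ∃ v ∈ H.vertexSet, M = {v}

/-- All modules of `H` are trivial. -/
def IsIndecomposable {α : Type*} (H : Hypergraph α) : Prop :=
  ∀ M : Set α, H.IsModule M → H.IsTrivialModule M

/-- Prime: indecomposable, with at least three vertices (used for finite hypergraphs). -/
def IsPrime {α : Type*} (H : Hypergraph α) : Prop :=
  H.IsIndecomposable ∧ 3 ≤ H.vertexSet.ncard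

/-- Critical: prime, and each `H - v` is decomposable. -/
def IsCritical {α : Type*} (H : Hypergraph α) : Prop :=
  H.IsPrime ∧ ∀ v ∈ H.vertexSet, ¬ (H.deleteVerts {v}).IsIndecomposable

/-- The primality graph: `v` and `w` are adjacent when they are distinct vertices of `H` such that
`H - {v, w}` is prime. -/
def primalityGraph {α : Type*} (H : Hypergraph α) : SimpleGraph α where
  Adj v w := v ≠ w ∧ v ∈ H.vertexSet ∧ w ∈ H.vertexSet ∧ (H.deleteVerts {v, w}).IsPrime
  symm := ⟨fun v w h => ⟨h.1.symm, h.2.2.1, h.2.1, by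
    rw [Set.pair_comm]; exact h.2.2.2⟩⟩
  loopless := ⟨fun _ h => h.1 rfl⟩

/-- Connectedness: `H` has a vertex, and any two vertices are joined by a sequence of vertices in
which consecutive ones lie in a common edge. -/
def IsConnected {α : Type*} (H : Hypergraph α) : Prop :=
  (SimpleGraph.fromRel (fun x y : H.vertexSet => H.Adj x y)).Connected

/-- Modules of a `{2,3}`-hypergraph: modules of both its 2-part and its 3-part. -/
def IsModule23 {α : Type*} (H : Hypergraph α) (M : Set α) : Prop :=
  (H.sizePart 2).IsModule M ∧ (H.sizePart 3).IsModule M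

/-- Nontrivial modules of a `{2,3}`-hypergraph. -/
def IsNontrivialModule23 {α : Type*} (H : Hypergraph α) (M : Set α) : Prop :=
  H.IsModule23 M ∧ ¬ H.IsTrivialModule M

end Hypergraph

/-- The `C₃`-structure of a tournament `T`: its edges are the vertex sets of the 3-cycles of `T`. -/
def Digraph.c3Structure {α : Type*} (T : Digraph α) : Hypergraph α where
  vertexSet := Set.univ
  edgeSet := {e | ∃ x y z : α, T.Adj x y ∧ T.Adj y z ∧ T.Adj z x ∧ e = {x, y, z}}
  subset_vertexSet_of_mem_edgeSet' := fun _ _ => Set.subset_univ _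

/-- The tournament `U_n` on `{0, …, n-1}`: the usual linear order `0 < 1 < ⋯ < n-1`, where the arcs
between even vertices are reversed. -/
def tournamentU (n : ℕ) : Digraph (Fin n) where
  Adj a b := if Even (a : ℕ) ∧ Even (b : ℕ) then b < a else a < b

namespace SimpleGraph

/-- The components of `Γ` with an even number of vertices. -/
def evenComps {V : Type*} (Γ : SimpleGraph V) : Set Γ.ConnectedComponent :=
  {C | Even C.supp.ncard}

/-- The components of `Γ` with an odd number of vertices. -/
def oddComps {V : Type*} (Γ : SimpleGraph V) : Set Γ.ConnectedComponent :=
  {C | Odd C.supp.ncard}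

/-- The components of `Γ` with one vertex. -/
def singletonComps {V : Type*} (Γ : SimpleGraph V) : Set Γ.ConnectedComponent :=
  {C | C.supp.ncard = 1}

/-- A choice, for each component `C` of `Γ`, of an isomorphism from the path on `{0, …, v(C)-1}`
onto `C`. Such a choice exists exactly when all components of (the finite graph) `Γ` are paths. -/
abbrev PathParam {V : Type*} (Γ : SimpleGraph V) : Type _ :=
  ∀ C : Γ.ConnectedComponent, pathGraph C.supp.ncard ≃g C.toSimpleGraph

/-- The standing conditions on the graph `Γ` (besides that all its components are paths). -/
structure BulletGraph {V : Type*} (Γ : SimpleGraph V) : Prop where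
  exists_nonsingleton : ((Γ.singletonComps)ᶜ).Nonempty
  odd_comp : ∀ C ∈ Γ.oddComps, ((C.supp)ᶜ).Nonempty → ((Γ.singletonComps)ᶜ \ {C}).Nonempty
  even_comp : ∀ C ∈ Γ.evenComps, 2 ≤ ((C.supp)ᶜ).ncard → ((Γ.singletonComps)ᶜ \ {C}).Nonempty

/-- The standing conditions on the `{2,3}`-hypergraph `ℍ` on the set of components of `Γ`. -/
structure BulletHypergraph {V : Type*} (Γ : SimpleGraph V)
    (ℍ : Hypergraph Γ.ConnectedComponent) : Prop where
  vertexSet_eq : ℍ.vertexSet = Set.univ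
  size : ∀ ε ∈ ℍ.edgeSet, ε.ncard = 2 ∨ ε.ncard = 3
  two : ∀ ε ∈ ℍ.edgeSet, ε.ncard = 2 → (ε ∩ Γ.evenComps).Nonempty ∧ (ε ∩ Γ.oddComps).Nonempty
  three : ∀ ε ∈ ℍ.edgeSet, ε.ncard = 3 → ε ⊆ Γ.oddComps

/-- The set `E_C` of triples attached to a component `C`: the image under `φ_C` of the edges of
the `C₃`-structure of `U_{v(C)}`. -/
def compTriples {V : Type*} {Γ : SimpleGraph V} (φ : Γ.PathParam) (C : Γ.ConnectedComponent) :
    Set (Set V) :=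
  ((tournamentU C.supp.ncard).c3Structure.image (fun i => (φ C i : V))).edgeSet

/-- The set of triples `φ_C(2i) φ_C(2j+1) φ_D(2k)` with `i ≤ j`; the upper bounds on `j` and `k`
come from the index types `Fin v(C)` and `Fin v(D)`. -/
def pairTriples {V : Type*} {Γ : SimpleGraph V} (φ : Γ.PathParam) (C D : Γ.ConnectedComponent) :
    Set (Set V) :=
  {e | ∃ (a b : Fin C.supp.ncard) (c : Fin D.supp.ncard) (i j k : ℕ),
    (a : ℕ) = 2 * i ∧ (b : ℕ) = 2 * j + 1 ∧ (c : ℕ) = 2 * k ∧ i ≤ j ∧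
      e = {(φ C a : V), (φ C b : V), (φ D c : V)}}

/-- The set of triples `φ_I(2i) φ_J(2j) φ_K(2k)`. -/
def tripleTriples {V : Type*} {Γ : SimpleGraph V} (φ : Γ.PathParam)
    (I J K : Γ.ConnectedComponent) : Set (Set V) :=
  {e | ∃ (a : Fin I.supp.ncard) (b : Fin J.supp.ncard) (c : Fin K.supp.ncard),
    Even (a : ℕ) ∧ Even (b : ℕ) ∧ Even (c : ℕ) ∧
      e = {(φ I a : V), (φ J b : V), (φ K c : V)}}

/-- The set `E_ε` of triples attached to an edge `ε` of `ℍ`. -/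
def edgeTriples {V : Type*} {Γ : SimpleGraph V} (φ : Γ.PathParam)
    (ε : Set Γ.ConnectedComponent) : Set (Set V) :=
  {e | (∃ C ∈ Γ.evenComps, ∃ D ∈ Γ.oddComps, ε = {C, D} ∧ e ∈ pairTriples φ C D) ∨
    (∃ I ∈ Γ.oddComps, ∃ J ∈ Γ.oddComps, ∃ K ∈ Γ.oddComps, I ≠ J ∧ I ≠ K ∧ J ≠ K ∧
      ε = {I, J, K} ∧ e ∈ tripleTriples φ I J K)}

/-- The 3-hypergraph `Γ • ℍ`. -/
def bullet {V : Type*} (Γ : SimpleGraph V) (φ : Γ.PathParam)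
    (ℍ : Hypergraph Γ.ConnectedComponent) : Hypergraph V where
  vertexSet := Set.univ
  edgeSet := (⋃ C ∈ Γ.oddComps \ Γ.singletonComps, compTriples φ C) ∪
    (⋃ ε ∈ ℍ.edgeSet, edgeTriples φ ε)
  subset_vertexSet_of_mem_edgeSet' := fun _ _ => Set.subset_univ _

open Classical in
/-- The hypergraph obtained from `ℍ` by replacing its vertex `C` by the one-point set `{x}`. To
accommodate the new vertex, the vertices are written as subsets of `V`, each remaining component
being represented by its vertex set. -/
noncomputable def replaceComp {V : Type*} {Γ : SimpleGraph V}
    (ℍ : Hypergraph Γ.ConnectedComponent) (C : Γ.ConnectedComponent) (x : V) :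
    Hypergraph (Set V) :=
  ℍ.image (fun D => if D = C then {x} else D.supp)

end SimpleGraph

/-! ### Modules, connectedness and relabelling of hypergraphs. -/

namespace Hypergraph

variable {α β : Type*}

/-! Regard the components of `Γ` as blocks and `Γ • ℍ` as a blow-up of `ℍ`. The vertex sets `X`
whose primality matters keep, in each block, positions that alternate between even and odd, start
with an even one, and end with an odd one exactly in even blocks. This holds for the whole vertex
set and survives the deletion of entire blocks or of two consecutive vertices of a path. For such
`X`, `Alternates.isPrime_induce_iff` reads primality off the pattern `ℍ'` induced by `ℍ` on the
blocks that meet `X`: `ℍ'` must be connected and have no nontrivial module made only of blocks with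
one vertex in `X`. Indeed, a module with two vertices in a block swallows the block and then, by
connectedness, all of `X`. A module with at least two vertices that meets each block at most once
lives on one-vertex blocks and projects to a module of `ℍ'`. Conversely, modules of `ℍ'` made of
one-vertex blocks lift, and a union of connected components of `ℍ'` lifts to a module.

This translates the six conditions. (C1) and (C2) say that `Γ • ℍ` is prime; (C3) treats the
deletion of an isolated vertex of `Γ`; (C4) and (C5) treat an edge of a path with two or three
vertices; longer paths lead back to (C1) and (C2). Nothing needs to be assumed about a vertex `v` of
a longer component and its non-neighbours in `Γ`: deleting `v` isolates a neighbour or turns its two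
neighbours into twins, and this persists when a non-neighbour of `v` is deleted too
(`IsBlockPosition.not_isIndecomposable`).

It remains to exclude edges of the primality graph between isolated vertices of `Γ`, although (C6)
only covers the case where one is isolated after deletion of the other. In the other case, let `v`,
`w` be adjacent in the primality graph. A nontrivial module of `H - v` becomes trivial when `w` is
deleted, so it is a pair `{w, α}`, and `w`, `α` are the only neighbours of `v`. The vertices
concerned thus lie on cycles of the primality graph in which the two neighbours of each vertex are
twins once it is deleted. Passing edges along such a cycle in steps of two shows that every second
vertex of it forms a module of `H` (`IsTwinCycle.isTripleModule`). This module is nontrivial, since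
`Γ` has a larger component, and contradicts primality (`Hypergraph.not_primalityGraph_adj`). -/

theorem exists_eq_triple_of_ncard_eq_three {e : Set α} (h : e.ncard = 3) {a d : α} (ha : a ∈ e)
    (hd : d ∈ e) (had : a ≠ d) : ∃ b, b ≠ a ∧ b ≠ d ∧ e = {a, b, d} := by
  obtain ⟨x, y, z, hxy, hxz, hyz, rfl⟩ := Set.ncard_eq_three.1 h
  simp only [Set.mem_insert_iff, Set.mem_singleton_iff] at ha hd
  rcases ha with rfl | rfl | rfl <;> rcases hd with rfl | rfl | rfl
  · exact absurd rfl had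
  · exact ⟨z, hxz.symm, hyz.symm, by ext; simp; tauto⟩
  · exact ⟨y, hxy.symm, hyz, rfl⟩
  · exact ⟨z, hyz.symm, hxz.symm, by ext; simp; tauto⟩
  · exact absurd rfl had
  · exact ⟨x, hxy, hxz, by ext; simp; tauto⟩
  · exact ⟨y, hyz, hxy.symm, by ext; simp; tauto⟩
  · exact ⟨x, hxz, hxy, by ext; simp; tauto⟩
  · exact absurd rfl had

theorem triple_ne_of_ncard {a b d : α} (h : ({a, b, d} : Set α).ncard = 3) :
    a ≠ b ∧ a ≠ d ∧ b ≠ d := by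
  refine ⟨?_, ?_, ?_⟩ <;> rintro rfl
  · have := Set.ncard_le_ncard (s := {a, a, d}) (t := {a, d}) (by intro; simp) (by simp)
    have := Set.ncard_insert_le a {d}
    simp at this h; omega
  · have := Set.ncard_le_ncard (s := {a, b, a}) (t := {b, a}) (by intro; simp) (by simp)
    have := Set.ncard_insert_le b {a}
    simp at this; omega
  · have := Set.ncard_insert_le a {b}
    simp at this h; omega

/-- An edge that meets both `M` and its complement can be written with its first vertex inside and
its last one outside, so only the role of the middle vertex has to be settled. -/
theorem isModule_iff_of_ncard_eq_three {H : Hypergraph α} (h3 : ∀ e ∈ H.edgeSet, e.ncard = 3)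
    {M : Set α} :
    H.IsModule M ↔ M ⊆ H.vertexSet ∧ ∀ a b d : α, {a, b, d} ∈ H.edgeSet → a ∈ M → d ∉ M →
      b ∉ M ∧ ∀ n ∈ M, {n, b, d} ∈ H.edgeSet := by
  refine and_congr_right fun _ => ⟨fun h a b d he ha hd => ?_, fun h e he ⟨a, hae, ha⟩ ⟨d, hde, hd⟩ => ?_⟩
  · obtain ⟨hab, had, hbd⟩ := triple_ne_of_ncard (h3 _ he)
    obtain ⟨m, hm, hem, hn⟩ := h _ he ⟨a, by simp, ha⟩ ⟨d, by simp, hd⟩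
    have ham : a = m := by
      have : a ∈ ({a, b, d} : Set α) ∩ M := ⟨by simp, ha⟩
      rwa [hem] at this
    subst ham
    refine ⟨fun hb => ?_, fun n hnM => ?_⟩
    · have : b ∈ ({a, b, d} : Set α) ∩ M := ⟨by simp, hb⟩
      rw [hem] at this
      exact hab this.symm
    · convert hn n hnM using 1
      ext x
      simp only [Set.mem_insert_iff, Set.mem_singleton_iff, Set.mem_union, Set.mem_sdiff]
      grind
  · obtain ⟨b, hba, hbd, rfl⟩ := exists_eq_triple_of_ncard_eq_three (h3 _ he) hae hde
      (fun h => hd (h ▸ ha))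
    obtain ⟨hb, hn⟩ := h a b d he ha hd
    refine ⟨a, ha, ?_, fun n hnM => ?_⟩
    · ext x
      simp only [Set.mem_insert_iff, Set.mem_singleton_iff, Set.mem_inter_iff]
      grind
    · convert hn n hnM using 1
      ext x
      simp only [Set.mem_insert_iff, Set.mem_singleton_iff, Set.mem_union, Set.mem_sdiff]
      grind

/-- The vertices reachable from a given one absorb every edge they meet. In this form connectedness
applies directly to the set of blocks contained in a module. -/
theorem isConnected_iff {H : Hypergraph α} :
    H.IsConnected ↔ H.vertexSet.Nonempty ∧ ∀ K ⊆ H.vertexSet, K.Nonempty →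
      (∀ e ∈ H.edgeSet, (e ∩ K).Nonempty → e ⊆ K) → K = H.vertexSet := by
  unfold IsConnected
  constructor
  · intro h
    refine ⟨Set.nonempty_coe_sort.1 h.nonempty, fun K hK ⟨x, hx⟩ hcl => hK.antisymm fun y hy => ?_⟩
    obtain ⟨w⟩ := h.preconnected ⟨x, hK hx⟩ ⟨y, hy⟩
    have key : ∀ u v : H.vertexSet,
        (SimpleGraph.fromRel (fun x y : H.vertexSet => H.Adj x y)).Walk u v →
        (u : α) ∈ K → (v : α) ∈ K := by
      intro u v w
      induction w with
      | nil => exact id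
      | cons hadj _ ih =>
        intro hu
        apply ih
        rw [SimpleGraph.fromRel_adj] at hadj
        obtain ⟨-, ⟨e, he, h1, h2⟩ | ⟨e, he, h1, h2⟩⟩ := hadj
        · exact hcl e he ⟨_, h1, hu⟩ h2
        · exact hcl e he ⟨_, h2, hu⟩ h1
    exact key _ _ w hx
  · rintro ⟨hne, h⟩
    have : Nonempty H.vertexSet := hne.to_subtype
    refine ⟨fun x y => ?_⟩
    let G := SimpleGraph.fromRel (fun x y : H.vertexSet => H.Adj x y)
    have hK := h {z | ∃ hz : z ∈ H.vertexSet, G.Reachable x ⟨z, hz⟩} (fun z hz => hz.1)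
      ⟨x, x.2, SimpleGraph.Reachable.refl _⟩ ?_
    · exact (hK.symm.subset y.2).2
    · rintro e he ⟨u, hu, hu', hr⟩ v hv
      have hv' := H.subset_vertexSet_of_mem_edgeSet' he hv
      refine ⟨hv', ?_⟩
      by_cases huv : u = v
      · subst huv; exact hr
      · refine hr.trans (SimpleGraph.Adj.reachable ?_)
        rw [SimpleGraph.fromRel_adj]
        exact ⟨fun h => huv (congrArg Subtype.val h), Or.inl ⟨e, he, hu, hv⟩⟩

theorem induce_univ (H : Hypergraph α) : H.induce Set.univ = H := by
  ext <;> simp [induce]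

theorem deleteVerts_eq_induce_compl {H : Hypergraph α} (hH : H.vertexSet = Set.univ) (X : Set α) :
    H.deleteVerts X = H.induce Xᶜ := by
  rw [deleteVerts, hH, Set.compl_eq_univ_sdiff]

theorem isConnected_image_iff {H : Hypergraph α} {f : α → β} (hf : Function.Injective f) :
    (H.image f).IsConnected ↔ H.IsConnected := by
  simp only [isConnected_iff, Hypergraph.image_vertexSet, Set.image_nonempty]
  refine and_congr_right fun _ => ⟨fun h K hK hne hcl => ?_, fun h K hK hne hcl => ?_⟩
  · refine hf.image_injective (h (f '' K) (Set.image_mono hK) (hne.image f) ?_)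
    rintro _ ⟨e, he, rfl⟩ hne
    rw [← Set.image_inter hf, Set.image_nonempty] at hne
    exact Set.image_mono (hcl e he hne)
  · obtain ⟨K, hK', rfl⟩ := Set.subset_image_iff.1 hK
    rw [h K hK' (Set.image_nonempty.1 hne)]
    intro e he hne'
    have := hcl (f '' e) ⟨e, he, rfl⟩ (by rw [← Set.image_inter hf]; exact hne'.image f)
    exact (Set.image_subset_image_iff hf).1 this

theorem isModule_image_iff {H : Hypergraph α} {f : α → β} (hf : Function.Injective f) {M : Set α} :
    (H.image f).IsModule (f '' M) ↔ H.IsModule M := by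
  simp only [IsModule, Hypergraph.image_vertexSet, Set.image_subset_image_iff hf]
  refine and_congr_right fun _ => ?_
  simp only [Hypergraph.image_edgeSet, Set.forall_mem_image, Set.exists_mem_image,
    ← Set.image_inter hf, ← Set.image_sdiff hf, Set.image_nonempty, ← Set.image_singleton,
    ← Set.image_union, hf.image_injective.eq_iff, hf.image_injective.mem_set_image]

theorem sizePart_image {H : Hypergraph α} {f : α → β} (hf : Function.Injective f) (k : ℕ) :
    (H.image f).sizePart k = (H.sizePart k).image f := by
  ext e
  · rfl
  · constructor
    · rintro ⟨⟨e, he, rfl⟩, hk⟩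
      rw [Set.ncard_image_of_injective _ hf] at hk
      exact ⟨e, ⟨he, hk⟩, rfl⟩
    · rintro ⟨e, ⟨he, hk⟩, rfl⟩
      exact ⟨⟨e, he, rfl⟩, by rwa [Set.ncard_image_of_injective _ hf]⟩

theorem isTrivialModule_image_iff {H : Hypergraph α} {f : α → β} (hf : Function.Injective f)
    {M : Set α} : (H.image f).IsTrivialModule (f '' M) ↔ H.IsTrivialModule M := by
  simp only [IsTrivialModule, Hypergraph.image_vertexSet, Set.image_eq_empty,
    hf.image_injective.eq_iff, Set.exists_mem_image, ← Set.image_singleton]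

theorem isNontrivialModule23_image_iff {H : Hypergraph α} {f : α → β} (hf : Function.Injective f)
    {M : Set α} : (H.image f).IsNontrivialModule23 (f '' M) ↔ H.IsNontrivialModule23 M := by
  simp only [IsNontrivialModule23, IsModule23, sizePart_image hf, isModule_image_iff hf,
    isTrivialModule_image_iff hf]

theorem IsNontrivialModule23.subset_vertexSet {H : Hypergraph α} {M : Set α}
    (h : H.IsNontrivialModule23 M) : M ⊆ H.vertexSet :=
  h.1.1.1

end Hypergraph

/-! ### Blow-ups of a pattern of blocks and their edges. -/

/-- The standing conditions on a `{2,3}`-hypergraph `ℍ` on a set of blocks, `Ev` being the set of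
even blocks. -/
structure Hypergraph.IsBlockPattern {ι : Type*} (ℍ : Hypergraph ι) (Ev : Set ι) : Prop where
  vertexSet_eq : ℍ.vertexSet = Set.univ
  size : ∀ ε ∈ ℍ.edgeSet, ε.ncard = 2 ∨ ε.ncard = 3
  two : ∀ ε ∈ ℍ.edgeSet, ε.ncard = 2 → (ε ∩ Ev).Nonempty ∧ (ε \ Ev).Nonempty
  three : ∀ ε ∈ ℍ.edgeSet, ε.ncard = 3 → ∀ i ∈ ε, i ∉ Ev

/-- The triples of the blow-up of `ℍ`, where `c x` is the block of the vertex `x` and `p x` is its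
position in this block. -/
def BlockTriple {V ι : Type*} (c : V → ι) (p : V → ℕ) (Ev : Set ι) (ℍ : Hypergraph ι)
    (x y z : V) : Prop :=
  (c x = c y ∧ c y = c z ∧ c x ∉ Ev ∧ p x < p y ∧ p y < p z ∧
    p x % 2 = 0 ∧ p y % 2 = 1 ∧ p z % 2 = 0) ∨
  (c x = c y ∧ c x ∈ Ev ∧ c z ∉ Ev ∧ {c x, c z} ∈ ℍ.edgeSet ∧ p x < p y ∧
    p x % 2 = 0 ∧ p y % 2 = 1 ∧ p z % 2 = 0) ∨
  (c x ≠ c y ∧ c x ≠ c z ∧ c y ≠ c z ∧ c x ∉ Ev ∧ c y ∉ Ev ∧ c z ∉ Ev ∧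
    {c x, c y, c z} ∈ ℍ.edgeSet ∧ p x % 2 = 0 ∧ p y % 2 = 0 ∧ p z % 2 = 0)

/-- `H` is the blow-up of `ℍ` along the blocks `c` and the positions `p`. -/
structure Hypergraph.IsBlowUp {V ι : Type*} (H : Hypergraph V) (c : V → ι) (p : V → ℕ)
    (Ev : Set ι) (ℍ : Hypergraph ι) : Prop where
  vertexSet_eq : H.vertexSet = Set.univ
  mem_edgeSet : ∀ e, e ∈ H.edgeSet ↔ ∃ x y z, e = {x, y, z} ∧ BlockTriple c p Ev ℍ x y z

/-- The positions of the elements of `X` in each block alternate between even and odd, the first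
one being even, and the last one being odd exactly for the even blocks. -/
structure Alternates {V ι : Type*} (c : V → ι) (p : V → ℕ) (Ev : Set ι) (X : Set V) : Prop where
  inj : ∀ x y, c x = c y → p x = p y → x = y
  between : ∀ x ∈ X, ∀ y ∈ X, c x = c y → p x < p y → p x % 2 = p y % 2 →
    ∃ z ∈ X, c z = c x ∧ p x < p z ∧ p z < p y ∧ p z % 2 ≠ p x % 2
  before : ∀ y ∈ X, p y % 2 = 1 → ∃ x ∈ X, c x = c y ∧ p x < p y ∧ p x % 2 = 0
  after_odd : ∀ y ∈ X, c y ∉ Ev → p y % 2 = 1 → ∃ z ∈ X, c z = c y ∧ p y < p z ∧ p z % 2 = 0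
  after_even : ∀ y ∈ X, c y ∈ Ev → p y % 2 = 0 → ∃ z ∈ X, c z = c y ∧ p y < p z ∧ p z % 2 = 1

/-- The blocks which meet `X` in exactly one vertex. -/
def singletonBlocks {V ι : Type*} (c : V → ι) (X : Set V) : Set ι :=
  {i | ∃ x ∈ X, c x = i ∧ ∀ y ∈ X, c y = i → y = x}

theorem Hypergraph.IsBlockPattern.cases {ι : Type*} {ℍ : Hypergraph ι} {Ev : Set ι}
    (h : ℍ.IsBlockPattern Ev) {ε : Set ι} (hε : ε ∈ ℍ.edgeSet) :
    (∃ i ∈ Ev, ∃ j ∉ Ev, ε = {i, j}) ∨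
      ∃ i ∉ Ev, ∃ j ∉ Ev, ∃ k ∉ Ev, i ≠ j ∧ i ≠ k ∧ j ≠ k ∧ ε = {i, j, k} := by
  rcases h.size ε hε with h2 | h3
  · left
    obtain ⟨⟨i, hi, hiE⟩, j, hj, hjE⟩ := h.two ε hε h2
    obtain ⟨a, b, hab, rfl⟩ := Set.ncard_eq_two.1 h2
    simp only [Set.mem_insert_iff, Set.mem_singleton_iff] at hi hj
    rcases hi with rfl | rfl <;> rcases hj with rfl | rfl
    · exact absurd hiE hjE
    · exact ⟨i, hiE, j, hjE, rfl⟩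
    · exact ⟨i, hiE, j, hjE, Set.pair_comm _ _⟩
    · exact absurd hiE hjE
  · right
    have := h.three ε hε h3
    obtain ⟨a, b, d, hab, had, hbd, rfl⟩ := Set.ncard_eq_three.1 h3
    exact ⟨a, this a (by simp), b, this b (by simp), d, this d (by simp), hab, had, hbd, rfl⟩

namespace BlockTriple

variable {V ι : Type*} {c : V → ι} {p : V → ℕ} {Ev : Set ι} {ℍ : Hypergraph ι} {x y z : V}

theorem ne (h : BlockTriple c p Ev ℍ x y z) : x ≠ y ∧ x ≠ z ∧ y ≠ z := by
  refine ⟨?_, ?_, ?_⟩ <;> rintro rfl <;> unfold BlockTriple at h <;> grind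

end BlockTriple

namespace Hypergraph.IsBlowUp

variable {V ι : Type*} {c : V → ι} {p : V → ℕ} {Ev : Set ι} {ℍ : Hypergraph ι} {H : Hypergraph V}
  (h : H.IsBlowUp c p Ev ℍ)
include h

theorem ncard_eq_three : ∀ e ∈ H.edgeSet, e.ncard = 3 := by
  intro e he
  obtain ⟨x, y, z, rfl, ht⟩ := (h.mem_edgeSet e).1 he
  exact Set.ncard_eq_three.2 ⟨x, y, z, ht.ne.1, ht.ne.2.1, ht.ne.2.2, rfl⟩

theorem triple_mem {x y z : V} (ht : BlockTriple c p Ev ℍ x y z) : {x, y, z} ∈ H.edgeSet :=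
  (h.mem_edgeSet _).2 ⟨x, y, z, rfl, ht⟩

/-- `BlockTriple` assigns roles to its three arguments while an edge is a mere set, hence the six
orders. -/
theorem triple_mem_iff {x y z : V} : {x, y, z} ∈ H.edgeSet ↔
    BlockTriple c p Ev ℍ x y z ∨ BlockTriple c p Ev ℍ x z y ∨ BlockTriple c p Ev ℍ y x z ∨
    BlockTriple c p Ev ℍ y z x ∨ BlockTriple c p Ev ℍ z x y ∨ BlockTriple c p Ev ℍ z y x := by
  constructor
  · intro he
    obtain ⟨hxy, hxz, hyz⟩ := triple_ne_of_ncard (h.ncard_eq_three _ he)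
    obtain ⟨a, b, d, habd, ht⟩ := (h.mem_edgeSet _).1 he
    obtain ⟨hab, had, hbd⟩ := ht.ne
    have ha : a ∈ ({x, y, z} : Set V) := by rw [habd]; simp
    have hb : b ∈ ({x, y, z} : Set V) := by rw [habd]; simp
    have hd : d ∈ ({x, y, z} : Set V) := by rw [habd]; simp
    simp only [Set.mem_insert_iff, Set.mem_singleton_iff] at ha hb hd
    rcases ha with rfl | rfl | rfl <;> rcases hb with rfl | rfl | rfl <;>
      rcases hd with rfl | rfl | rfl <;> first | contradiction | simp [ht]
  · rintro (ht | ht | ht | ht | ht | ht)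
    · exact h.triple_mem ht
    · convert h.triple_mem ht using 1; ext; simp; tauto
    · convert h.triple_mem ht using 1; ext; simp; tauto
    · convert h.triple_mem ht using 1; ext; simp; tauto
    · convert h.triple_mem ht using 1; ext; simp; tauto
    · convert h.triple_mem ht using 1; ext; simp; tauto

theorem triple_mem_of_odd {a b d : V} (h1 : c a = c b) (h2 : c b = c d) (h3 : c a ∉ Ev)
    (h4 : p a < p b) (h5 : p b < p d) (h6 : p a % 2 = 0) (h7 : p b % 2 = 1) (h8 : p d % 2 = 0) :
    {a, b, d} ∈ H.edgeSet :=
  h.triple_mem (Or.inl ⟨h1, h2, h3, h4, h5, h6, h7, h8⟩)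

theorem triple_mem_of_even {a b d : V} (h1 : c a = c b) (h2 : c a ∈ Ev) (h3 : c d ∉ Ev)
    (he : {c a, c d} ∈ ℍ.edgeSet)
    (h4 : p a < p b) (h6 : p a % 2 = 0) (h7 : p b % 2 = 1) (h8 : p d % 2 = 0) :
    {a, b, d} ∈ H.edgeSet :=
  h.triple_mem (Or.inr (Or.inl ⟨h1, h2, h3, he, h4, h6, h7, h8⟩))

theorem mod_two_of_mem_of_even {x y z : V} (he : {x, y, z} ∈ H.edgeSet) (h1 : c x = c y)
    (hx : c x ∈ Ev) (hlt : p x < p y) : p x % 2 = 0 ∧ p y % 2 = 1 := by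
  rw [h.triple_mem_iff] at he
  unfold BlockTriple at he
  rcases he with (he | he | he) | (he | he | he) | (he | he | he) | (he | he | he) |
    (he | he | he) | (he | he | he) <;> grind

/-- In a triple inside an odd block the odd position is the middle one, never the first. -/
theorem not_mem_of_odd {x y z : V} (hx : c x ∉ Ev) (h1 : c x = c y) (h2 : c x = c z)
    (hx2 : p x % 2 = 1) (h3 : p x < p y) (h4 : p x < p z) : {x, y, z} ∉ H.edgeSet := by
  rw [h.triple_mem_iff]
  unfold BlockTriple
  grind

theorem not_mem_of_odd' {x y z : V} (hx : c x ∉ Ev) (h1 : c x = c y) (h2 : c z ≠ c x) :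
    {x, y, z} ∉ H.edgeSet := by
  rw [h.triple_mem_iff]
  unfold BlockTriple
  grind

theorem edge_of_mem_of_even {x y z : V} (he : {x, y, z} ∈ H.edgeSet) (hx : c x ∈ Ev)
    (h1 : c x = c y) : c z ∉ Ev ∧ {c x, c z} ∈ ℍ.edgeSet := by
  rw [h.triple_mem_iff] at he
  unfold BlockTriple at he
  rcases he with (he | he | he) | (he | he | he) | (he | he | he) | (he | he | he) |
    (he | he | he) | (he | he | he) <;> grind

theorem edge_of_mem_of_ne {x y z : V} (he : {x, y, z} ∈ H.edgeSet) (h1 : c x ≠ c y)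
    (h2 : c x ≠ c z) (h3 : c y ≠ c z) :
    c x ∉ Ev ∧ c y ∉ Ev ∧ c z ∉ Ev ∧ {c x, c y, c z} ∈ ℍ.edgeSet ∧
      p x % 2 = 0 ∧ p y % 2 = 0 ∧ p z % 2 = 0 := by
  rw [h.triple_mem_iff] at he
  unfold BlockTriple at he
  rcases he with he | he | he | he | he | he <;>
  · rcases he with he | he | he
    · grind
    · grind
    · refine ⟨by tauto, by tauto, by tauto, ?_, by tauto⟩
      convert he.2.2.2.2.2.2.1 using 1 <;> (ext; simp; try tauto)

/-- Odd positions occur only as the middle argument of the first two kinds of `BlockTriple`, where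
the first argument is an earlier vertex of the same block. -/
theorem exists_block_eq {x y z : V} (he : {x, y, z} ∈ H.edgeSet) (hx : p x % 2 = 1) :
    c y = c x ∨ c z = c x := by
  rw [h.triple_mem_iff] at he
  unfold BlockTriple at he
  rcases he with (he | he | he) | (he | he | he) | (he | he | he) | (he | he | he) |
    (he | he | he) | (he | he | he) <;> grind

theorem exists_before {x y z : V} (he : {x, y, z} ∈ H.edgeSet) (hx : p x % 2 = 1) :
    (c y = c x ∧ p y < p x ∧ p y % 2 = 0) ∨ (c z = c x ∧ p z < p x ∧ p z % 2 = 0) := by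
  rw [h.triple_mem_iff] at he
  unfold BlockTriple at he
  rcases he with (he | he | he) | (he | he | he) | (he | he | he) | (he | he | he) |
    (he | he | he) | (he | he | he) <;> grind

theorem exists_after {x y z : V} (he : {x, y, z} ∈ H.edgeSet)
    (hx : c x ∉ Ev ∧ p x % 2 = 1 ∨ c x ∈ Ev ∧ p x % 2 = 0) :
    (c y = c x ∧ p x < p y) ∨ (c z = c x ∧ p x < p z) := by
  rw [h.triple_mem_iff] at he
  unfold BlockTriple at he
  rcases he with (he | he | he) | (he | he | he) | (he | he | he) | (he | he | he) |
    (he | he | he) | (he | he | he) <;> grind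

theorem blocks_mem_edgeSet {x y z : V} (he : {x, y, z} ∈ H.edgeSet) :
    (c x = c y ∧ c x = c z) ∨ {c x, c y, c z} ∈ ℍ.edgeSet := by
  rw [h.triple_mem_iff] at he
  unfold BlockTriple at he
  rcases he with he | he | he | he | he | he <;>
  · rcases he with he | he | he
    · grind
    · right
      convert he.2.2.2.1 using 1
      ext; simp [he.1]; try tauto
    · right
      convert he.2.2.2.2.2.2.1 using 1 <;> (ext; simp; try tauto)

end Hypergraph.IsBlowUp

/-! ### Modules of an induced 3-hypergraph in terms of triples. -/

namespace Hypergraph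

theorem isModule_iff_of_ncard_eq_two {α : Type*} {H : Hypergraph α}
    (h2 : ∀ e ∈ H.edgeSet, e.ncard = 2) {M : Set α} :
    H.IsModule M ↔ M ⊆ H.vertexSet ∧ ∀ a d : α, {a, d} ∈ H.edgeSet → a ∈ M → d ∉ M →
      ∀ n ∈ M, {n, d} ∈ H.edgeSet := by
  refine and_congr_right fun _ => ⟨fun h a d he ha hd n hn => ?_,
    fun h e he ⟨a, hae, ha⟩ ⟨d, hde, hd⟩ => ?_⟩
  · obtain ⟨m, hm, hem, hn'⟩ := h _ he ⟨a, by simp, ha⟩ ⟨d, by simp, hd⟩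
    have ham : a = m := by
      have : a ∈ ({a, d} : Set α) ∩ M := ⟨by simp, ha⟩
      rwa [hem] at this
    subst ham
    convert hn' n hn using 1
    ext x
    simp only [Set.mem_insert_iff, Set.mem_singleton_iff, Set.mem_union, Set.mem_sdiff]
    grind
  · obtain ⟨x, y, hxy, rfl⟩ := Set.ncard_eq_two.1 (h2 e he)
    have : ({x, y} : Set α) = {a, d} := by
      ext z
      simp only [Set.mem_insert_iff, Set.mem_singleton_iff] at hae hde ⊢
      grind
    rw [this] at he ⊢
    refine ⟨a, ha, ?_, fun n hn => ?_⟩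
    · ext z
      simp only [Set.mem_insert_iff, Set.mem_singleton_iff, Set.mem_inter_iff]
      grind
    · convert h a d he ha hd n hn using 1
      ext z
      simp only [Set.mem_insert_iff, Set.mem_singleton_iff, Set.mem_union, Set.mem_sdiff]
      grind

/-- `M` is a module of the 3-hypergraph `H[X]`, in terms of triples. -/
structure IsTripleModule {V : Type*} (H : Hypergraph V) (X M : Set V) : Prop where
  subset : M ⊆ X
  swap : ∀ a b d, {a, b, d} ∈ H.edgeSet → a ∈ X → b ∈ X → d ∈ X → a ∈ M → d ∉ M →
    b ∉ M ∧ ∀ n ∈ M, {n, b, d} ∈ H.edgeSet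

theorem triple_rotate {V : Type*} (a b d : V) : ({a, b, d} : Set V) = {b, d, a} := by
  ext; simp; tauto

theorem triple_swap {V : Type*} (a b d : V) : ({a, b, d} : Set V) = {a, d, b} := by
  ext; simp; tauto

theorem rotate_mem {V : Type*} {S : Set (Set V)} {a b d : V} (h : {a, b, d} ∈ S) :
    {b, d, a} ∈ S :=
  triple_rotate a b d ▸ h

theorem swap_mem {V : Type*} {S : Set (Set V)} {a b d : V} (h : {a, b, d} ∈ S) :
    {a, d, b} ∈ S :=
  triple_swap a b d ▸ h

namespace IsTripleModule

variable {V : Type*} {H : Hypergraph V} {X M : Set V} (hM : H.IsTripleModule X M)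
include hM

theorem mem_of_mem_of_mem {a b d : V} (he : {a, b, d} ∈ H.edgeSet) (ha : a ∈ M) (hb : b ∈ M)
    (hd : d ∈ X) : d ∈ M := by
  by_contra hdM
  exact (hM.swap a b d he (hM.subset ha) (hM.subset hb) hd ha hdM).1 hb

/-- If the edge left `M`, exchanging `a` for `n` would have to succeed. Pairs without a common edge
can be exploited in this way. -/
theorem mem_of_not_mem {a b d n : V} (he : {a, b, d} ∈ H.edgeSet) (ha : a ∈ M) (hb : b ∈ X)
    (hd : d ∈ X) (hn : n ∈ M) (hne : {n, b, d} ∉ H.edgeSet) : b ∈ M ∧ d ∈ M := by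
  have key : d ∈ M := by
    by_contra hdM
    exact hne ((hM.swap a b d he (hM.subset ha) hb hd ha hdM).2 n hn)
  refine ⟨?_, key⟩
  rw [triple_swap] at he
  exact hM.mem_of_mem_of_mem he ha key hb

end IsTripleModule

theorem isModule_induce_iff {V : Type*} {H : Hypergraph V} (hV : H.vertexSet = Set.univ)
    (h3 : ∀ e ∈ H.edgeSet, e.ncard = 3) {X M : Set V} :
    (H.induce X).IsModule M ↔ H.IsTripleModule X M := by
  rw [isModule_iff_of_ncard_eq_three (H := H.induce X) (fun e he => h3 e he.1)]
  have hsub : ∀ a b d : V, {a, b, d} ⊆ X ↔ a ∈ X ∧ b ∈ X ∧ d ∈ X := by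
    intro a b d; simp [Set.insert_subset_iff]
  simp only [induce, hV, Set.univ_inter, Set.mem_ofPred_eq, hsub]
  constructor
  · rintro ⟨h1, h2⟩
    exact ⟨h1, fun a b d he ha hb hd haM hdM =>
      ⟨(h2 a b d ⟨he, ha, hb, hd⟩ haM hdM).1, fun n hn => ((h2 a b d ⟨he, ha, hb, hd⟩ haM hdM).2 n hn).1⟩⟩
  · rintro ⟨h1, h2⟩
    exact ⟨h1, fun a b d ⟨he, ha, hb, hd⟩ haM hdM =>
      ⟨(h2 a b d he ha hb hd haM hdM).1, fun n hn =>
        ⟨(h2 a b d he ha hb hd haM hdM).2 n hn, h1 hn, hb, hd⟩⟩⟩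

end Hypergraph

/-! ### Modules that meet a block in two vertices contain the block. -/

namespace Alternates

variable {V ι : Type*} {c : V → ι} {p : V → ℕ} {Ev : Set ι} {X : Set V} (hX : Alternates c p Ev X)
include hX

theorem exists_even {x : V} (hx : x ∈ X) : ∃ y ∈ X, c y = c x ∧ p y % 2 = 0 := by
  rcases Nat.mod_two_eq_zero_or_one (p x) with h | h
  · exact ⟨x, hx, rfl, h⟩
  · obtain ⟨y, hy, hyx, -, h⟩ := hX.before x hx h
    exact ⟨y, hy, hyx, h⟩

theorem singleton_spec {x : V} (hx : x ∈ X) (h : c x ∈ singletonBlocks c X) :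
    c x ∉ Ev ∧ p x % 2 = 0 ∧ ∀ y ∈ X, c y = c x → y = x := by
  obtain ⟨z, hz, hzx, huniq⟩ := h
  obtain rfl := huniq x hx rfl
  refine ⟨fun hE => ?_, ?_, huniq⟩
  · rcases Nat.mod_two_eq_zero_or_one (p x) with h | h
    · obtain ⟨y, hy, hyx, hlt, -⟩ := hX.after_even x hx hE h
      rw [huniq y hy hyx] at hlt
      exact lt_irrefl _ hlt
    · obtain ⟨y, hy, hyx, hlt, -⟩ := hX.before x hx h
      rw [huniq y hy hyx] at hlt
      exact lt_irrefl _ hlt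
  · rcases Nat.mod_two_eq_zero_or_one (p x) with h | h
    · exact h
    · obtain ⟨y, hy, hyx, hlt, -⟩ := hX.before x hx h
      rw [huniq y hy hyx] at hlt
      exact absurd hlt (lt_irrefl _)

variable {ℍ : Hypergraph ι} {H : Hypergraph V} (hH : H.IsBlowUp c p Ev ℍ)
include hH

/-- A second vertex in an odd block brings an odd position with it: one of `x`, `y`, or one between
them. If `x` is odd, it has even positions on both sides; if `x` is even, the odd position is
completed by an even one beyond it. -/
theorem exists_internal_triple {x y : V} (hx : x ∈ X) (hy : y ∈ X) (hxy : c x = c y) (hne : x ≠ y)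
    (ho : c x ∉ Ev) : ∃ s ∈ X, ∃ t ∈ X, c s = c x ∧ c t = c x ∧ {x, s, t} ∈ H.edgeSet := by
  rcases Nat.mod_two_eq_zero_or_one (p x) with h | h
  · obtain ⟨z, hz, hzx, hz2⟩ : ∃ z ∈ X, c z = c x ∧ p z % 2 = 1 := by
      rcases Nat.mod_two_eq_zero_or_one (p y) with h' | h'
      · have hp : p x ≠ p y := fun hp => hne (hX.inj x y hxy hp)
        rcases lt_or_gt_of_ne hp with hlt | hlt
        · obtain ⟨z, hz, hzx, -, -, hz2⟩ := hX.between x hx y hy hxy hlt (by omega)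
          exact ⟨z, hz, hzx, by omega⟩
        · obtain ⟨z, hz, hzx, -, -, hz2⟩ := hX.between y hy x hx hxy.symm hlt (by omega)
          exact ⟨z, hz, hzx.trans hxy.symm, by omega⟩
      · exact ⟨y, hy, hxy.symm, h'⟩
    rcases lt_trichotomy (p x) (p z) with hlt | heq | hlt
    · obtain ⟨t, ht, htz, hlt', ht2⟩ := hX.after_odd z hz (hzx ▸ ho) hz2
      exact ⟨z, hz, t, ht, hzx, htz.trans hzx,
        hH.triple_mem_of_odd hzx.symm htz.symm ho hlt hlt' h hz2 ht2⟩
    · omega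
    · obtain ⟨t, ht, htz, hlt', ht2⟩ := hX.before z hz hz2
      exact ⟨t, ht, z, hz, htz.trans hzx, hzx, Hypergraph.rotate_mem (Hypergraph.rotate_mem
        (hH.triple_mem_of_odd htz hzx (by rwa [htz, hzx]) hlt' hlt ht2 hz2 h))⟩
  · obtain ⟨s, hs, hsz, hlt, hs2⟩ := hX.before x hx h
    obtain ⟨t, ht, htz, hlt', ht2⟩ := hX.after_odd x hx ho h
    exact ⟨t, ht, s, hs, htz, hsz, Hypergraph.rotate_mem
      (hH.triple_mem_of_odd hsz htz.symm (by rwa [hsz]) hlt hlt' hs2 h ht2)⟩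

theorem exists_partner {x w : V} (hx : x ∈ X) (hE : c x ∈ Ev) (hw : c w ∉ Ev)
    (he : {c x, c w} ∈ ℍ.edgeSet) (hw2 : p w % 2 = 0) :
    ∃ y ∈ X, c y = c x ∧ {x, y, w} ∈ H.edgeSet := by
  rcases Nat.mod_two_eq_zero_or_one (p x) with h | h
  · obtain ⟨y, hy, hyx, hlt, h'⟩ := hX.after_even x hx hE h
    exact ⟨y, hy, hyx, hH.triple_mem_of_even hyx.symm hE hw he hlt h h' hw2⟩
  · obtain ⟨y, hy, hyx, hlt, h'⟩ := hX.before x hx h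
    refine ⟨y, hy, hyx, Hypergraph.swap_mem (Hypergraph.rotate_mem
      (hH.triple_mem_of_even hyx (by rwa [hyx]) hw (by rwa [hyx]) hlt h' h hw2))⟩

variable {M : Set V} (hM : H.IsTripleModule X M)
include hM

/-- Two vertices of an edge in `M` pull in the third. From an even position before an odd one this
reaches a later even position, then all even ones, then the odd ones between them. The other
parities are reduced to this case (`core`). -/
theorem block_subset_of_odd {x y : V} (hx : x ∈ M) (hy : y ∈ M) (hxy : c x = c y) (hne : x ≠ y)
    (ho : c x ∉ Ev) : ∀ z ∈ X, c z = c x → z ∈ M := by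
  have core : ∀ x ∈ M, ∀ y ∈ M, c x = c y → c x ∉ Ev → p x < p y → p x % 2 = 0 → p y % 2 = 1 →
      ∀ z ∈ X, c z = c x → z ∈ M := by
    intro x hx y hy hxy ho hlt hx2 hy2
    obtain ⟨d, hd, hdy, hyd, hd2⟩ := hX.after_odd y (hM.subset hy) (hxy ▸ ho) hy2
    have hdM : d ∈ M := hM.mem_of_mem_of_mem
      (hH.triple_mem_of_odd hxy hdy.symm ho hlt hyd hx2 hy2 hd2) hx hy hd
    have hev : ∀ z ∈ X, c z = c x → p z % 2 = 0 → z ∈ M := by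
      intro z hz hzx hz2
      rcases lt_trichotomy (p z) (p y) with h | h | h
      · exact hM.mem_of_mem_of_mem (Hypergraph.rotate_mem (hH.triple_mem_of_odd (hzx.trans hxy)
          hdy.symm (by rwa [hzx]) h hyd hz2 hy2 hd2)) hy hdM hz
      · omega
      · exact hM.mem_of_mem_of_mem (hH.triple_mem_of_odd hxy
          (hxy.symm.trans hzx.symm) ho hlt h hx2 hy2 hz2) hx hy hz
    intro z hz hzx
    rcases Nat.mod_two_eq_zero_or_one (p z) with h | h
    · exact hev z hz hzx h
    · obtain ⟨s, hs, hsz, hlt, hs2⟩ := hX.before z hz h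
      obtain ⟨t, ht, htz, hlt', ht2⟩ := hX.after_odd z hz (hzx ▸ ho) h
      exact hM.mem_of_mem_of_mem (Hypergraph.swap_mem (hH.triple_mem_of_odd hsz htz.symm
        (by rwa [hsz, hzx]) hlt hlt' hs2 h ht2)) (hev s hs (hsz.trans hzx) hs2)
        (hev t ht (htz.trans hzx) ht2) hz
  have key : ∀ x ∈ M, ∀ y ∈ M, c x = c y → c x ∉ Ev → p x < p y →
      ∀ z ∈ X, c z = c x → z ∈ M := by
    intro x hx y hy hxy ho hlt
    rcases Nat.mod_two_eq_zero_or_one (p x) with h | h <;>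
      rcases Nat.mod_two_eq_zero_or_one (p y) with h' | h'
    · obtain ⟨b, hb, hbx, hlt1, hlt2, hb2⟩ :=
        hX.between x (hM.subset hx) y (hM.subset hy) hxy hlt (by omega)
      have hbM : b ∈ M := hM.mem_of_mem_of_mem (Hypergraph.swap_mem (hH.triple_mem_of_odd hbx.symm
        (hbx.trans hxy) ho hlt1 hlt2 h (by omega) h')) hx hy hb
      exact core x hx b hbM hbx.symm ho hlt1 h (by omega)
    · exact core x hx y hy hxy ho hlt h h'
    · obtain ⟨a, ha, hax, hlt', ha2⟩ := hX.before x (hM.subset hx) h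
      have haM : a ∈ M := hM.mem_of_mem_of_mem (Hypergraph.rotate_mem (hH.triple_mem_of_odd hax
        hxy (by rwa [hax]) hlt' hlt ha2 h h')) hx hy ha
      have := core a haM x hx hax (by rwa [hax]) hlt' ha2 h
      rwa [hax] at this
    · obtain ⟨a, ha, hax, hlt1, hlt2, ha2⟩ :=
        hX.between x (hM.subset hx) y (hM.subset hy) hxy hlt (by omega)
      obtain ⟨d, hd, hdy, hyd, hd2⟩ := hX.after_odd y (hM.subset hy) (hxy ▸ ho) h'
      -- No triple inside the block has two odd positions. Instead, `a`, `y`, `d` form an edge, and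
      -- replacing `y` by `x` destroys it because `x` would be an odd first position; hence the edge
      -- lies in `M`.
      have he := Hypergraph.rotate_mem (hH.triple_mem_of_odd (hax.trans hxy) hdy.symm
        (by rwa [hax]) hlt2 hyd (by omega) h' hd2)
      have haM : a ∈ M := (hM.mem_of_not_mem he hy hd ha hx (hH.not_mem_of_odd ho
        (hxy.trans hdy.symm) hax.symm h (by omega) hlt1)).2
      have := core a haM y hy (hax.trans hxy) (by rwa [hax]) hlt2 (by omega) h'
      rwa [hax] at this
  have hp : p x ≠ p y := fun hp => hne (hX.inj x y hxy hp)
  rcases lt_or_gt_of_ne hp with hlt | hlt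
  · exact key x hx y hy hxy ho hlt
  · have := key y hy x hx hxy.symm (hxy ▸ ho) hlt
    rwa [← hxy] at this

/-- Together with `w`, the pairs of block vertices that form an edge are exactly an even position
followed by a later odd one, a half graph. A pair of this kind in `M` puts `w` into `M` and spreads
over the block. For any other two vertices of `M` in the block, some third vertex forms such a pair
with one of them but not with the other, and therefore belongs to `M`. -/
theorem block_subset_of_even {x y w : V} (hx : x ∈ M) (hy : y ∈ M) (hxy : c x = c y) (hne : x ≠ y)
    (hE : c x ∈ Ev) (hwX : w ∈ X) (hw : c w ∉ Ev) (he : {c x, c w} ∈ ℍ.edgeSet)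
    (hw2 : p w % 2 = 0) : ∀ z ∈ X, c z = c x → z ∈ M := by
  have mk : ∀ a b, c a = c x → c b = c x → p a < p b → p a % 2 = 0 → p b % 2 = 1 →
      {a, b, w} ∈ H.edgeSet := fun a b ha hb hlt ha2 hb2 =>
    hH.triple_mem_of_even (ha.trans hb.symm) (by rwa [ha]) hw (by rwa [ha]) hlt ha2 hb2 hw2
  have nmk : ∀ a b, c a = c x → c b = c x → p a < p b → ¬ (p a % 2 = 0 ∧ p b % 2 = 1) →
      {a, b, w} ∉ H.edgeSet := fun a b ha hb hlt hn hab =>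
    hn (hH.mod_two_of_mem_of_even hab (ha.trans hb.symm) (by rwa [ha]) hlt)
  have core : ∀ a ∈ M, ∀ b ∈ M, c a = c x → c b = c x → p a < p b → p a % 2 = 0 → p b % 2 = 1 →
      ∀ z ∈ X, c z = c x → z ∈ M := by
    intro a ha b hb hax hbx hlt ha2 hb2
    have hwM : w ∈ M := hM.mem_of_mem_of_mem (mk a b hax hbx hlt ha2 hb2) ha hb hwX
    have hodd : ∀ z ∈ X, c z = c x → p z % 2 = 1 → p a < p z → z ∈ M := fun z hz hzx hz2 hlt =>
      hM.mem_of_mem_of_mem (Hypergraph.swap_mem (mk a z hax hzx hlt ha2 hz2)) ha hwM hz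
    have hodd' : ∀ z ∈ X, c z = c x → p z % 2 = 1 → z ∈ M := by
      intro z hz hzx hz2
      obtain ⟨s, hs, hsz, hlt', hs2⟩ := hX.before z hz hz2
      by_cases h : p a < p z
      · exact hodd z hz hzx hz2 h
      · have hsM : s ∈ M := hM.mem_of_mem_of_mem (Hypergraph.rotate_mem
          (mk s b (hsz.trans hzx) hbx (by omega) hs2 hb2)) hb hwM hs
        exact hM.mem_of_mem_of_mem (Hypergraph.swap_mem
          (mk s z (hsz.trans hzx) hzx hlt' hs2 hz2)) hsM hwM hz
    intro z hz hzx
    rcases Nat.mod_two_eq_zero_or_one (p z) with h | h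
    · obtain ⟨t, ht, htz, hlt', ht2⟩ := hX.after_even z hz (by rwa [hzx]) h
      exact hM.mem_of_mem_of_mem (Hypergraph.rotate_mem (mk z t hzx (htz.trans hzx) hlt' h ht2))
        (hodd' t ht (htz.trans hzx) ht2) hwM hz
    · exact hodd' z hz hzx h
  have key : ∀ a ∈ M, ∀ b ∈ M, c a = c x → c b = c x → p a < p b →
      ∀ z ∈ X, c z = c x → z ∈ M := by
    intro a ha b hb hax hbx hlt
    have haX := hM.subset ha
    have hbX := hM.subset hb
    rcases Nat.mod_two_eq_zero_or_one (p a) with h | h <;>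
      rcases Nat.mod_two_eq_zero_or_one (p b) with h' | h'
    · obtain ⟨s, hs, hsa, hlt1, hlt2, hs2⟩ :=
        hX.between a haX b hbX (hax.trans hbx.symm) hlt (by omega)
      have hsM := (hM.mem_of_not_mem (mk a s hax (hsa.trans hax) hlt1 h (by omega)) ha hs hwX hb
        (fun hn => nmk s b (hsa.trans hax) hbx hlt2 (by omega)
          (Hypergraph.swap_mem (Hypergraph.rotate_mem hn)))).1
      exact core a ha s hsM hax (hsa.trans hax) hlt1 h (by omega)
    · exact core a ha b hb hax hbx hlt h h'
    · obtain ⟨s, hs, hsa, hlt', hs2⟩ := hX.before a haX h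
      have hsM := (hM.mem_of_not_mem (Hypergraph.rotate_mem
        (mk s a (hsa.trans hax) hax hlt' hs2 h)) ha hwX hs hb
        (fun hn => nmk s b (hsa.trans hax) hbx (by omega) (by omega)
          (Hypergraph.rotate_mem (Hypergraph.rotate_mem hn)))).2
      exact core s hsM a ha (hsa.trans hax) hax hlt' hs2 h
    · obtain ⟨s, hs, hsa, hlt1, hlt2, hs2⟩ :=
        hX.between a haX b hbX (hax.trans hbx.symm) hlt (by omega)
      have hsM := (hM.mem_of_not_mem (Hypergraph.rotate_mem
        (mk s b (hsa.trans hax) hbx hlt2 (by omega) h')) hb hwX hs ha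
        (fun hn => nmk a s hax (hsa.trans hax) hlt1 (by omega)
          (Hypergraph.swap_mem hn))).2
      exact core s hsM b hb (hsa.trans hax) hbx hlt2 (by omega) h'
  have hp : p x ≠ p y := fun hp => hne (hX.inj x y hxy hp)
  rcases lt_or_gt_of_ne hp with hlt | hlt
  · exact key x hx y hy rfl hxy.symm hlt
  · exact key y hy x hx hxy.symm rfl hlt

end Alternates

/-! ### Primality of an alternating restriction in terms of the pattern. -/

namespace Alternates

open Hypergraph

variable {V ι : Type*} {c : V → ι} {p : V → ℕ} {Ev : Set ι} {X : Set V} {ℍ : Hypergraph ι}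
  {H : Hypergraph V} {M : Set V} (hX : Alternates c p Ev X) (hH : H.IsBlowUp c p Ev ℍ)
  (hP : ℍ.IsBlockPattern Ev)
include hX hH hP

omit hX hH in
-- Edges of size 3 avoid even blocks, so an even block that is not alone can only be connected to
-- the rest by an edge of size 2, whose other end is odd.
theorem exists_edge_of_even (hconn : (ℍ.induce (c '' X)).IsConnected) {i : ι} (hi : i ∈ Ev)
    (hiX : i ∈ c '' X) (hne : ∃ x ∈ X, c x ≠ i) :
    ∃ j ∈ c '' X, j ∉ Ev ∧ {i, j} ∈ ℍ.edgeSet := by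
  by_contra! hcon
  have hV : (ℍ.induce (c '' X)).vertexSet = c '' X := by simp [induce, hP.vertexSet_eq]
  have := (isConnected_iff.1 hconn).2 {i} (by simpa [hV] using hiX) (Set.singleton_nonempty i) ?_
  · obtain ⟨x, hx, hxi⟩ := hne
    have hx' : c x ∈ (ℍ.induce (c '' X)).vertexSet := by rw [hV]; exact ⟨x, hx, rfl⟩
    rw [← this] at hx'
    exact hxi hx'
  · rintro ε ⟨hε, hεX⟩ ⟨_, hiε, rfl⟩
    exfalso
    rcases hP.cases hε with ⟨a, ha, b, hb, rfl⟩ | ⟨a, ha, b, hb, d, hd, -, -, -, rfl⟩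
    · simp only [Set.mem_insert_iff, Set.mem_singleton_iff] at hiε
      rcases hiε with rfl | rfl
      · exact hcon b (hεX (by simp)) hb hε
      · exact hb hi
    · simp only [Set.mem_insert_iff, Set.mem_singleton_iff] at hiε
      rcases hiε with rfl | rfl | rfl <;> contradiction

theorem block_subset (hconn : (ℍ.induce (c '' X)).IsConnected)
    (hns : ∀ i ∈ Ev, ∃ x ∈ X, c x ≠ i) (hM : H.IsTripleModule X M)
    {x y : V} (hx : x ∈ M) (hy : y ∈ M) (hxy : c x = c y) (hne : x ≠ y) :
    ∀ z ∈ X, c z = c x → z ∈ M := by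
  by_cases hE : c x ∈ Ev
  · obtain ⟨_, ⟨w, hw, rfl⟩, hwE, he⟩ := exists_edge_of_even hP hconn hE ⟨x, hM.subset hx, rfl⟩
      (hns _ hE)
    obtain ⟨w', hw', hww, hw2⟩ := hX.exists_even hw
    rw [← hww] at hwE he
    exact hX.block_subset_of_even hH hM hx hy hxy hne hE hw' hwE he hw2
  · exact hX.block_subset_of_odd hH hM hx hy hxy hne hE

omit hX hP in
/-- A module which contains a block with an odd position contains every edge which it meets. -/
theorem edge_subset (hM : H.IsTripleModule X M) {o : V} (ho : o ∈ M) (ho2 : p o % 2 = 1)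
    (hoM : ∀ z ∈ X, c z = c o → z ∈ M) {a b d : V} (he : {a, b, d} ∈ H.edgeSet)
    (ha : a ∈ M) (hb : b ∈ X) (hd : d ∈ X) : b ∈ M ∧ d ∈ M := by
  have key : d ∈ M := by
    -- Otherwise `a` could be exchanged for `o`. An odd position needs another vertex of its own
    -- block in the edge, but that block lies in `M` whereas `b` and `d` do not.
    by_contra hdM
    obtain ⟨hbM, h⟩ := hM.swap a b d he (hM.subset ha) hb hd ha hdM
    rcases hH.exists_block_eq (h o ho) ho2 with h | h
    · exact hbM (hoM b hb h)
    · exact hdM (hoM d hd h)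
  exact ⟨hM.mem_of_mem_of_mem (swap_mem he) ha key hb, key⟩

/-- A block with two vertices has an odd position, so by `edge_subset` the module absorbs every edge
it meets. The blocks contained in `M` therefore absorb every edge of the pattern they meet, and
connectedness yields all blocks. -/
theorem eq_of_block_subset (hconn : (ℍ.induce (c '' X)).IsConnected) (hM : H.IsTripleModule X M)
    {x y : V} (hx : x ∈ M) (hy : y ∈ M) (hxy : c x = c y) (hne : x ≠ y)
    (hsub : ∀ z ∈ X, c z = c x → z ∈ M) : M = X := by
  have hV : (ℍ.induce (c '' X)).vertexSet = c '' X := by simp [induce, hP.vertexSet_eq]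
  obtain ⟨o, ho, hox, ho2⟩ : ∃ o ∈ M, c o = c x ∧ p o % 2 = 1 := by
    have hp : p x ≠ p y := fun hp => hne (hX.inj x y hxy hp)
    rcases Nat.mod_two_eq_zero_or_one (p x) with h | h <;>
      rcases Nat.mod_two_eq_zero_or_one (p y) with h' | h'
    · rcases lt_or_gt_of_ne hp with hlt | hlt
      · obtain ⟨z, hz, hzx, -, -, hz2⟩ :=
          hX.between x (hM.subset hx) y (hM.subset hy) hxy hlt (by omega)
        exact ⟨z, hsub z hz hzx, hzx, by omega⟩
      · obtain ⟨z, hz, hzx, -, -, hz2⟩ :=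
          hX.between y (hM.subset hy) x (hM.subset hx) hxy.symm hlt (by omega)
        exact ⟨z, hsub z hz (hzx.trans hxy.symm), hzx.trans hxy.symm, by omega⟩
    · exact ⟨y, hy, hxy.symm, h'⟩
    · exact ⟨x, hx, rfl, h⟩
    · exact ⟨x, hx, rfl, h⟩
  have hcl : ∀ {a b d : V}, {a, b, d} ∈ H.edgeSet → a ∈ M → b ∈ X → d ∈ X → b ∈ M ∧ d ∈ M :=
    fun he ha hb hd => edge_subset hH hM ho ho2 (by rwa [hox]) he ha hb hd
  -- Even positions suffice in an odd block: an odd position lies in a triple with an even one on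
  -- each side.
  have hodd : ∀ j ∉ Ev, (∀ z ∈ X, c z = j → p z % 2 = 0 → z ∈ M) → ∀ z ∈ X, c z = j → z ∈ M := by
    rintro j hj h z hz rfl
    rcases Nat.mod_two_eq_zero_or_one (p z) with h2 | h2
    · exact h z hz rfl h2
    · obtain ⟨s, hs, hsz, hlt, hs2⟩ := hX.before z hz h2
      obtain ⟨t, ht, htz, hlt', ht2⟩ := hX.after_odd z hz hj h2
      exact (hcl (hH.triple_mem_of_odd hsz htz.symm (by rwa [hsz]) hlt hlt' hs2 h2 ht2)
        (h s hs hsz hs2) hz ht).1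
  have hmem : ∀ i j k, i ∉ Ev → j ∉ Ev → k ∉ Ev → i ≠ j → i ≠ k → j ≠ k → i ∈ c '' X →
      k ∈ c '' X → {i, j, k} ∈ ℍ.edgeSet → (∀ z ∈ X, c z = i → z ∈ M) →
      ∀ z ∈ X, c z = j → z ∈ M := by
    rintro _ j _ hi hj hk hij hik hjk ⟨u, hu, rfl⟩ ⟨w, hw, rfl⟩ he hiM
    refine hodd j hj ?_
    rintro z hz rfl hz2
    obtain ⟨u', hu', huu, hu2⟩ := hX.exists_even hu
    obtain ⟨w', hw', hww, hw2⟩ := hX.exists_even hw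
    rw [← huu] at hi hij hik he
    rw [← hww] at hk hjk he hik
    exact (hcl (hH.triple_mem (Or.inr (Or.inr ⟨hij, hik, hjk, hi, hj, hk, he, hu2, hz2, hw2⟩)))
      (hiM u' hu' huu) hz hw').1
  have hK := (isConnected_iff.1 hconn).2 {i | i ∈ c '' X ∧ ∀ z ∈ X, c z = i → z ∈ M}
    (fun i hi => by rw [hV]; exact hi.1) ⟨c x, ⟨x, hM.subset hx, rfl⟩, hsub⟩ ?_
  · refine hM.subset.antisymm fun z hz => ?_
    have : c z ∈ (ℍ.induce (c '' X)).vertexSet := by rw [hV]; exact ⟨z, hz, rfl⟩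
    rw [← hK] at this
    exact this.2 z hz rfl
  · rintro ε ⟨hε, hεX⟩ ⟨l, hlε, hlX, hlM⟩
    rcases hP.cases hε with ⟨i, hi, j, hj, rfl⟩ | ⟨i, hi, j, hj, k, hk, hij, hik, hjk, rfl⟩
    · have hiX : i ∈ c '' X := hεX (by simp)
      have hjX : j ∈ c '' X := hεX (by simp)
      simp only [Set.mem_insert_iff, Set.mem_singleton_iff] at hlε
      rintro m hm
      refine ⟨hεX hm, ?_⟩
      simp only [Set.mem_insert_iff, Set.mem_singleton_iff] at hm
      rcases hlε with rfl | rfl <;> rcases hm with rfl | rfl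
      · exact hlM
      · obtain ⟨u, hu, rfl⟩ := hiX
        refine hodd m hj ?_
        rintro z hz rfl hz2
        obtain ⟨y, hy, hyu, he⟩ := hX.exists_partner hH hu hi hj hε hz2
        exact (hcl he (hlM u hu rfl) hy hz).2
      · obtain ⟨w, hw, rfl⟩ := hjX
        obtain ⟨w', hw', hww, hw2⟩ := hX.exists_even hw
        rintro z hz rfl
        rw [← hww] at hj hε
        obtain ⟨y, hy, hyu, he⟩ := hX.exists_partner hH hz hi hj hε hw2
        exact (hcl (rotate_mem (rotate_mem he)) (hlM w' hw' hww) hz hy).1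
      · exact hlM
    · have hiX : i ∈ c '' X := hεX (by simp)
      have hjX : j ∈ c '' X := hεX (by simp)
      have hkX : k ∈ c '' X := hεX (by simp)
      simp only [Set.mem_insert_iff, Set.mem_singleton_iff] at hlε
      rintro m hm
      refine ⟨hεX hm, ?_⟩
      simp only [Set.mem_insert_iff, Set.mem_singleton_iff] at hm
      rcases hlε with rfl | rfl | rfl <;> rcases hm with rfl | rfl | rfl
      · exact hlM
      · exact hmem l m k hi hj hk hij hik hjk hlX hkX hε hlM
      · exact hmem l m j hi hk hj hik hij hjk.symm hlX hjX (swap_mem hε) hlM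
      · exact hmem l m k hj hi hk hij.symm hjk hik hlX hkX
          (swap_mem (rotate_mem hε)) hlM
      · exact hlM
      · exact hmem l m i hj hk hi hjk hij.symm hik.symm hlX hiX (rotate_mem hε) hlM
      · exact hmem l m j hk hi hj hik.symm hjk.symm hij hlX hjX
          (rotate_mem (rotate_mem hε)) hlM
      · exact hmem l m i hk hj hi hjk.symm hik.symm hij.symm hlX hiX
          (swap_mem (rotate_mem (rotate_mem hε))) hlM
      · exact hlM

/-- A module with at least two vertices which meets each block at most once only meets
one-vertex blocks. -/
theorem block_mem_singletonBlocks (hconn : (ℍ.induce (c '' X)).IsConnected)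
    (hM : H.IsTripleModule X M) (hinj : ∀ x ∈ M, ∀ y ∈ M, c x = c y → x = y)
    (hnt : M.Nontrivial) {x : V} (hx : x ∈ M) : c x ∈ singletonBlocks c X := by
  have hother : ∀ x ∈ M, ∃ y ∈ M, c y ≠ c x := by
    intro x hx
    obtain ⟨y, hy, hyx⟩ := hnt.exists_ne x
    exact ⟨y, hy, fun h => hyx (hinj y hy x hx h)⟩
  have hodd : ∀ x ∈ M, c x ∉ Ev → c x ∈ singletonBlocks c X := by
    intro x hx hE
    by_contra hns
    obtain ⟨x', hx', hcx, hne⟩ : ∃ x' ∈ X, c x = c x' ∧ x ≠ x' := by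
      by_contra! hcon
      exact hns ⟨x, hM.subset hx, rfl, fun y hy h => (hcon y hy h.symm).symm⟩
    obtain ⟨s, hs, t, ht, hsx, htx, he⟩ :=
      hX.exists_internal_triple hH (hM.subset hx) hx' hcx hne hE
    obtain ⟨hxs, hxt, hst⟩ := triple_ne_of_ncard (hH.ncard_eq_three _ he)
    obtain ⟨y, hy, hyx⟩ := hother x hx
    have htM : t ∉ M := fun h => hxt (hinj x hx t h htx.symm)
    -- Exchanging `x` for a vertex of another block gives an edge with exactly two vertices in an
    -- odd block, which does not exist.
    have := (hM.swap x s t he (hM.subset hx) hs ht hx htM).2 y hy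
    exact hH.not_mem_of_odd' (by rwa [hsx]) (hsx.trans htx.symm) (by rwa [hsx]) (rotate_mem this)
  by_cases hE : c x ∈ Ev
  -- In an even block, exchanging `x` for `y` in the edge formed by `x`, its partner `x'` and `w'`
  -- leaves `x'` alone in its even block. This is impossible when the blocks are distinct; if `y`
  -- shares the block of `w'`, that one-vertex block forces `y = w'`.
  · exfalso
    obtain ⟨y, hy, hyx⟩ := hother x hx
    obtain ⟨_, ⟨w, hw, rfl⟩, hwE, he⟩ := exists_edge_of_even hP hconn hE ⟨x, hM.subset hx, rfl⟩
      ⟨y, hM.subset hy, hyx⟩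
    obtain ⟨w', hw', hww, hw2⟩ := hX.exists_even hw
    rw [← hww] at hwE he
    obtain ⟨x', hx', hxx, he'⟩ := hX.exists_partner hH (hM.subset hx) hE hwE he hw2
    obtain ⟨hne, -, -⟩ := triple_ne_of_ncard (hH.ncard_eq_three _ he')
    have hx'M : x' ∉ M := fun h => hne (hinj x hx x' h hxx.symm)
    by_cases hwM : w' ∈ M
    · exact hx'M (hM.mem_of_mem_of_mem (swap_mem he') hx hwM hx')
    · have hs := (hM.swap x x' w' he' (hM.subset hx) hx' hw' hx hwM).2 y hy
      by_cases hyw : c y = c w'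
      · have := (hX.singleton_spec (hM.subset hy) (hodd y hy (hyw ▸ hwE))).2.2 w' hw' hyw.symm
        exact hwM (this ▸ hy)
      · exact (hH.edge_of_mem_of_ne hs (by rwa [hxx]) hyw
          (fun h => hwE (by rwa [← h, hxx]))).2.1 (by rwa [hxx])
  · exact hodd x hx hE

/-- A one-vertex block is odd with its vertex at an even position, so every edge of the pattern
through it lifts to an edge through that vertex. The exchange is made upstairs and projected back.
-/
theorem isModule23_image (hM : H.IsTripleModule X M)
    (hs : ∀ x ∈ M, c x ∈ singletonBlocks c X) : (ℍ.induce (c '' X)).IsModule23 (c '' M) := by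
  have hsub : c '' M ⊆ c '' X := Set.image_mono hM.subset
  have hspec : ∀ x ∈ M, c x ∉ Ev ∧ p x % 2 = 0 ∧ ∀ y ∈ X, c y = c x → y = x :=
    fun x hx => hX.singleton_spec (hM.subset hx) (hs x hx)
  have hmem : ∀ y ∈ X, c y ∈ c '' M → y ∈ M := by
    rintro y hy ⟨x, hx, hxy⟩
    rwa [(hspec x hx).2.2 y hy hxy.symm]
  constructor
  · rw [isModule_iff_of_ncard_eq_two (H := sizePart _ 2) (fun e he => he.2)]
    refine ⟨by simpa [sizePart, induce, hP.vertexSet_eq] using hsub, ?_⟩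
    rintro _ i ⟨⟨he, heX⟩, hcard⟩ ⟨x, hx, rfl⟩ hi _ ⟨y, hy, rfl⟩
    obtain ⟨z, hz, rfl⟩ : i ∈ c '' X := heX (by simp)
    have hzE : c z ∈ Ev := by
      obtain ⟨l, hl, hlE⟩ := (hP.two _ he hcard).1
      simp only [Set.mem_insert_iff, Set.mem_singleton_iff] at hl
      rcases hl with rfl | rfl
      · exact absurd hlE (hspec x hx).1
      · exact hlE
    obtain ⟨w, hw, hwz, he'⟩ := hX.exists_partner hH hz hzE (hspec x hx).1
      (by rwa [Set.pair_comm]) (hspec x hx).2.1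
    have hzM : z ∉ M := fun h => hi ⟨z, h, rfl⟩
    have := (hM.swap x w z (swap_mem (rotate_mem (rotate_mem he'))) (hM.subset hx) hw hz hx hzM).2
      y hy
    have h2 := (hH.edge_of_mem_of_even (rotate_mem this) (by rwa [hwz]) hwz).2
    rw [hwz, Set.pair_comm] at h2
    have hyz : c y ≠ c z := fun h => hi ⟨y, hy, h⟩
    refine ⟨⟨h2, ?_⟩, Set.ncard_pair hyz⟩
    rintro j (rfl | rfl)
    · exact hsub ⟨y, hy, rfl⟩
    · exact ⟨z, hz, rfl⟩
  · rw [isModule_iff_of_ncard_eq_three (H := sizePart _ 3) (fun e he => he.2)]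
    refine ⟨by simpa [sizePart, induce, hP.vertexSet_eq] using hsub, ?_⟩
    rintro _ i j ⟨⟨he, heX⟩, hcard⟩ ⟨x, hx, rfl⟩ hj
    obtain ⟨u, hu, rfl⟩ : i ∈ c '' X := heX (by simp)
    obtain ⟨w, hw, rfl⟩ : j ∈ c '' X := heX (by simp)
    obtain ⟨hxu, hxw, huw⟩ := triple_ne_of_ncard hcard
    have hE := hP.three _ he hcard
    obtain ⟨u', hu', huu, hu2⟩ := hX.exists_even hu
    obtain ⟨w', hw', hww, hw2⟩ := hX.exists_even hw
    rw [← huu] at he hxu huw hE heX ⊢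
    rw [← hww] at he hxw huw hE hj heX ⊢
    have ht := hH.triple_mem (Or.inr (Or.inr ⟨hxu, hxw, huw, hE _ (by simp), hE _ (by simp),
      hE _ (by simp), he, (hspec x hx).2.1, hu2, hw2⟩))
    have hw'M : w' ∉ M := fun h => hj ⟨w', h, rfl⟩
    obtain ⟨h1, h2⟩ := hM.swap x u' w' ht (hM.subset hx) hu' hw' hx hw'M
    have hu'M : c u' ∉ c '' M := fun h => h1 (hmem u' hu' h)
    refine ⟨hu'M, ?_⟩
    rintro _ ⟨y, hy, rfl⟩
    have hyu : c y ≠ c u' := fun h => hu'M ⟨y, hy, h⟩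
    have hyw : c y ≠ c w' := fun h => hj ⟨y, hy, h⟩
    refine ⟨⟨(hH.edge_of_mem_of_ne (h2 y hy) hyu hyw huw).2.2.2.1, ?_⟩,
      Set.ncard_eq_three.2 ⟨_, _, _, hyu, hyw, huw, rfl⟩⟩
    rintro l (rfl | rfl | rfl)
    · exact hsub ⟨y, hy, rfl⟩
    · exact ⟨u', hu', rfl⟩
    · exact ⟨w', hw', rfl⟩

theorem isIndecomposable_of (hns : ∀ i ∈ Ev, ∃ x ∈ X, c x ≠ i)
    (hconn : (ℍ.induce (c '' X)).IsConnected)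
    (hmod : ∀ N, (ℍ.induce (c '' X)).IsNontrivialModule23 N →
      (N \ singletonBlocks c X).Nonempty) : (H.induce X).IsIndecomposable := by
  intro M hM'
  have hM := (isModule_induce_iff hH.vertexSet_eq hH.ncard_eq_three).1 hM'
  have hV : (ℍ.induce (c '' X)).vertexSet = c '' X := by simp [induce, hP.vertexSet_eq]
  have hVX : (H.induce X).vertexSet = X := by simp [induce, hH.vertexSet_eq]
  unfold IsTrivialModule
  rw [hVX]
  by_cases hinj : ∀ x ∈ M, ∀ y ∈ M, c x = c y → x = y
  · rcases M.subsingleton_or_nontrivial with hsub | hnt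
    · rcases hsub.eq_empty_or_singleton with rfl | ⟨x, rfl⟩
      · exact Or.inl rfl
      · exact Or.inr (Or.inr ⟨x, hM.subset rfl, rfl⟩)
    · right; left
      have hs : ∀ x ∈ M, c x ∈ singletonBlocks c X := fun x hx =>
        hX.block_mem_singletonBlocks hH hP hconn hM hinj hnt hx
      have htriv : (ℍ.induce (c '' X)).IsTrivialModule (c '' M) := by
        by_contra hcon
        obtain ⟨_, ⟨x, hx, rfl⟩, hxn⟩ := hmod _ ⟨hX.isModule23_image hH hP hM hs, hcon⟩
        exact hxn (hs x hx)
      obtain ⟨x, hx, y, hy, hxy⟩ := hnt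
      rcases htriv with h | h | ⟨v, -, h⟩
      · exact absurd (Set.image_eq_empty.1 h) (Set.nonempty_iff_ne_empty.1 ⟨x, hx⟩)
      · refine hM.subset.antisymm fun z hz => ?_
        rw [hV] at h
        obtain ⟨u, hu, huz⟩ : c z ∈ c '' M := by rw [h]; exact ⟨z, hz, rfl⟩
        rwa [(hX.singleton_spec (hM.subset hu) (hs u hu)).2.2 z hz huz.symm]
      · have h1 : c x = v := by simpa [h] using Set.mem_image_of_mem c hx
        have h2 : c y = v := by simpa [h] using Set.mem_image_of_mem c hy
        exact absurd (hinj x hx y hy (h1.trans h2.symm)) hxy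
  · push Not at hinj
    obtain ⟨x, hx, y, hy, hxy, hne⟩ := hinj
    right; left
    exact hX.eq_of_block_subset hH hP hconn hM hx hy hxy hne
      (hX.block_subset hH hP hconn hns hM hx hy hxy hne)

omit hX in
-- If `K` absorbs the edges it meets, no edge of `H` inside `X` joins the vertices over `K` to those
-- over its complement, so both sets are modules. They can both be trivial only if one is empty or
-- `X` has at most two vertices.
theorem isConnected_of_isIndecomposable [Finite V] (hcard : 3 ≤ X.ncard)
    (hind : (H.induce X).IsIndecomposable) : (ℍ.induce (c '' X)).IsConnected := by
  have hV : (ℍ.induce (c '' X)).vertexSet = c '' X := by simp [induce, hP.vertexSet_eq]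
  have hVX : (H.induce X).vertexSet = X := by simp [induce, hH.vertexSet_eq]
  have hXne : X.Nonempty := by
    rw [← Set.ncard_pos]; omega
  rw [isConnected_iff, hV]
  refine ⟨hXne.image c, fun K hK hKne hcl => ?_⟩
  have hedge : ∀ a ∈ X, ∀ b ∈ X, ∀ d ∈ X, {a, b, d} ∈ H.edgeSet → c a ∈ K → c b ∈ K ∧ c d ∈ K := by
    intro a ha b hb d hd he haK
    rcases hH.blocks_mem_edgeSet he with ⟨h1, h2⟩ | h
    · exact ⟨h1 ▸ haK, h2 ▸ haK⟩
    · have hsub := hcl {c a, c b, c d} ⟨h, by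
        rintro l (rfl | rfl | rfl)
        exacts [⟨a, ha, rfl⟩, ⟨b, hb, rfl⟩, ⟨d, hd, rfl⟩]⟩ ⟨c a, by simp, haK⟩
      exact ⟨hsub (by simp), hsub (by simp)⟩
  have h1 := hind {x ∈ X | c x ∈ K} ((isModule_induce_iff hH.vertexSet_eq hH.ncard_eq_three).2
    ⟨fun x hx => hx.1, fun a b d he ha hb hd haN hdN =>
      absurd ⟨hd, (hedge a ha b hb d hd he haN.2).2⟩ hdN⟩)
  have h2 := hind {x ∈ X | c x ∉ K} ((isModule_induce_iff hH.vertexSet_eq hH.ncard_eq_three).2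
    ⟨fun x hx => hx.1, fun a b d he ha hb hd haN hdN => by
      refine absurd ⟨hd, fun h => haN.2 ?_⟩ hdN
      exact (hedge d hd a ha b hb (rotate_mem (rotate_mem he)) h).1⟩)
  unfold IsTrivialModule at h1 h2
  rw [hVX] at h1 h2
  rcases h1 with h1 | h1 | ⟨v, hv, h1⟩
  · obtain ⟨k, hk⟩ := hKne
    obtain ⟨x, hx, rfl⟩ := hK hk
    exact absurd (show x ∈ {x ∈ X | c x ∈ K} from ⟨hx, hk⟩) (by rw [h1]; simp)
  · refine hK.antisymm ?_
    rintro _ ⟨x, hx, rfl⟩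
    rw [← h1] at hx
    exact hx.2
  · rcases h2 with h2 | h2 | ⟨w, hw, h2⟩
    · refine hK.antisymm ?_
      rintro _ ⟨x, hx, rfl⟩
      by_contra hxK
      exact absurd (show x ∈ {x ∈ X | c x ∉ K} from ⟨hx, hxK⟩) (by rw [h2]; simp)
    · have hv1 : v ∈ {x ∈ X | c x ∈ K} := by rw [h1]; rfl
      have hv2 : v ∈ {x ∈ X | c x ∉ K} := by rw [h2]; exact hv
      exact absurd hv1.2 hv2.2
    · exfalso
      have hle : X ⊆ {v, w} := by
        intro x hx
        by_cases hxK : c x ∈ K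
        · have : x ∈ ({v} : Set V) := by rw [← h1]; exact ⟨hx, hxK⟩
          exact Or.inl this
        · have : x ∈ ({w} : Set V) := by rw [← h2]; exact ⟨hx, hxK⟩
          exact Or.inr this
      have := Set.ncard_le_ncard hle
      have := Set.ncard_insert_le v {w}
      rw [Set.ncard_singleton] at this
      omega

/-- A module of one-vertex blocks lifts. In an edge that meets its lift and leaves it, the vertex in
the lift is alone in its block; the other two share an even block or lie in two further odd blocks,
so the exchange is the one for an edge of size 2 or 3 of the pattern. -/
theorem nonempty_of_isIndecomposable (hind : (H.induce X).IsIndecomposable) {N : Set ι}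
    (hN : (ℍ.induce (c '' X)).IsNontrivialModule23 N) : (N \ singletonBlocks c X).Nonempty := by
  have hV : (ℍ.induce (c '' X)).vertexSet = c '' X := by simp [induce, hP.vertexSet_eq]
  have hVX : (H.induce X).vertexSet = X := by simp [induce, hH.vertexSet_eq]
  by_contra hcon
  have hs : N ⊆ singletonBlocks c X := by
    rwa [Set.not_nonempty_iff_eq_empty, Set.sdiff_eq_empty] at hcon
  have hNX : N ⊆ c '' X := hV ▸ hN.subset_vertexSet
  have hspec : ∀ x ∈ X, c x ∈ N → c x ∉ Ev ∧ p x % 2 = 0 ∧ ∀ y ∈ X, c y = c x → y = x :=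
    fun x hx hxN => hX.singleton_spec hx (hs hxN)
  have h2 := ((isModule_iff_of_ncard_eq_two (H := sizePart _ 2) (fun e he => he.2)).1 hN.1.1).2
  have h3 := ((isModule_iff_of_ncard_eq_three (H := sizePart _ 3) (fun e he => he.2)).1 hN.1.2).2
  have hmod : (H.induce X).IsModule {x ∈ X | c x ∈ N} := by
    rw [isModule_induce_iff hH.vertexSet_eq hH.ncard_eq_three]
    refine ⟨fun x hx => hx.1, fun a b d he ha hb hd ⟨_, haN⟩ hdN => ?_⟩
    have hdN' : c d ∉ N := fun h => hdN ⟨hd, h⟩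
    obtain ⟨hab, had, hbd⟩ := triple_ne_of_ncard (hH.ncard_eq_three _ he)
    obtain ⟨haE, ha2, hau⟩ := hspec a ha haN
    have hcab : c a ≠ c b := fun h => hab (hau b hb h.symm).symm
    have hcad : c a ≠ c d := fun h => had (hau d hd h.symm).symm
    by_cases hcbd : c b = c d
    · have hbE : c b ∈ Ev := by
        by_contra hbE
        exact hH.not_mem_of_odd' hbE hcbd hcab (rotate_mem he)
      have hedge := (hH.edge_of_mem_of_even (rotate_mem he) hbE hcbd).2
      refine ⟨fun h => hdN' (hcbd ▸ h.2), fun n ⟨hnX, hnN⟩ => ?_⟩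
      obtain ⟨hnE, hn2, -⟩ := hspec n hnX hnN
      have hsub : ({c a, c d} : Set ι) ⊆ c '' X := by
        rintro l (rfl | rfl)
        exacts [⟨a, ha, rfl⟩, ⟨d, hd, rfl⟩]
      have hnd := (h2 (c a) (c d) ⟨⟨by rwa [Set.pair_comm, ← hcbd], hsub⟩, Set.ncard_pair hcad⟩
        haN hdN' (c n) hnN).1.1
      have hp : p b ≠ p d := fun h => hbd (hX.inj b d hcbd h)
      rcases lt_or_gt_of_ne hp with hlt | hlt
      · obtain ⟨hb2, hd2⟩ := hH.mod_two_of_mem_of_even (rotate_mem he) hcbd hbE hlt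
        exact rotate_mem (rotate_mem (hH.triple_mem_of_even hcbd hbE hnE
          (by rwa [Set.pair_comm, hcbd]) hlt hb2 hd2 hn2))
      · obtain ⟨hd2, hb2⟩ := hH.mod_two_of_mem_of_even (swap_mem (rotate_mem (rotate_mem he)))
          hcbd.symm (hcbd ▸ hbE) hlt
        exact swap_mem (rotate_mem (rotate_mem (hH.triple_mem_of_even hcbd.symm (hcbd ▸ hbE) hnE
          (by rwa [Set.pair_comm]) hlt hd2 hb2 hn2)))
    · obtain ⟨-, hbE, hdE, hedge, -, hb2, hd2⟩ := hH.edge_of_mem_of_ne he hcab hcad hcbd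
      have hsub : ({c a, c b, c d} : Set ι) ⊆ c '' X := by
        rintro l (rfl | rfl | rfl)
        exacts [⟨a, ha, rfl⟩, ⟨b, hb, rfl⟩, ⟨d, hd, rfl⟩]
      obtain ⟨hbN, hnN'⟩ := h3 (c a) (c b) (c d) ⟨⟨hedge, hsub⟩,
        Set.ncard_eq_three.2 ⟨_, _, _, hcab, hcad, hcbd, rfl⟩⟩ haN hdN'
      refine ⟨fun h => hbN h.2, fun n ⟨hnX, hnN⟩ => ?_⟩
      obtain ⟨hnE, hn2, -⟩ := hspec n hnX hnN
      exact hH.triple_mem (Or.inr (Or.inr ⟨fun h => hbN (h ▸ hnN), fun h => hdN' (h ▸ hnN), hcbd,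
        hnE, hbE, hdE, (hnN' _ hnN).1.1, hn2, hb2, hd2⟩))
  apply hN.2
  unfold IsTrivialModule
  rw [hV]
  have h := hind _ hmod
  unfold IsTrivialModule at h
  rw [hVX] at h
  rcases h with h | h | ⟨v, hv, h⟩
  · left
    rw [Set.eq_empty_iff_forall_notMem] at h ⊢
    intro i hi
    obtain ⟨x, hx, rfl⟩ := hNX hi
    exact h x ⟨hx, hi⟩
  · right; left
    refine hNX.antisymm ?_
    rintro _ ⟨x, hx, rfl⟩
    rw [← h] at hx
    exact hx.2
  · right; right
    refine ⟨c v, ⟨v, hv, rfl⟩, ?_⟩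
    have hvN : v ∈ {x ∈ X | c x ∈ N} := by rw [h]; rfl
    refine Set.eq_singleton_iff_unique_mem.2 ⟨hvN.2, fun i hi => ?_⟩
    obtain ⟨x, hx, rfl⟩ := hNX hi
    have : x ∈ ({v} : Set V) := by rw [← h]; exact ⟨hx, hi⟩
    rw [this]

theorem isPrime_induce_iff [Finite V] (hcard : 3 ≤ X.ncard) (hns : ∀ i ∈ Ev, ∃ x ∈ X, c x ≠ i) :
    (H.induce X).IsPrime ↔ (ℍ.induce (c '' X)).IsConnected ∧
      ∀ N, (ℍ.induce (c '' X)).IsNontrivialModule23 N → (N \ singletonBlocks c X).Nonempty := by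
  have hVX : (H.induce X).vertexSet = X := by simp [induce, hH.vertexSet_eq]
  unfold IsPrime
  rw [hVX]
  exact ⟨fun h => ⟨isConnected_of_isIndecomposable hH hP hcard h.1,
    fun N hN => hX.nonempty_of_isIndecomposable hH hP h.1 hN⟩,
    fun h => ⟨hX.isIndecomposable_of hH hP hns h.1 h.2, hcard⟩⟩

end Alternates

/-! ### Deleting vertices from a block: isolated vertices, twins, and alternation. -/

/-- `p x` is the position of `x` in its block `c x`, which has `n (c x)` elements; `Ev` is the set
of blocks with an even number of elements. -/
structure IsBlockPosition {V ι : Type*} (c : V → ι) (p : V → ℕ) (n : ι → ℕ) (Ev : Set ι) :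
    Prop where
  inj : ∀ x y, c x = c y → p x = p y → x = y
  lt : ∀ x, p x < n (c x)
  surj : ∀ i k, k < n i → ∃ x, c x = i ∧ p x = k
  mem_iff : ∀ i, i ∈ Ev ↔ n i % 2 = 0

namespace BlockTriple

variable {V ι : Type*} {c : V → ι} {p : V → ℕ} {Ev : Set ι} {ℍ : Hypergraph ι} {a b v x y : V}

/-- The positions of `a` and `b` have the same parity and only that of `v` lies between them. Any
comparison with another position, and hence the whole condition, is the same for both. The three
versions differ in the role of `a`. -/
theorem twin_left (hab : c b = c a) (hva : c v = c a)
    (hp : p v = p a + 1 ∧ p b = p a + 2 ∨ p v + 1 = p a ∧ p b + 2 = p a)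
    (hx : c x = c v → p x ≠ p v) (h : BlockTriple c p Ev ℍ a x y) : BlockTriple c p Ev ℍ b x y := by
  rcases h with h | h | h
  · have := hx (by rw [hva]; exact h.1.symm)
    exact Or.inl ⟨hab.trans h.1, h.2.1, hab ▸ h.2.2.1, by omega, by omega, by omega, by omega,
      by omega⟩
  · have := hx (by rw [hva]; exact h.1.symm)
    exact Or.inr (Or.inl ⟨hab.trans h.1, hab ▸ h.2.1, h.2.2.1, hab ▸ h.2.2.2.1, by omega, by omega,
      by omega, by omega⟩)
  · right; right
    rw [hab]
    exact ⟨h.1, h.2.1, h.2.2.1, h.2.2.2.1, h.2.2.2.2.1, h.2.2.2.2.2.1, h.2.2.2.2.2.2.1, by omega,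
      by omega, by omega⟩

theorem twin_middle (hab : c b = c a) (hva : c v = c a)
    (hp : p v = p a + 1 ∧ p b = p a + 2 ∨ p v + 1 = p a ∧ p b + 2 = p a)
    (hx : c x = c v → p x ≠ p v) (hy : c y = c v → p y ≠ p v)
    (h : BlockTriple c p Ev ℍ x a y) : BlockTriple c p Ev ℍ x b y := by
  rcases h with h | h | h
  · have := hx (by rw [hva]; exact h.1)
    have := hy (by rw [hva]; exact h.2.1.symm)
    exact Or.inl ⟨h.1.trans hab.symm, hab.trans h.2.1, h.2.2.1, by omega, by omega, by omega,
      by omega, by omega⟩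
  · have := hx (by rw [hva]; exact h.1)
    exact Or.inr (Or.inl ⟨h.1.trans hab.symm, h.2.1, h.2.2.1, h.2.2.2.1, by omega, by omega,
      by omega, by omega⟩)
  · right; right
    rw [hab]
    exact ⟨h.1, h.2.1, h.2.2.1, h.2.2.2.1, h.2.2.2.2.1, h.2.2.2.2.2.1, h.2.2.2.2.2.2.1, by omega,
      by omega, by omega⟩

theorem twin_right (hab : c b = c a) (hva : c v = c a)
    (hp : p v = p a + 1 ∧ p b = p a + 2 ∨ p v + 1 = p a ∧ p b + 2 = p a)
    (hy : c y = c v → p y ≠ p v) (h : BlockTriple c p Ev ℍ x y a) : BlockTriple c p Ev ℍ x y b := by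
  rcases h with h | h | h
  · have := hy (by rw [hva]; exact h.2.1)
    exact Or.inl ⟨h.1, h.2.1.trans hab.symm, h.2.2.1, by omega, by omega, by omega,
      by omega, by omega⟩
  · right; left
    rw [hab]
    exact ⟨h.1, h.2.1, h.2.2.1, h.2.2.2.1, by omega, by omega, by omega, by omega⟩
  · right; right
    rw [hab]
    exact ⟨h.1, h.2.1, h.2.2.1, h.2.2.2.1, h.2.2.2.2.1, h.2.2.2.2.2.1, h.2.2.2.2.2.2.1, by omega,
      by omega, by omega⟩

end BlockTriple

namespace Hypergraph

variable {V : Type*} [Finite V] {H : Hypergraph V} (hV : H.vertexSet = Set.univ)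
  (h3 : ∀ e ∈ H.edgeSet, e.ncard = 3) {X : Set V} (hX : 3 ≤ X.ncard)
include hV h3 hX

/-- No edge leaves the set of the other vertices, so it is a module. -/
theorem not_isIndecomposable_of_isolated {a : V} (ha : a ∈ X)
    (h : ∀ b ∈ X, ∀ d ∈ X, {a, b, d} ∉ H.edgeSet) : ¬ (H.induce X).IsIndecomposable := by
  intro hind
  have hVX : (H.induce X).vertexSet = X := by simp [induce, hV]
  have hcard := Set.ncard_sdiff_singleton_add_one ha
  have := hind (X \ {a}) ((isModule_induce_iff hV h3).2 ⟨Set.sdiff_subset,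
    fun x y d he hx hy hd hxM hdM => by
      obtain rfl : d = a := by by_contra hda; exact hdM ⟨hd, hda⟩
      exact absurd (rotate_mem (rotate_mem he)) (h x hx y hy)⟩)
  unfold IsTrivialModule at this
  rw [hVX] at this
  rcases this with h0 | h0 | ⟨v, -, h0⟩
  · rw [h0, Set.ncard_empty] at hcard; omega
  · rw [h0] at hcard; omega
  · rw [h0, Set.ncard_singleton] at hcard; omega

omit [Finite V] in
theorem not_isIndecomposable_of_twins {a b : V} (hab : a ≠ b)
    (hM : H.IsTripleModule X {a, b}) : ¬ (H.induce X).IsIndecomposable := by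
  intro hind
  have hVX : (H.induce X).vertexSet = X := by simp [induce, hV]
  have hcard := Set.ncard_pair hab
  have := hind _ ((isModule_induce_iff hV h3).2 hM)
  unfold IsTrivialModule at this
  rw [hVX] at this
  rcases this with h0 | h0 | ⟨v, -, h0⟩
  · rw [h0, Set.ncard_empty] at hcard; omega
  · rw [h0] at hcard; omega
  · rw [h0, Set.ncard_singleton] at hcard; omega

omit [Finite V] hV hX in
-- An edge containing both vertices would be carried by the exchange to a triple with a repeated
-- vertex.
theorem isTripleModule_pair {a b : V} (ha : a ∈ X) (hb : b ∈ X)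
    (h1 : ∀ x ∈ X, ∀ y ∈ X, {a, x, y} ∈ H.edgeSet → {b, x, y} ∈ H.edgeSet)
    (h2 : ∀ x ∈ X, ∀ y ∈ X, {b, x, y} ∈ H.edgeSet → {a, x, y} ∈ H.edgeSet) :
    H.IsTripleModule X {a, b} := by
  refine ⟨by rintro x (rfl | rfl) <;> assumption, ?_⟩
  rintro x y d he hx hy hd (rfl | rfl) hdM
  · refine ⟨?_, ?_⟩
    · rintro (rfl | rfl)
      · exact (triple_ne_of_ncard (h3 _ he)).1 rfl
      · exact (triple_ne_of_ncard (h3 _ (h1 _ hy _ hd he))).1 rfl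
    · rintro n (rfl | rfl)
      · exact he
      · exact h1 _ hy _ hd he
  · refine ⟨?_, ?_⟩
    · rintro (rfl | rfl)
      · exact (triple_ne_of_ncard (h3 _ (h2 _ hy _ hd he))).1 rfl
      · exact (triple_ne_of_ncard (h3 _ he)).1 rfl
    · rintro n (rfl | rfl)
      · exact h2 _ hy _ hd he
      · exact he

end Hypergraph

namespace IsBlockPosition

open Hypergraph

variable {V ι : Type*} {c : V → ι} {p : V → ℕ} {n : ι → ℕ} {Ev : Set ι} {ℍ : Hypergraph ι}
  {H : Hypergraph V} (hp : IsBlockPosition c p n Ev) (hH : H.IsBlowUp c p Ev ℍ)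
include hp

theorem eq_of_pos {x v : V} (hx : x ≠ v) : c x = c v → p x ≠ p v :=
  fun h h' => hx (hp.inj x v h h')

include hH

theorem twin_mem {a b v x y : V} (hab : c b = c a) (hva : c v = c a)
    (hpos : p v = p a + 1 ∧ p b = p a + 2 ∨ p v + 1 = p a ∧ p b + 2 = p a)
    (hx : x ≠ v) (hy : y ≠ v) (he : {a, x, y} ∈ H.edgeSet) : {b, x, y} ∈ H.edgeSet := by
  have hx' := hp.eq_of_pos hx
  have hy' := hp.eq_of_pos hy
  rw [hH.triple_mem_iff] at he ⊢
  rcases he with h | h | h | h | h | h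
  · exact Or.inl (h.twin_left hab hva hpos hx')
  · exact Or.inr (Or.inl (h.twin_left hab hva hpos hy'))
  · exact Or.inr (Or.inr (Or.inl (h.twin_middle hab hva hpos hx' hy')))
  · exact Or.inr (Or.inr (Or.inr (Or.inl (h.twin_right hab hva hpos hy'))))
  · exact Or.inr (Or.inr (Or.inr (Or.inr (Or.inl (h.twin_middle hab hva hpos hy' hx')))))
  · exact Or.inr (Or.inr (Or.inr (Or.inr (Or.inr (h.twin_right hab hva hpos hx')))))

/-- If `v` is first, its neighbour is at position 1 and has lost its only predecessor; if `v` is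
last, its neighbour has lost the only later vertex that its edges could use; otherwise the two
neighbours become twins. Only the neighbours of `v` have to survive in `X`, so a further vertex may
be missing. -/
theorem not_isIndecomposable [Finite V] {X : Set V} (hX : 3 ≤ X.ncard) {v : V}
    (hv : 2 ≤ n (c v)) (hvX : v ∉ X)
    (hN : ∀ w, c w = c v → (p w = p v + 1 ∨ p w + 1 = p v) → w ∈ X) :
    ¬ (H.induce X).IsIndecomposable := by
  have hnv := hp.lt v
  have hne : ∀ x ∈ X, x ≠ v := fun x hx h => hvX (h ▸ hx)
  by_cases h0 : p v = 0
  · obtain ⟨a, ha, ha1⟩ := hp.surj (c v) 1 (by omega)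
    refine not_isIndecomposable_of_isolated hH.vertexSet_eq hH.ncard_eq_three hX
      (hN a ha (by omega)) fun b hb d hd he => ?_
    rcases hH.exists_before he (by omega) with ⟨h1, h2, -⟩ | ⟨h1, h2, -⟩
    · exact hp.eq_of_pos (hne b hb) (h1.trans ha) (by omega)
    · exact hp.eq_of_pos (hne d hd) (h1.trans ha) (by omega)
  obtain ⟨a, ha, ha1⟩ := hp.surj (c v) (p v - 1) (by omega)
  have haX : a ∈ X := hN a ha (by omega)
  by_cases h1 : p v + 1 = n (c v)
  · refine not_isIndecomposable_of_isolated hH.vertexSet_eq hH.ncard_eq_three hX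
      haX fun b hb d hd he => ?_
    have hmem := hp.mem_iff (c v)
    have hb' := hp.lt b
    have hd' := hp.lt d
    have hpar : c a ∉ Ev ∧ p a % 2 = 1 ∨ c a ∈ Ev ∧ p a % 2 = 0 := by
      rw [ha]
      by_cases hE : c v ∈ Ev
      · have := hmem.1 hE
        exact Or.inr ⟨hE, by omega⟩
      · have : ¬ n (c v) % 2 = 0 := fun h => hE (hmem.2 h)
        exact Or.inl ⟨hE, by omega⟩
    rcases hH.exists_after he hpar with ⟨h1, h2⟩ | ⟨h1, h2⟩
    · have h3 := hp.eq_of_pos (hne b hb) (h1.trans ha)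
      rw [h1, ha] at hb'
      omega
    · have h3 := hp.eq_of_pos (hne d hd) (h1.trans ha)
      rw [h1, ha] at hd'
      omega
  · obtain ⟨b, hb, hb1⟩ := hp.surj (c v) (p v + 1) (by omega)
    have hbX : b ∈ X := hN b hb (by omega)
    refine not_isIndecomposable_of_twins hH.vertexSet_eq hH.ncard_eq_three hX
      (a := a) (b := b) (fun h => by rw [h] at ha1; omega)
      (isTripleModule_pair hH.ncard_eq_three haX hbX ?_ ?_)
    · intro x hx y hy he
      exact hp.twin_mem hH (hb.trans ha.symm) ha.symm (by omega) (hne x hx) (hne y hy) he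
    · intro x hx y hy he
      exact hp.twin_mem hH (ha.trans hb.symm) hb.symm (by omega) (hne x hx) (hne y hy) he

omit hH in
theorem alternates_univ : Alternates c p Ev Set.univ where
  inj := hp.inj
  between x _ y _ hxy hlt hpar := by
    have := hp.lt y
    obtain ⟨z, hz, hz1⟩ := hp.surj (c x) (p x + 1) (by rw [hxy]; omega)
    exact ⟨z, trivial, hz, by omega, by omega, by omega⟩
  before y _ hy := by
    have := hp.lt y
    obtain ⟨z, hz, hz1⟩ := hp.surj (c y) (p y - 1) (by omega)
    exact ⟨z, trivial, hz, by omega, by omega⟩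
  after_odd y _ hE hy := by
    have := hp.lt y
    rw [hp.mem_iff] at hE
    obtain ⟨z, hz, hz1⟩ := hp.surj (c y) (p y + 1) (by omega)
    exact ⟨z, trivial, hz, by omega, by omega⟩
  after_even y _ hE hy := by
    have := hp.lt y
    rw [hp.mem_iff] at hE
    obtain ⟨z, hz, hz1⟩ := hp.surj (c y) (p y + 1) (by omega)
    exact ⟨z, trivial, hz, by omega, by omega⟩

omit hp hH in
theorem _root_.Alternates.diff_preimage {X : Set V} (hX : Alternates c p Ev X) (S : Set ι) :
    Alternates c p Ev (X \ c ⁻¹' S) where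
  inj := hX.inj
  between x hx y hy hxy hlt hpar := by
    obtain ⟨z, hz, hzx, h⟩ := hX.between x hx.1 y hy.1 hxy hlt hpar
    exact ⟨z, ⟨hz, fun h => hx.2 (by rwa [Set.mem_preimage, hzx] at h)⟩, hzx, h⟩
  before x hx hpar := by
    obtain ⟨z, hz, hzx, h⟩ := hX.before x hx.1 hpar
    exact ⟨z, ⟨hz, fun h => hx.2 (by rwa [Set.mem_preimage, hzx] at h)⟩, hzx, h⟩
  after_odd x hx hE hpar := by
    obtain ⟨z, hz, hzx, h⟩ := hX.after_odd x hx.1 hE hpar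
    exact ⟨z, ⟨hz, fun h => hx.2 (by rwa [Set.mem_preimage, hzx] at h)⟩, hzx, h⟩
  after_even x hx hE hpar := by
    obtain ⟨z, hz, hzx, h⟩ := hX.after_even x hx.1 hE hpar
    exact ⟨z, ⟨hz, fun h => hx.2 (by rwa [Set.mem_preimage, hzx] at h)⟩, hzx, h⟩

omit hH in
-- The witness is the adjacent position or, if that falls into the deleted pair, the position three
-- steps away, which has the same parity.
theorem alternates_compl_pair {v w : V} (hvw : c v = c w) (hpos : p w = p v + 1) :
    Alternates c p Ev ({v, w}ᶜ) := by
  have hmem : ∀ x, x ∈ ({v, w}ᶜ : Set V) ↔ (c x = c v → p x ≠ p v ∧ p x ≠ p v + 1) := by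
    intro x
    simp only [Set.mem_compl_iff, Set.mem_insert_iff, Set.mem_singleton_iff, not_or]
    constructor
    · rintro ⟨h1, h2⟩ h
      refine ⟨hp.eq_of_pos h1 h, ?_⟩
      rw [← hpos]
      exact hp.eq_of_pos h2 (h.trans hvw)
    · intro h
      refine ⟨?_, ?_⟩
      · rintro rfl; exact (h rfl).1 rfl
      · rintro rfl; exact (h hvw.symm).2 hpos
  have hw := hp.lt w
  rw [← hvw] at hw
  have key : ∀ i k, k < n i → (i = c v → k ≠ p v ∧ k ≠ p v + 1) →
      ∃ z ∈ ({v, w}ᶜ : Set V), c z = i ∧ p z = k := by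
    rintro i k hk h
    obtain ⟨z, rfl, rfl⟩ := hp.surj i k hk
    exact ⟨z, (hmem z).2 h, rfl, rfl⟩
  refine ⟨hp.inj, fun x hx y hy hxy hlt hpar => ?_, fun y hy hpar => ?_, fun y hy hE hpar => ?_,
    fun y hy hE hpar => ?_⟩
  · rw [hmem] at hx hy
    have h1 := hp.lt y
    rw [← hxy] at h1 hy
    by_cases h : c x = c v ∧ p x + 1 = p v
    · have := hy h.1
      obtain ⟨z, hz, hzx, hz1⟩ := key (c x) (p x + 3) (by omega) (fun _ => by omega)
      exact ⟨z, hz, hzx, by omega, by omega, by omega⟩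
    · obtain ⟨z, hz, hzx, hz1⟩ := key (c x) (p x + 1) (by omega) (fun h' => by
        have := hx h'
        have : p x + 1 ≠ p v := fun h'' => h ⟨h', h''⟩
        omega)
      exact ⟨z, hz, hzx, by omega, by omega, by omega⟩
  · rw [hmem] at hy
    have h1 := hp.lt y
    by_cases h : c y = c v ∧ p y = p v + 2
    · obtain ⟨z, hz, hzx, hz1⟩ := key (c y) (p y - 3) (by omega) (fun _ => by omega)
      exact ⟨z, hz, hzx, by omega, by omega⟩
    · obtain ⟨z, hz, hzx, hz1⟩ := key (c y) (p y - 1) (by omega) (fun h' => by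
        have := hy h'
        have : p y ≠ p v + 2 := fun h'' => h ⟨h', h''⟩
        omega)
      exact ⟨z, hz, hzx, by omega, by omega⟩
  · rw [hmem] at hy
    rw [hp.mem_iff] at hE
    have h1 := hp.lt y
    by_cases h : c y = c v ∧ p y + 1 = p v
    · rw [← h.1] at hw
      obtain ⟨z, hz, hzx, hz1⟩ := key (c y) (p y + 3) (by omega) (fun _ => by omega)
      exact ⟨z, hz, hzx, by omega, by omega⟩
    · obtain ⟨z, hz, hzx, hz1⟩ := key (c y) (p y + 1) (by omega) (fun h' => by
        have := hy h'
        have : p y + 1 ≠ p v := fun h'' => h ⟨h', h''⟩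
        omega)
      exact ⟨z, hz, hzx, by omega, by omega⟩
  · rw [hmem] at hy
    rw [hp.mem_iff] at hE
    have h1 := hp.lt y
    by_cases h : c y = c v ∧ p y + 1 = p v
    · rw [← h.1] at hw
      obtain ⟨z, hz, hzx, hz1⟩ := key (c y) (p y + 3) (by omega) (fun _ => by omega)
      exact ⟨z, hz, hzx, by omega, by omega⟩
    · obtain ⟨z, hz, hzx, hz1⟩ := key (c y) (p y + 1) (by omega) (fun h' => by
        have := hy h'
        have : p y + 1 ≠ p v := fun h'' => h ⟨h', h''⟩
        omega)
      exact ⟨z, hz, hzx, by omega, by omega⟩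

end IsBlockPosition

/-! ### Cycles of twins. -/

namespace Hypergraph

/-- A cyclic sequence of vertices of a 3-hypergraph, with period `m`, in which the two neighbours
of each vertex `v` are twins after the deletion of `v`. -/
structure IsTwinCycle {V : Type*} (H : Hypergraph V) (f : ℤ → V) (m : ℕ) : Prop where
  period : ∀ k, f (k + m) = f k
  le_of_eq : ∀ i j, i < j → f i = f j → (m : ℤ) ≤ j - i
  ne : ∀ k, f k ≠ f (k + 2)
  up : ∀ k x y, {f k, x, y} ∈ H.edgeSet → x ≠ f (k + 1) → y ≠ f (k + 1) →
    {f (k + 2), x, y} ∈ H.edgeSet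
  down : ∀ k x y, {f (k + 2), x, y} ∈ H.edgeSet → x ≠ f (k + 1) → y ≠ f (k + 1) →
    {f k, x, y} ∈ H.edgeSet

namespace IsTwinCycle

variable {V : Type*} {H : Hypergraph V} {f : ℤ → V} {m : ℕ} (hf : H.IsTwinCycle f m)
include hf

/-- An edge moves along the cycle in steps of two until one of its other vertices would be jumped
over. -/
theorem slide_up {x y : V} {i : ℤ} (t : ℕ) (he : {f i, x, y} ∈ H.edgeSet)
    (h : ∀ s : ℕ, s < t → x ≠ f (i + 2 * s + 1) ∧ y ≠ f (i + 2 * s + 1)) :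
    {f (i + 2 * t), x, y} ∈ H.edgeSet := by
  induction t with
  | zero => simpa using he
  | succ t ih =>
    have := hf.up _ x y (ih fun s hs => h s (by omega)) (h t (by omega)).1 (h t (by omega)).2
    convert this using 3
    push_cast; ring

theorem slide_down {x y : V} {i : ℤ} (t : ℕ) (he : {f i, x, y} ∈ H.edgeSet)
    (h : ∀ s : ℕ, s < t → x ≠ f (i - 2 * s - 1) ∧ y ≠ f (i - 2 * s - 1)) :
    {f (i - 2 * t), x, y} ∈ H.edgeSet := by
  induction t with
  | zero => simpa using he
  | succ t ih =>
    have h1 := ih fun s hs => h s (by omega)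
    have h2 := h t (by omega)
    have e1 : i - 2 * (t : ℤ) = (i - 2 * ((t + 1 : ℕ) : ℤ)) + 2 := by push_cast; ring
    have e2 : i - 2 * (t : ℤ) - 1 = (i - 2 * ((t + 1 : ℕ) : ℤ)) + 1 := by push_cast; ring
    rw [e2] at h2
    rw [e1] at h1
    exact hf.down _ x y h1 h2.1 h2.2

variable (h3 : ∀ e ∈ H.edgeSet, e.ncard = 3)
include h3

/-- Two vertices of an edge at even distance on the cycle are separated by the third one. -/
theorem exists_between {x : V} {i j : ℤ} (hij : i < j) (hjm : j < i + m) (hpar : (j - i) % 2 = 0)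
    (he : {f i, f j, x} ∈ H.edgeSet) : ∃ l, i < l ∧ l < j ∧ f l = x := by
  -- Without an obstacle the edge slides from `f i` up to `f j`, giving a triple that contains `f j`
  -- twice.
  by_contra! hcon
  obtain ⟨t, ht⟩ : ∃ t : ℕ, j = i + 2 * t := ⟨((j - i) / 2).toNat, by omega⟩
  have := hf.slide_up t he fun s hs => ⟨fun h => ?_, (hcon _ (by omega) (by omega)).symm⟩
  · rw [← ht] at this
    exact (triple_ne_of_ncard (h3 _ this)).1 rfl
  · have := hf.le_of_eq _ _ (by omega) h.symm
    omega

omit h3 in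
theorem period_mul (k : ℤ) (t : ℤ) : f (k + m * t) = f k := by
  induction t using Int.induction_on with
  | zero => simp
  | succ t ih => rw [← ih, ← hf.period (k + m * t)]; congr 1; ring
  | pred t ih => rw [← ih, ← hf.period (k + m * (-t - 1))]; congr 1; ring

omit h3 in
theorem exists_rep (hm : 0 < m) (i k : ℤ) (hne : f k ≠ f i) :
    ∃ j, i < j ∧ j < i + m ∧ f j = f k ∧ (m % 2 = 0 → (j - k) % 2 = 0) := by
  have hm' : (0 : ℤ) < m := by exact_mod_cast hm
  have h0 := Int.emod_nonneg (k - i) hm'.ne'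
  have h1 := Int.emod_lt_of_pos (k - i) hm'
  have h2 := Int.mul_ediv_add_emod (k - i) m
  have hfj : f (i + (k - i) % m) = f k := by
    rw [← hf.period_mul (i + (k - i) % m) ((k - i) / m)]
    congr 1; omega
  refine ⟨i + (k - i) % m, ?_, by omega, hfj, fun hpar => ?_⟩
  · rcases h0.lt_or_eq with h | h
    · omega
    · rw [← h, add_zero] at hfj
      exact absurd hfj.symm hne
  · obtain ⟨r, hr⟩ : ∃ r, m = 2 * r := ⟨m / 2, by omega⟩
    have : i + (k - i) % m - k = 2 * (- (r * ((k - i) / m))) := by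
      have : (m : ℤ) = 2 * r := by exact_mod_cast hr
      rw [this] at h2 ⊢
      linarith
    omega

/-- For odd `m` the even indices reach the whole cycle; vertices outside it never obstruct sliding.
For even `m`, an edge with two vertices of even index has its third vertex strictly between them on
both arcs, which would make it occur twice in a period. To exchange `f (2 * s)` for `f (2 * t)` one
slides along the arc without obstacles. Obstacles on both arcs would be two vertices of odd index,
which by `exists_between` are separated by `f (2 * s)` also on the arc that avoids it. -/
theorem isTripleModule (hm : 0 < m) :
    H.IsTripleModule Set.univ (Set.range fun s : ℤ => f (2 * s)) := by
  have hrange : m % 2 = 1 → ∀ k, f k ∈ Set.range fun s : ℤ => f (2 * s) := by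
    intro hodd k
    rcases Int.emod_two_eq_zero_or_one k with h | h
    · exact ⟨k / 2, by dsimp only; congr 1; omega⟩
    · refine ⟨(k + m) / 2, ?_⟩
      dsimp only
      rw [← hf.period k]
      congr 1; omega
  have hmem : ∀ k : ℤ, k % 2 = 0 → f k ∈ Set.range fun s : ℤ => f (2 * s) := fun k hk =>
    ⟨k / 2, by dsimp only; congr 1; omega⟩
  have hone : ∀ a b d, {a, b, d} ∈ H.edgeSet → a ∈ (Set.range fun s : ℤ => f (2 * s)) →
      d ∉ (Set.range fun s : ℤ => f (2 * s)) → b ∉ Set.range fun s : ℤ => f (2 * s) := by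
    rintro _ _ d he ⟨s, rfl⟩ hd ⟨t, rfl⟩
    dsimp only at he
    obtain ⟨hab, -, -⟩ := triple_ne_of_ncard (h3 _ he)
    obtain ⟨j, h1, h2, h4, h5⟩ := hf.exists_rep hm (2 * s) (2 * t) hab.symm
    rw [← h4] at he
    have he' : {f j, f (2 * s + m), d} ∈ H.edgeSet := by
      rw [hf.period]
      exact swap_mem (rotate_mem he)
    rcases Nat.mod_two_eq_zero_or_one m with hpar | hpar
    · have := h5 hpar
      obtain ⟨l, hl1, hl2, hl⟩ := hf.exists_between h3 h1 h2 (by omega) he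
      obtain ⟨l', hl1', hl2', hl'⟩ := hf.exists_between h3 h2 (by omega) (by omega) he'
      have := hf.le_of_eq l l' (by omega) (hl.trans hl'.symm)
      omega
    · by_cases hev : (j - 2 * s) % 2 = 0
      · obtain ⟨l, -, -, rfl⟩ := hf.exists_between h3 h1 h2 (by omega) he
        exact hd (hrange hpar l)
      · obtain ⟨l, -, -, rfl⟩ := hf.exists_between h3 h2 (by omega) (by omega) he'
        exact hd (hrange hpar l)
  refine ⟨Set.subset_univ _, fun a b d he _ _ _ ha hd => ⟨hone a b d he ha hd, ?_⟩⟩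
  have hb := hone a b d he ha hd
  obtain ⟨s, rfl⟩ := ha
  rintro _ ⟨t, rfl⟩
  dsimp only at he ⊢
  by_cases hne : f (2 * t) = f (2 * s)
  · rwa [hne]
  rcases Nat.mod_two_eq_zero_or_one m with hpar | hpar
  · obtain ⟨j, h1, h2, h4, h5⟩ := hf.exists_rep hm (2 * s) (2 * t) hne
    have hj := h5 hpar
    rw [← h4]
    by_cases hup : ∀ l, 2 * s < l → l < j → b ≠ f l ∧ d ≠ f l
    · obtain ⟨r, hr⟩ : ∃ r : ℕ, j = 2 * s + 2 * r := ⟨((j - 2 * s) / 2).toNat, by omega⟩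
      rw [hr]
      exact hf.slide_up r he fun s' hs' => hup _ (by omega) (by omega)
    · have aux : ∀ b d, {f (2 * s), b, d} ∈ H.edgeSet →
          b ∉ (Set.range fun s : ℤ => f (2 * s)) → d ∉ (Set.range fun s : ℤ => f (2 * s)) →
          ∀ l, 2 * s < l → l < j → b = f l → {f j, b, d} ∈ H.edgeSet := by
        rintro b d he hb hd l hl1 hl2 rfl
        obtain ⟨r, hr⟩ : ∃ r : ℕ, j = 2 * s + m - 2 * r :=
          ⟨((2 * s + m - j) / 2).toNat, by omega⟩
        rw [hr]
        refine hf.slide_down r (by rwa [hf.period]) fun s' hs' => ⟨fun h => ?_, fun h => ?_⟩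
        · have := hf.le_of_eq _ _ (by omega) h
          omega
        · rw [h] at he hd
          have hlodd : l % 2 = 1 := by
            by_contra hl; exact hb (hmem l (by omega))
          obtain ⟨l', hl1', hl2', hl'⟩ := hf.exists_between h3 (i := l)
            (j := 2 * s + m - 2 * s' - 1) (by omega) (by omega) (by omega) (rotate_mem he)
          have := hf.le_of_eq (2 * s) l' (by omega) hl'.symm
          omega
      push Not at hup
      obtain ⟨l, hl1, hl2, hl⟩ := hup
      by_cases hbl : b = f l
      · exact aux b d he hb hd l hl1 hl2 hbl
      · exact swap_mem (aux d b (swap_mem he) hd hb l hl1 hl2 (hl hbl))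
  · obtain ⟨r, hr⟩ : ∃ r : ℕ, f (2 * s + 2 * r) = f (2 * t) := by
      -- Extra turns, `2 * |t - s|` of them, make the number of steps nonnegative without changing
      -- the endpoint.
      refine ⟨(t - s + m * |t - s|).toNat, ?_⟩
      have : 0 ≤ t - s + m * |t - s| := by
        have h1 := neg_abs_le (t - s)
        have h2 : 1 * |t - s| ≤ m * |t - s| :=
          mul_le_mul_of_nonneg_right (by exact_mod_cast hm) (abs_nonneg _)
        linarith
      rw [Int.toNat_of_nonneg this, ← hf.period_mul (2 * t) (2 * |t - s|)]
      congr 1; ring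
    rw [← hr]
    exact hf.slide_up r he fun s' _ => ⟨fun h => hb (h ▸ hrange hpar _),
      fun h => hd (h ▸ hrange hpar _)⟩

end IsTwinCycle

/-- Going from `(a, v)` to `v` and its other neighbour permutes the finite set of directed edges in
`S`. The powers of this permutation give a walk indexed by `ℤ`; once it is known never to revisit a
vertex in the opposite direction, it is a twin cycle with its least period. -/
theorem exists_isTripleModule_of_two_regular {V : Type*} [Finite V] {H : Hypergraph V}
    (h3 : ∀ e ∈ H.edgeSet, e.ncard = 3) (P : SimpleGraph V) {S : Set V} (hne : S.Nonempty)
    (hS : ∀ v ∈ S, ∃ a ∈ S, ∃ b ∈ S, a ≠ b ∧ (∀ x, P.Adj v x ↔ x = a ∨ x = b) ∧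
      H.IsTripleModule {v}ᶜ {a, b}) :
    ∃ M ⊆ S, M.Nontrivial ∧ H.IsTripleModule Set.univ M := by
  classical
  -- The neighbour of `v` other than `a`, with `a` itself as a default value where this makes no
  -- sense.
  have hoth : ∀ a v : V, ∃ b, v ∈ S → P.Adj v a → b ∈ S ∧ a ≠ b ∧
      (∀ x, P.Adj v x ↔ x = a ∨ x = b) ∧ H.IsTripleModule {v}ᶜ {a, b} := by
    intro a v
    by_cases hv : v ∈ S ∧ P.Adj v a
    · obtain ⟨b, hb, d, hd, hbd, hadj, hmod⟩ := hS v hv.1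
      rcases (hadj a).1 hv.2 with rfl | rfl
      · exact ⟨d, fun _ _ => ⟨hd, hbd, hadj, hmod⟩⟩
      · exact ⟨b, fun _ _ => ⟨hb, hbd.symm, fun x => (hadj x).trans or_comm,
          Set.pair_comm b a ▸ hmod⟩⟩
    · exact ⟨a, fun h1 h2 => absurd ⟨h1, h2⟩ hv⟩
  choose oth hoth using hoth
  let D := {d : V × V // d.1 ∈ S ∧ d.2 ∈ S ∧ P.Adj d.2 d.1}
  have hothoth : ∀ a v, v ∈ S → P.Adj v a → oth (oth a v) v = a := by
    intro a v hv hva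
    obtain ⟨-, h2, h4, -⟩ := hoth a v hv hva
    have hadj : P.Adj v (oth a v) := (h4 _).2 (Or.inr rfl)
    obtain ⟨-, -, h4', -⟩ := hoth (oth a v) v hv hadj
    exact (((h4' a).1 hva).resolve_left h2).symm
  let σ : Equiv.Perm D :=
    { toFun := fun d => ⟨(d.1.2, oth d.1.1 d.1.2), d.2.2.1,
        (hoth _ _ d.2.2.1 d.2.2.2).1, (((hoth _ _ d.2.2.1 d.2.2.2).2.2.1 _).2 (Or.inr rfl)).symm⟩
      invFun := fun d => ⟨(oth d.1.2 d.1.1, d.1.1), (hoth _ _ d.2.1 d.2.2.2.symm).1, d.2.1,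
        ((hoth _ _ d.2.1 d.2.2.2.symm).2.2.1 _).2 (Or.inr rfl)⟩
      left_inv := fun d => Subtype.ext (Prod.ext (hothoth _ _ d.2.2.1 d.2.2.2) rfl)
      right_inv := fun d => Subtype.ext (Prod.ext rfl (hothoth _ _ d.2.1 d.2.2.2.symm)) }
  obtain ⟨v, hv⟩ := hne
  obtain ⟨a, ha, _, _, _, hva, _⟩ := hS v hv
  let d0 : D := ⟨(a, v), ha, hv, (hva a).2 (Or.inl rfl)⟩
  let f : ℤ → V := fun k => ((σ ^ k) d0).1.1
  have hf1 : ∀ k, f (k + 1) = ((σ ^ k) d0).1.2 := by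
    intro k
    simp only [f, add_comm k 1, zpow_one_add, Equiv.Perm.mul_apply]
    rfl
  have hf2 : ∀ k, f (k + 2) = oth (f k) (f (k + 1)) := by
    intro k
    rw [show k + 2 = (k + 1) + 1 by ring, hf1 (k + 1), hf1 k, add_comm k 1, zpow_one_add,
      Equiv.Perm.mul_apply]
    rfl
  have hfS : ∀ k, f k ∈ S := fun k => ((σ ^ k) d0).2.1
  have hfadj : ∀ k, P.Adj (f (k + 1)) (f k) := by
    intro k; rw [hf1]; exact ((σ ^ k) d0).2.2.2
  have hfne : ∀ k, f k ≠ f (k + 2) := by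
    intro k; rw [hf2]; exact (hoth _ _ (hfS _) (hfadj k)).2.1
  have hfN : ∀ k x, P.Adj (f (k + 1)) x ↔ x = f k ∨ x = f (k + 2) := by
    intro k; rw [hf2]; exact (hoth _ _ (hfS _) (hfadj k)).2.2.1
  have hfmod : ∀ k, H.IsTripleModule {f (k + 1)}ᶜ {f k, f (k + 2)} := by
    intro k; rw [hf2]; exact (hoth _ _ (hfS _) (hfadj k)).2.2.2
  -- Otherwise the walk between `i` and `j` folds onto itself, and at its centre either `f k = f (k
  -- + 2)` or two consecutive vertices coincide, according to the parity of `j - i`.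
  have hrefl : ∀ i j : ℤ, i < j → f i = f j → f (i + 1) ≠ f (j - 1) := by
    intro i j hij h h'
    have key : ∀ k : ℕ, f (i + k) = f (j - k) ∧ f (i + k + 1) = f (j - k - 1) := by
      intro k
      induction k with
      | zero => simpa using ⟨h, h'⟩
      | succ k ih =>
        obtain ⟨h1, h2⟩ := ih
        have e1 : i + ((k + 1 : ℕ) : ℤ) = i + k + 1 := by push_cast; ring
        have e2 : j - ((k + 1 : ℕ) : ℤ) = j - k - 1 := by push_cast; ring
        rw [e1, e2]
        refine ⟨h2, ?_⟩
        have h5 : P.Adj (f (i + k + 1)) (f (j - k - 1 - 1)) := by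
          rw [h2]
          have := (hfN (j - k - 1 - 1) (f (j - k - 1 - 1))).2 (Or.inl rfl)
          rwa [sub_add_cancel] at this
        rcases (hfN (i + k) _).1 h5 with h6 | h6
        · rw [h1] at h6
          exfalso
          refine hfne (j - k - 1 - 1) (h6.trans ?_)
          congr 1; ring
        · rw [h6]; congr 1; ring
    rcases Int.emod_two_eq_zero_or_one (j - i) with hpar | hpar
    · have := (key ((j - i) / 2 - 1).toNat).1
      refine hfne (i + (((j - i) / 2 - 1).toNat : ℕ)) (this.trans ?_)
      congr 1; omega
    · have := (key ((j - i) / 2).toNat).1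
      refine (hfadj (i + (((j - i) / 2).toNat : ℕ))).ne' (this.trans ?_)
      congr 1; omega
  have hsucc : ∀ i j : ℤ, i < j → f i = f j → f (i + 1) = f (j + 1) ∧ f (i - 1) = f (j - 1) := by
    intro i j hij h
    have h1 : ∀ x, x = f (i - 1) ∨ x = f (i + 1) ↔ x = f (j - 1) ∨ x = f (j + 1) := by
      intro x
      have e1 := hfN (i - 1) x
      have e2 := hfN (j - 1) x
      rw [sub_add_cancel, show i - 1 + 2 = i + 1 by ring] at e1
      rw [sub_add_cancel, show j - 1 + 2 = j + 1 by ring] at e2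
      rw [← e1, ← e2, h]
    have h2 := hrefl i j hij h
    have h4 := ((h1 _).1 (Or.inr rfl)).resolve_left h2
    refine ⟨h4, ((h1 _).2 (Or.inl rfl)).elim Eq.symm fun h5 => absurd h5.symm h2⟩
  have hshift : ∀ i j : ℤ, i < j → f i = f j → ∀ k, f (i + k) = f (j + k) := by
    intro i j hij h k
    induction k using Int.induction_on with
    | zero => simpa using h
    | succ k ih => rw [← add_assoc, ← add_assoc]; exact (hsucc _ _ (by omega) ih).1
    | pred k ih =>
      rw [← add_sub_assoc, ← add_sub_assoc]; exact (hsucc _ _ (by omega) ih).2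
  have hex : ∃ m : ℕ, 0 < m ∧ f m = f 0 := by
    obtain ⟨i, j, hij, h⟩ := Finite.exists_ne_map_eq_of_infinite f
    rcases lt_or_gt_of_ne hij with hlt | hlt
    · refine ⟨(j - i).toNat, by omega, ?_⟩
      have := hshift i j hlt h (-i)
      rw [Int.toNat_of_nonneg (by omega), sub_eq_add_neg, ← this, add_neg_cancel]
    · refine ⟨(i - j).toNat, by omega, ?_⟩
      have := hshift j i hlt h.symm (-j)
      rw [Int.toNat_of_nonneg (by omega), sub_eq_add_neg, ← this, add_neg_cancel]
  obtain ⟨hm0, hm⟩ := Nat.find_spec hex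
  have hcyc : H.IsTwinCycle f (Nat.find hex) := by
    refine ⟨fun k => ?_, fun i j hij h => ?_, hfne, fun k x y he hx hy => ?_,
      fun k x y he hx hy => ?_⟩
    · have := hshift 0 (Nat.find hex) (by exact_mod_cast hm0) hm.symm k
      rw [zero_add] at this
      rw [this, add_comm]
    · have := hshift i j hij h (-i)
      have hle := Nat.find_min' hex (m := (j - i).toNat) ⟨by omega, by
        rw [Int.toNat_of_nonneg (by omega), sub_eq_add_neg, ← this, add_neg_cancel]⟩
      omega
    · have hyM : y ∉ ({f k, f (k + 2)} : Set V) ∨ x ∉ ({f k, f (k + 2)} : Set V) := by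
        obtain ⟨h1, h2, h4⟩ := triple_ne_of_ncard (h3 _ he)
        by_contra! hcon
        obtain ⟨ha | ha, hb | hb⟩ := hcon
        · exact h2 ha.symm
        · exact h2 ha.symm
        · exact h1 hb.symm
        · exact h4 (hb.trans ha.symm)
      have hk : f k ≠ f (k + 1) := (hfadj k).ne'
      rcases hyM with hyM | hxM
      · exact ((hfmod k).swap _ _ _ he hk hx hy (Or.inl rfl) hyM).2 _ (Or.inr rfl)
      · exact swap_mem (((hfmod k).swap _ _ _ (swap_mem he) hk hy hx (Or.inl rfl) hxM).2 _
          (Or.inr rfl))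
    · have hyM : y ∉ ({f k, f (k + 2)} : Set V) ∨ x ∉ ({f k, f (k + 2)} : Set V) := by
        obtain ⟨h1, h2, h4⟩ := triple_ne_of_ncard (h3 _ he)
        by_contra! hcon
        obtain ⟨ha | ha, hb | hb⟩ := hcon
        · exact h4 (hb.trans ha.symm)
        · exact h1 hb.symm
        · exact h2 ha.symm
        · exact h2 ha.symm
      have hk : f (k + 2) ≠ f (k + 1) := by
        have := (hfadj (k + 1)).ne
        rwa [add_assoc] at this
      rcases hyM with hyM | hxM
      · exact ((hfmod k).swap _ _ _ he hk hx hy (Or.inr rfl) hyM).2 _ (Or.inl rfl)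
      · exact swap_mem (((hfmod k).swap _ _ _ (swap_mem he) hk hy hx (Or.inr rfl) hxM).2 _
          (Or.inl rfl))
  refine ⟨Set.range fun s : ℤ => f (2 * s), ?_, ⟨_, ⟨0, rfl⟩, _, ⟨1, rfl⟩, ?_⟩,
    hcyc.isTripleModule h3 hm0⟩
  · rintro _ ⟨s, rfl⟩
    exact hfS _
  · exact hfne 0

end Hypergraph

/-! ### The hypergraph `Γ • ℍ` as a blow-up along the components of `Γ`. -/

namespace SimpleGraph

variable {V : Type*} {Γ : SimpleGraph V} (φ : Γ.PathParam)

/-- The position of a vertex on its component. -/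
noncomputable def PathParam.pos (x : V) : ℕ :=
  ((φ (Γ.connectedComponentMk x)).symm ⟨x, rfl⟩ : Fin _)

theorem PathParam.pos_eq {C : Γ.ConnectedComponent} {x : V} (hx : Γ.connectedComponentMk x = C) :
    φ.pos x = ((φ C).symm ⟨x, hx⟩ : Fin _) := by
  subst hx; rfl

theorem PathParam.mk_apply (C : Γ.ConnectedComponent) (a : Fin C.supp.ncard) :
    Γ.connectedComponentMk (φ C a : V) = C :=
  (φ C a).2

theorem PathParam.pos_apply (C : Γ.ConnectedComponent) (a : Fin C.supp.ncard) :
    φ.pos (φ C a : V) = a := by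
  rw [φ.pos_eq (φ.mk_apply C a)]
  exact congrArg Fin.val ((φ C).symm_apply_apply a)

theorem PathParam.pos_lt {C : Γ.ConnectedComponent} {x : V}
    (hx : Γ.connectedComponentMk x = C) : φ.pos x < C.supp.ncard := by
  rw [φ.pos_eq hx]; exact Fin.isLt _

theorem PathParam.apply_pos {C : Γ.ConnectedComponent} {x : V}
    (hx : Γ.connectedComponentMk x = C) : (φ C ⟨φ.pos x, φ.pos_lt hx⟩ : V) = x := by
  have : (⟨φ.pos x, φ.pos_lt hx⟩ : Fin C.supp.ncard) = (φ C).symm ⟨x, hx⟩ :=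
    Fin.ext (φ.pos_eq hx)
  rw [this]
  simp

theorem PathParam.isBlockPosition : IsBlockPosition Γ.connectedComponentMk φ.pos
    (fun C => C.supp.ncard) Γ.evenComps where
  inj x y hxy hp := by
    have h : (⟨φ.pos x, φ.pos_lt hxy⟩ : Fin (Γ.connectedComponentMk y).supp.ncard) =
      ⟨φ.pos y, φ.pos_lt rfl⟩ := Fin.ext hp
    exact (φ.apply_pos hxy).symm.trans ((congrArg (fun a => (φ _ a : V)) h).trans (φ.apply_pos rfl))
  lt x := φ.pos_lt rfl
  surj C k hk := ⟨φ C ⟨k, hk⟩, φ.mk_apply C _, φ.pos_apply C _⟩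
  mem_iff C := Nat.even_iff

theorem PathParam.adj_iff {x y : V} : Γ.Adj x y ↔
    Γ.connectedComponentMk x = Γ.connectedComponentMk y ∧
      (φ.pos x + 1 = φ.pos y ∨ φ.pos y + 1 = φ.pos x) := by
  by_cases h : Γ.connectedComponentMk x = Γ.connectedComponentMk y
  · have h1 := φ.apply_pos h
    have h2 := φ.apply_pos (x := y) rfl
    have h3 : Γ.Adj (φ (Γ.connectedComponentMk y) ⟨φ.pos x, φ.pos_lt h⟩)
        (φ (Γ.connectedComponentMk y) ⟨φ.pos y, φ.pos_lt rfl⟩) ↔ _ :=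
      (φ (Γ.connectedComponentMk y)).map_adj_iff (v := ⟨φ.pos x, φ.pos_lt h⟩)
        (w := ⟨φ.pos y, φ.pos_lt rfl⟩)
    rw [pathGraph_adj, h1, h2] at h3
    rw [h3]
    simp [h]
  · exact ⟨fun hadj => absurd (ConnectedComponent.sound hadj.reachable) h, fun h' => absurd h'.1 h⟩

theorem notMem_evenComps {C : Γ.ConnectedComponent} : C ∉ Γ.evenComps ↔ C ∈ Γ.oddComps :=
  Nat.not_even_iff_odd

theorem BulletHypergraph.isBlockPattern {ℍ : Hypergraph Γ.ConnectedComponent}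
    (h : Γ.BulletHypergraph ℍ) : ℍ.IsBlockPattern Γ.evenComps where
  vertexSet_eq := h.vertexSet_eq
  size := h.size
  two ε hε h2 := by
    obtain ⟨h1, i, hi, hi'⟩ := h.two ε hε h2
    exact ⟨h1, i, hi, notMem_evenComps.2 hi'⟩
  three ε hε h3 i hi := notMem_evenComps.2 (h.three ε hε h3 hi)

theorem tournamentU_adj {n : ℕ} {a b : Fin n} : (tournamentU n).Adj a b ↔
    if Even (a : ℕ) ∧ Even (b : ℕ) then b < a else a < b :=
  Iff.rfl

/-- Three even vertices, or at most one even vertex, induce a transitive tournament; with two even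
vertices the reversed arc closes a cycle exactly when the odd vertex lies between them. -/
theorem mem_compTriples {C : Γ.ConnectedComponent} {e : Set V} : e ∈ compTriples φ C ↔
    ∃ a b d : Fin C.supp.ncard, (a : ℕ) % 2 = 0 ∧ (b : ℕ) % 2 = 1 ∧ (d : ℕ) % 2 = 0 ∧ a < b ∧
      b < d ∧ e = {(φ C a : V), (φ C b : V), (φ C d : V)} := by
  simp only [compTriples, Digraph.c3Structure, Hypergraph.image_edgeSet, Set.mem_image,
    Set.mem_ofPred_eq]
  constructor
  · rintro ⟨_, ⟨x, y, z, hxy, hyz, hzx, rfl⟩, rfl⟩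
    simp only [Set.image_insert_eq, Set.image_singleton]
    rw [tournamentU_adj] at hxy hyz hzx
    simp only [Nat.even_iff] at hxy hyz hzx
    by_cases hx : (x : ℕ) % 2 = 0 <;> by_cases hy : (y : ℕ) % 2 = 0 <;>
      by_cases hz : (z : ℕ) % 2 = 0 <;> simp only [hx, hy, hz, and_self, and_true, if_true, and_false,
        if_false] at hxy hyz hzx
    · omega
    · exact ⟨y, z, x, hy, by omega, hx, hyz, hzx, Hypergraph.triple_rotate _ _ _⟩
    · exact ⟨x, y, z, hx, by omega, hz, hxy, hyz, rfl⟩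
    · omega
    · exact ⟨z, x, y, hz, by omega, hy, hzx, hxy,
        (Hypergraph.triple_rotate _ _ _).symm⟩
    · omega
    · omega
    · omega
  · rintro ⟨a, b, d, ha, hb, hd, hab, hbd, rfl⟩
    refine ⟨{a, b, d}, ⟨a, b, d, ?_, ?_, ?_, rfl⟩, by simp [Set.image_insert_eq]⟩
    · rw [tournamentU_adj, if_neg (by simp only [Nat.even_iff]; omega)]; exact hab
    · rw [tournamentU_adj, if_neg (by simp only [Nat.even_iff]; omega)]; exact hbd
    · rw [tournamentU_adj, if_pos (by simp only [Nat.even_iff]; omega)]; exact hab.trans hbd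

theorem BulletHypergraph.isBlowUp {ℍ : Hypergraph Γ.ConnectedComponent} :
    (Γ.bullet φ ℍ).IsBlowUp Γ.connectedComponentMk φ.pos Γ.evenComps ℍ where
  vertexSet_eq := rfl
  mem_edgeSet e := by
    simp only [bullet, Set.mem_union, Set.mem_iUnion, exists_prop]
    constructor
    · rintro (⟨C, ⟨hC, -⟩, he⟩ | ⟨ε, hε, ⟨C, hC, D, hD, rfl, a, b, d, i, j, k, ha, hb, hd, hij, rfl⟩ |
        ⟨I, hI, J, hJ, K, hK, hIJ, hIK, hJK, rfl, a, b, d, ha, hb, hd, rfl⟩⟩)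
      · obtain ⟨a, b, d, ha, hb, hd, hab, hbd, rfl⟩ := (mem_compTriples φ).1 he
        refine ⟨_, _, _, rfl, Or.inl ?_⟩
        simp only [φ.mk_apply, φ.pos_apply]
        exact ⟨trivial, trivial, notMem_evenComps.2 hC, hab, hbd, ha, hb, hd⟩
      · refine ⟨_, _, _, rfl, Or.inr (Or.inl ?_)⟩
        simp only [φ.mk_apply, φ.pos_apply]
        exact ⟨trivial, hC, notMem_evenComps.2 hD, hε, by omega, by omega, by omega, by omega⟩
      · refine ⟨_, _, _, rfl, Or.inr (Or.inr ?_)⟩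
        simp only [φ.mk_apply, φ.pos_apply, ← Nat.even_iff]
        exact ⟨hIJ, hIK, hJK, notMem_evenComps.2 hI, notMem_evenComps.2 hJ, notMem_evenComps.2 hK,
          hε, ha, hb, hd⟩
    · rintro ⟨x, y, z, rfl, ⟨h1, h2, h3, h4, h5, h6, h7, h8⟩ | ⟨h1, h2, h3, h4, h5, h6, h7, h8⟩ |
        ⟨h1, h2, h3, h4, h5, h6, h7, h8, h9, h10⟩⟩
      · left
        have hlt := φ.pos_lt h1.symm
        refine ⟨_, ⟨notMem_evenComps.1 h3, fun h => ?_⟩, (mem_compTriples φ).2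
          ⟨⟨φ.pos x, φ.pos_lt rfl⟩, ⟨φ.pos y, hlt⟩, ⟨φ.pos z, φ.pos_lt (h1.trans h2).symm⟩,
            h6, h7, h8, h4, h5, ?_⟩⟩
        · have : (Γ.connectedComponentMk x).supp.ncard = 1 := h
          omega
        · rw [φ.apply_pos rfl, φ.apply_pos h1.symm,
            φ.apply_pos (h1.trans h2).symm]
      · right
        refine ⟨_, h4, Or.inl ⟨_, h2, _, notMem_evenComps.1 h3, rfl, ⟨φ.pos x, φ.pos_lt rfl⟩,
          ⟨φ.pos y, φ.pos_lt h1.symm⟩, ⟨φ.pos z, φ.pos_lt rfl⟩, φ.pos x / 2, φ.pos y / 2,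
          φ.pos z / 2, by dsimp only; omega, by dsimp only; omega, by dsimp only; omega,
          by omega, ?_⟩⟩
        rw [φ.apply_pos rfl, φ.apply_pos h1.symm, φ.apply_pos rfl]
      · right
        refine ⟨_, h7, Or.inr ⟨_, notMem_evenComps.1 h4, _, notMem_evenComps.1 h5, _,
          notMem_evenComps.1 h6, h1, h2, h3, rfl, ⟨φ.pos x, φ.pos_lt rfl⟩,
          ⟨φ.pos y, φ.pos_lt rfl⟩, ⟨φ.pos z, φ.pos_lt rfl⟩, Nat.even_iff.2 h8, Nat.even_iff.2 h9,
          Nat.even_iff.2 h10, ?_⟩⟩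
        rw [φ.apply_pos rfl, φ.apply_pos rfl, φ.apply_pos rfl]

end SimpleGraph

/-! ### The primality graph of a critical 3-hypergraph. -/

namespace Hypergraph

theorem isIndecomposable_image_iff {α β : Type*} {H : Hypergraph α} {f : α → β}
    (hf : Function.Injective f) : (H.image f).IsIndecomposable ↔ H.IsIndecomposable := by
  constructor
  · intro h M hM
    exact (isTrivialModule_image_iff hf).1 (h _ ((isModule_image_iff hf).2 hM))
  · intro h M hM
    obtain ⟨N, -, rfl⟩ := Set.subset_image_iff.1 hM.1
    exact (isTrivialModule_image_iff hf).2 (h _ ((isModule_image_iff hf).1 hM))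

theorem IsTripleModule.diff_singleton {V : Type*} {H : Hypergraph V} {X M : Set V}
    (h : H.IsTripleModule X M) (w : V) : H.IsTripleModule (X \ {w}) (M \ {w}) := by
  refine ⟨Set.sdiff_subset_sdiff_left h.subset, fun a b d he ha hb hd haM hdM => ?_⟩
  obtain ⟨h1, h2⟩ := h.swap a b d he ha.1 hb.1 hd.1 haM.1 fun h' => hdM ⟨h', hd.2⟩
  exact ⟨fun h' => h1 h'.1, fun n hn => h2 n hn.1⟩

variable {V : Type*} {H : Hypergraph V} (hV : H.vertexSet = Set.univ)
  (h3 : ∀ e ∈ H.edgeSet, e.ncard = 3)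
include hV h3

omit hV in
open Classical in
-- An edge has three vertices and so leaves the two-element module; if it meets it at all, it does
-- so once, and the transposition is the exchange of twins.
theorem image_swap_mem_edgeSet {v w α : V} (hM : H.IsTripleModule {v}ᶜ {w, α})
    {e : Set V} (he : e ∈ H.edgeSet) (hv : v ∉ e) : Equiv.swap w α '' e ∈ H.edgeSet := by
  have aux : ∀ w α : V, H.IsTripleModule {v}ᶜ {w, α} → w ∈ e →
      Equiv.swap w α '' e ∈ H.edgeSet := by
    intro w α hM hw
    obtain ⟨b, d, hwb, hwd, rfl⟩ : ∃ b d, w ≠ b ∧ w ≠ d ∧ e = {w, b, d} := by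
      obtain ⟨x, y, z, hxy, hxz, hyz, rfl⟩ := Set.ncard_eq_three.1 (h3 e he)
      simp only [Set.mem_insert_iff, Set.mem_singleton_iff] at hw
      rcases hw with rfl | rfl | rfl
      · exact ⟨y, z, hxy, hxz, rfl⟩
      · exact ⟨z, x, hyz, hxy.symm, triple_rotate _ _ _⟩
      · exact ⟨x, y, hxz.symm, hyz.symm, (triple_rotate _ _ _).symm⟩
    obtain ⟨-, -, hbd⟩ := triple_ne_of_ncard (h3 _ he)
    simp only [Set.mem_insert_iff, Set.mem_singleton_iff, not_or] at hv
    have hdα : d ≠ α := by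
      rintro rfl
      have : b ∉ ({w, d} : Set V) := by
        rintro (h | h)
        exacts [hwb h.symm, hbd h]
      exact (hM.swap w d b (swap_mem he) (Ne.symm hv.1) (Ne.symm hv.2.2) (Ne.symm hv.2.1)
        (Or.inl rfl) this).1 (Or.inr rfl)
    have hd : d ∉ ({w, α} : Set V) := by
      rintro (h | h)
      exacts [hwd h.symm, hdα h]
    obtain ⟨h1, h2⟩ := hM.swap w b d he (Ne.symm hv.1) (Ne.symm hv.2.1) (Ne.symm hv.2.2)
      (Or.inl rfl) hd
    have hbα : b ≠ α := fun h => h1 (Or.inr h)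
    rw [Set.image_insert_eq, Set.image_insert_eq, Set.image_singleton, Equiv.swap_apply_left,
      Equiv.swap_apply_of_ne_of_ne hwb.symm hbα, Equiv.swap_apply_of_ne_of_ne hwd.symm hdα]
    exact h2 α (Or.inr rfl)
  by_cases hw : w ∈ e
  · exact aux w α hM hw
  by_cases hα : α ∈ e
  · rw [Equiv.swap_comm]
    exact aux α w (Set.pair_comm w α ▸ hM) hα
  · convert he using 1
    rw [Set.image_congr (g := id), Set.image_id]
    intro x hx
    exact Equiv.swap_apply_of_ne_of_ne (fun h => hw (h ▸ hx)) (fun h => hα (h ▸ hx))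

/-- Deleting one or the other of two twins of `H - v` gives isomorphic hypergraphs. -/
theorem isIndecomposable_of_twins {v w α : V} (hM : H.IsTripleModule {v}ᶜ {w, α})
    (h : (H.induce {v, w}ᶜ).IsIndecomposable) : (H.induce {v, α}ᶜ).IsIndecomposable := by
  classical
  have hw : w ≠ v := hM.subset (Or.inl rfl)
  have hα : α ≠ v := hM.subset (Or.inr rfl)
  have hset : Equiv.swap w α '' {v, w}ᶜ = {v, α}ᶜ := by
    rw [Set.image_compl_eq (Equiv.bijective _), Set.image_pair, Equiv.swap_apply_left,
      Equiv.swap_apply_of_ne_of_ne hw.symm hα.symm]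
  have hset' : Equiv.swap w α '' {v, α}ᶜ = {v, w}ᶜ := by
    rw [← hset, Set.image_image]
    simp
  have : H.induce {v, α}ᶜ = (H.induce {v, w}ᶜ).image (Equiv.swap w α) := by
    ext e
    · simp only [induce, hV, Set.univ_inter, Hypergraph.image_vertexSet, hset]
    · simp only [induce, Hypergraph.image_edgeSet, Set.mem_image, Set.mem_ofPred_eq]
      constructor
      · rintro ⟨he, hsub⟩
        refine ⟨Equiv.swap w α '' e, ⟨image_swap_mem_edgeSet h3 hM he
          fun hv => hsub hv (Or.inl rfl), ?_⟩, by rw [Set.image_image]; simp⟩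
        rw [← hset']
        exact Set.image_mono hsub
      · rintro ⟨e, ⟨he, hsub⟩, rfl⟩
        refine ⟨image_swap_mem_edgeSet h3 hM he fun hv => hsub hv (Or.inl rfl), ?_⟩
        rw [← hset]
        exact Set.image_mono hsub
  rw [this, isIndecomposable_image_iff (Equiv.injective _)]
  exact h

end Hypergraph

namespace Hypergraph

theorem primalityGraph_adj_iff {V : Type*} [Finite V] {H : Hypergraph V}
    (hV : H.vertexSet = Set.univ) (h5 : 5 ≤ H.vertexSet.ncard) {v w : V} :
    H.primalityGraph.Adj v w ↔ v ≠ w ∧ (H.induce {v, w}ᶜ).IsIndecomposable := by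
  have h : (H.induce {v, w}ᶜ).vertexSet = {v, w}ᶜ := by simp [induce, hV]
  have hc : 3 ≤ ({v, w}ᶜ : Set V).ncard := by
    have h1 := Set.ncard_add_ncard_compl ({v, w} : Set V)
    have h2 := Set.ncard_insert_le v {w}
    rw [Set.ncard_singleton] at h2
    rw [hV, Set.ncard_univ] at h5
    omega
  change (v ≠ w ∧ v ∈ H.vertexSet ∧ w ∈ H.vertexSet ∧ (H.deleteVerts {v, w}).IsPrime) ↔ _
  rw [deleteVerts_eq_induce_compl hV, hV]
  unfold IsPrime
  rw [h]
  simp [hc]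

/-- In a critical 3-hypergraph, let `T` be a proper set of vertices which is closed under adjacency
in the primality graph. If no vertex of `T` has a neighbour `w` isolated in `H - v`, then the
vertices of `T` are isolated in the primality graph. -/
theorem not_primalityGraph_adj {V : Type*} [Finite V] {H : Hypergraph V}
    (hV : H.vertexSet = Set.univ) (h3 : ∀ e ∈ H.edgeSet, e.ncard = 3) (h5 : 5 ≤ H.vertexSet.ncard)
    (hind : H.IsIndecomposable) {T : Set V} (hT : T ≠ Set.univ)
    (hdel : ∀ v ∈ T, ¬ (H.induce {v}ᶜ).IsIndecomposable)
    (hTadj : ∀ v ∈ T, ∀ w, H.primalityGraph.Adj v w → w ∈ T)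
    (hiso : ∀ v ∈ T, ∀ w, H.primalityGraph.Adj v w →
      ¬ ∀ b d, b ≠ v → d ≠ v → {w, b, d} ∉ H.edgeSet) :
    ∀ v ∈ T, ∀ w, ¬ H.primalityGraph.Adj v w := by
  intro v₀ hv₀ w₀ hvw₀
  have hVX : ∀ X : Set V, (H.induce X).vertexSet = X := fun X => by simp [induce, hV]
  have hex := exists_isTripleModule_of_two_regular h3 H.primalityGraph
    (S := {v | v ∈ T ∧ ∃ w, H.primalityGraph.Adj v w}) ⟨v₀, hv₀, w₀, hvw₀⟩ ?_
  · obtain ⟨M, hMT, hMnt, hM⟩ := hex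
    -- The module found is proper because it lies in `T`, and has two vertices, so it contradicts
    -- indecomposability.
    have := hind M (by
      rw [← induce_univ H]
      exact (isModule_induce_iff hV h3).2 hM)
    rcases this with h | h | ⟨x, -, h⟩
    · rw [h] at hMnt; exact Set.not_nontrivial_empty hMnt
    · rw [hV] at h
      exact hT (Set.eq_univ_of_univ_subset (h ▸ fun x hx => (hMT hx).1))
    · rw [h] at hMnt; exact Set.not_nontrivial_singleton hMnt
  · rintro v ⟨hv, w, hvw⟩
    have hdv := hdel v hv
    unfold IsIndecomposable at hdv
    push Not at hdv
    obtain ⟨M, hM, hMt⟩ := hdv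
    rw [isModule_induce_iff hV h3] at hM
    unfold IsTrivialModule at hMt
    rw [hVX] at hMt
    push Not at hMt
    obtain ⟨h1, h2, h4⟩ := hMt
    have key : ∀ w, H.primalityGraph.Adj v w → ∃ α, α ≠ w ∧ M = {w, α} := by
      intro w hvw
      have hadj := (primalityGraph_adj_iff hV h5).1 hvw
      have hwv : w ∈ ({v}ᶜ : Set V) := hadj.1.symm
      have hset : ({v}ᶜ : Set V) \ {w} = {v, w}ᶜ := by
        ext x; simp
      have hmod := hM.diff_singleton w
      rw [hset] at hmod
      have htriv := hadj.2 _ ((isModule_induce_iff hV h3).2 hmod)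
      unfold IsTrivialModule at htriv
      rw [hVX] at htriv
      -- If `M \ {w}` is empty, `M` was trivial. If it is everything left, then `w ∉ M`, and an edge
      -- at `w` avoiding `v` would have two vertices in `M` and one outside, so `w` would be
      -- isolated in `H - v`. Only a pair remains.
      rcases htriv with h | h | ⟨α, hα, h⟩
      · exfalso
        rw [Set.sdiff_eq_empty] at h
        rcases Set.subset_singleton_iff_eq.1 h with h | h
        · exact h1.ne_empty h
        · exact h4 w hwv h
      · exfalso
        have hmem : ∀ x, x ≠ v → x ≠ w → x ∈ M := by
          intro x hxv hxw
          have hx : x ∈ M \ {w} := by rw [h]; simp [hxv, hxw]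
          exact hx.1
        have hwM : w ∉ M := by
          intro hw
          refine h2 (hM.subset.antisymm fun x hx => ?_)
          by_cases hxw : x = w
          · rwa [hxw]
          · exact hmem x hx hxw
        refine hiso v hv w hvw fun b d hb hd he => ?_
        obtain ⟨hwb, hwd, -⟩ := triple_ne_of_ncard (h3 _ he)
        exact (hM.swap b d w (rotate_mem he) hb hd hwv (hmem b hb hwb.symm) hwM).1
          (hmem d hd hwd.symm)
      · have hαM : α ∈ M \ {w} := by rw [h]; rfl
        refine ⟨α, hαM.2, ?_⟩
        by_cases hw : w ∈ M
        · rw [← h, Set.insert_sdiff_singleton, Set.insert_eq_of_mem hw]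
        · rw [Set.sdiff_singleton_eq_self hw] at h
          exact absurd h (h4 α (hM.subset hαM.1))
    obtain ⟨α, hαw, rfl⟩ := key w hvw
    have hadj := (primalityGraph_adj_iff hV h5).1 hvw
    -- Exchanging the twins makes `α` a second neighbour of `v`. Any neighbour belongs to the same
    -- module by `key`, so there is no third.
    have hvα : H.primalityGraph.Adj v α :=
      (primalityGraph_adj_iff hV h5).2 ⟨fun h => hM.subset (Or.inr rfl) h.symm,
        isIndecomposable_of_twins hV h3 hM hadj.2⟩
    refine ⟨w, ⟨hTadj v hv w hvw, v, hvw.symm⟩, α, ⟨hTadj v hv α hvα, v, hvα.symm⟩, hαw.symm,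
      fun x => ⟨fun hx => ?_, ?_⟩, hM⟩
    · obtain ⟨β, -, hβ⟩ := key x hx
      have : x ∈ ({w, α} : Set V) := by rw [hβ]; exact Or.inl rfl
      exact this
    · rintro (rfl | rfl)
      exacts [hvw, hvα]

end Hypergraph

/-! ### Primality of the restrictions of `Γ • ℍ`. -/

namespace SimpleGraph

open Hypergraph

variable {V : Type*} {Γ : SimpleGraph V}

theorem mem_singletonComps_mk {v : V} : Γ.connectedComponentMk v ∈ Γ.singletonComps ↔
    ∀ y, Γ.connectedComponentMk y = Γ.connectedComponentMk v → y = v := by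
  change (Γ.connectedComponentMk v).supp.ncard = 1 ↔ _
  rw [Set.ncard_eq_one]
  constructor
  · rintro ⟨a, ha⟩ y hy
    have h1 : y ∈ (Γ.connectedComponentMk v).supp := hy
    have h2 : v ∈ (Γ.connectedComponentMk v).supp := rfl
    rw [ha] at h1 h2
    exact h1.trans h2.symm
  · intro h
    exact ⟨v, Set.eq_singleton_iff_unique_mem.2 ⟨rfl, h⟩⟩

theorem singletonBlocks_preimage (S : Set Γ.ConnectedComponent) :
    singletonBlocks Γ.connectedComponentMk (Γ.connectedComponentMk ⁻¹' S) =
      Γ.singletonComps ∩ S := by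
  ext C
  constructor
  · rintro ⟨x, hx, rfl, h⟩
    exact ⟨mem_singletonComps_mk.2 fun y hy => h y (by rwa [Set.mem_preimage, hy]) hy, hx⟩
  · rintro ⟨hC, hCS⟩
    obtain ⟨x, rfl⟩ := C.exists_rep
    exact ⟨x, hCS, rfl, fun y _ hy => mem_singletonComps_mk.1 hC y hy⟩

theorem surjective_mk : Function.Surjective Γ.connectedComponentMk := fun C => C.exists_rep

theorem preimage_compl_singleton {v : V} (hv : Γ.connectedComponentMk v ∈ Γ.singletonComps) :
    Γ.connectedComponentMk ⁻¹' {Γ.connectedComponentMk v}ᶜ = {v}ᶜ := by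
  ext x
  exact not_congr ⟨mem_singletonComps_mk.1 hv x, fun h => congrArg _ h⟩

theorem preimage_compl_pair {v w : V} (hv : Γ.connectedComponentMk v ∈ Γ.singletonComps)
    (hw : Γ.connectedComponentMk w ∈ Γ.singletonComps) :
    Γ.connectedComponentMk ⁻¹' {Γ.connectedComponentMk v, Γ.connectedComponentMk w}ᶜ =
      {v, w}ᶜ := by
  ext x
  exact not_congr (or_congr ⟨mem_singletonComps_mk.1 hv x, fun h => congrArg _ h⟩
    ⟨mem_singletonComps_mk.1 hw x, fun h => congrArg _ h⟩)

variable [Finite V] (φ : Γ.PathParam) {ℍ : Hypergraph Γ.ConnectedComponent}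
  (hℍ : Γ.BulletHypergraph ℍ)
include hℍ

theorem isPrime_bullet_induce_preimage_iff {S : Set Γ.ConnectedComponent}
    (hcard : 3 ≤ (Γ.connectedComponentMk ⁻¹' S).ncard) (hns : ∀ C ∈ Γ.evenComps, ∃ D ∈ S, D ≠ C) :
    ((Γ.bullet φ ℍ).induce (Γ.connectedComponentMk ⁻¹' S)).IsPrime ↔
      (ℍ.induce S).IsConnected ∧ ∀ M, (ℍ.induce S).IsNontrivialModule23 M →
        (M \ Γ.singletonComps).Nonempty := by
  have halt : Alternates Γ.connectedComponentMk φ.pos Γ.evenComps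
      (Γ.connectedComponentMk ⁻¹' S) := by
    convert φ.isBlockPosition.alternates_univ.diff_preimage Sᶜ using 1
    ext x; simp
  have himg : Γ.connectedComponentMk '' (Γ.connectedComponentMk ⁻¹' S) = S :=
    Set.image_preimage_eq S surjective_mk
  rw [halt.isPrime_induce_iff (BulletHypergraph.isBlowUp φ) hℍ.isBlockPattern hcard, himg,
    singletonBlocks_preimage]
  · refine and_congr_right fun _ => forall₂_congr fun M hM => ?_
    have hMS : M ⊆ S := fun i hi => (hM.subset_vertexSet hi).2
    constructor
    · rintro ⟨i, hi, hin⟩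
      exact ⟨i, hi, fun h => hin ⟨h, hMS hi⟩⟩
    · rintro ⟨i, hi, hin⟩
      exact ⟨i, hi, fun h => hin h.1⟩
  · intro C hC
    obtain ⟨D, hD, hDC⟩ := hns C hC
    obtain ⟨x, rfl⟩ := surjective_mk D
    exact ⟨x, hD, hDC⟩

/-- A component with at least three vertices does not disappear, so the pattern is still `ℍ`; it
becomes a one-vertex block precisely when it had three vertices. -/
theorem isPrime_bullet_induce_compl_pair_iff {v w : V} (hcard : 3 ≤ ({v, w}ᶜ : Set V).ncard)
    (hns : ∀ C ∈ Γ.evenComps, ∃ D, D ≠ C)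
    (hvw : Γ.connectedComponentMk v = Γ.connectedComponentMk w) (hpos : φ.pos w = φ.pos v + 1)
    (h3 : 3 ≤ (Γ.connectedComponentMk v).supp.ncard) :
    ((Γ.bullet φ ℍ).induce {v, w}ᶜ).IsPrime ↔
      ℍ.IsConnected ∧ ∀ M, ℍ.IsNontrivialModule23 M → (M \ (Γ.singletonComps ∪
        {C | C = Γ.connectedComponentMk v ∧ C.supp.ncard = 3})).Nonempty := by
  have hp := φ.isBlockPosition
  have hmem : ∀ x, Γ.connectedComponentMk x = Γ.connectedComponentMk v →
      (x ∈ ({v, w}ᶜ : Set V) ↔ φ.pos x ≠ φ.pos v ∧ φ.pos x ≠ φ.pos v + 1) := by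
    intro x hx
    simp only [Set.mem_compl_iff, Set.mem_insert_iff, Set.mem_singleton_iff, not_or]
    refine and_congr (not_congr ⟨fun h => h ▸ rfl, fun h => hp.inj _ _ hx h⟩)
      (not_congr ⟨fun h => h ▸ hpos, fun h => hp.inj _ _ (hx.trans hvw) (h.trans hpos.symm)⟩)
  have hmem' : ∀ x, Γ.connectedComponentMk x ≠ Γ.connectedComponentMk v →
      x ∈ ({v, w}ᶜ : Set V) := by
    rintro x hx (rfl | rfl)
    exacts [hx rfl, hx hvw.symm]
  have hlt : φ.pos v + 1 < (Γ.connectedComponentMk v).supp.ncard := by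
    rw [← hpos]; exact φ.pos_lt hvw.symm
  have hex : ∀ k, k < (Γ.connectedComponentMk v).supp.ncard → k ≠ φ.pos v → k ≠ φ.pos v + 1 →
      ∃ x ∈ ({v, w}ᶜ : Set V), Γ.connectedComponentMk x = Γ.connectedComponentMk v ∧
        φ.pos x = k := by
    intro k hk h1 h2
    obtain ⟨x, hx, rfl⟩ := hp.surj _ k hk
    exact ⟨x, (hmem x hx).2 ⟨h1, h2⟩, hx, rfl⟩
  have himg : Γ.connectedComponentMk '' {v, w}ᶜ = Set.univ := by
    refine Set.eq_univ_of_forall fun C => ?_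
    obtain ⟨x, rfl⟩ := surjective_mk C
    by_cases hx : Γ.connectedComponentMk x = Γ.connectedComponentMk v
    · rw [hx]
      by_cases h0 : φ.pos v = 0
      · obtain ⟨y, hy, hyv, -⟩ := hex 2 (by omega) (by omega) (by omega)
        exact ⟨y, hy, hyv⟩
      · obtain ⟨y, hy, hyv, -⟩ := hex 0 (by omega) (by omega) (by omega)
        exact ⟨y, hy, hyv⟩
    · exact ⟨x, hmem' x hx, rfl⟩
  have hsing : singletonBlocks Γ.connectedComponentMk ({v, w}ᶜ : Set V) = Γ.singletonComps ∪
      {C | C = Γ.connectedComponentMk v ∧ C.supp.ncard = 3} := by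
    ext C
    by_cases hC : C = Γ.connectedComponentMk v
    · subst hC
      have hns : Γ.connectedComponentMk v ∉ Γ.singletonComps := by
        intro h
        have : (Γ.connectedComponentMk v).supp.ncard = 1 := h
        omega
      simp only [Set.mem_union, hns, false_or, Set.mem_ofPred_eq, true_and]
      constructor
      · rintro ⟨x, hx, hxv, huniq⟩
        by_contra hn
        have h2 : ∀ k l, k < (Γ.connectedComponentMk v).supp.ncard →
            l < (Γ.connectedComponentMk v).supp.ncard → k ≠ φ.pos v → k ≠ φ.pos v + 1 →
            l ≠ φ.pos v → l ≠ φ.pos v + 1 → k = l := by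
          intro k l hk hl h1 h2 h4 h5
          obtain ⟨y, hy, hyv, rfl⟩ := hex k hk h1 h2
          obtain ⟨z, hz, hzv, rfl⟩ := hex l hl h4 h5
          rw [huniq y hy hyv, huniq z hz hzv]
        rcases Nat.lt_or_ge (φ.pos v) 2 with h | h
        · by_cases h0 : φ.pos v = 0
          · have := h2 2 3 (by omega) (by omega) (by omega) (by omega) (by omega) (by omega)
            omega
          · have := h2 0 3 (by omega) (by omega) (by omega) (by omega) (by omega) (by omega)
            omega
        · have := h2 0 1 (by omega) (by omega) (by omega) (by omega) (by omega) (by omega)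
          omega
      · intro hn
        -- The surviving position on a path with three vertices: 2 if the first two are deleted, 0
        -- if the last two are.
        obtain ⟨x, hx, hxv, hxp⟩ := hex (2 - 2 * φ.pos v) (by omega) (by omega) (by omega)
        refine ⟨x, hx, hxv, fun y hy hyv => hp.inj _ _ (hyv.trans hxv.symm) ?_⟩
        have h1 := (hmem y hyv).1 hy
        have h2 := φ.pos_lt hyv
        omega
    · have : C ∈ Γ.singletonComps ∪ {C | C = Γ.connectedComponentMk v ∧ C.supp.ncard = 3} ↔
          C ∈ Γ.singletonComps := by simp [hC]
      rw [this]
      constructor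
      · rintro ⟨x, hx, rfl, huniq⟩
        exact mem_singletonComps_mk.2 fun y hy => huniq y (hmem' y (by rwa [hy])) hy
      · intro hs
        obtain ⟨x, rfl⟩ := surjective_mk C
        exact ⟨x, hmem' x hC, rfl, fun y _ hy => mem_singletonComps_mk.1 hs y hy⟩
  rw [(hp.alternates_compl_pair hvw hpos).isPrime_induce_iff (BulletHypergraph.isBlowUp φ)
    hℍ.isBlockPattern hcard, himg, hsing, induce_univ]
  intro C hC
  obtain ⟨D, hDC⟩ := hns C hC
  obtain ⟨x, hx, rfl⟩ : D ∈ Γ.connectedComponentMk '' {v, w}ᶜ := by rw [himg]; trivial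
  exact ⟨x, hx, hDC⟩

omit [Finite V] hℍ in
-- Replacing `C` is an injective relabelling, since `{x}` with `x` in `C` is not the support of
-- another component. Only the list of one-vertex blocks changes, by the addition of `C`; any vertex
-- of `C` would serve.
theorem replaceComp_iff {C : Γ.ConnectedComponent} {x : V}
    (hx : Γ.connectedComponentMk x = C) :
    ((replaceComp ℍ C x).IsConnected ∧ ∀ M, (replaceComp ℍ C x).IsNontrivialModule23 M →
      (M \ (ConnectedComponent.supp '' Γ.singletonComps ∪ {{x}})).Nonempty) ↔
    (ℍ.IsConnected ∧ ∀ M, ℍ.IsNontrivialModule23 M →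
      (M \ (Γ.singletonComps ∪ {C})).Nonempty) := by
  classical
  have hf : Function.Injective (fun D : Γ.ConnectedComponent => if D = C then {x} else D.supp) := by
    have aux : ∀ D : Γ.ConnectedComponent, D ≠ C → ({x} : Set V) ≠ D.supp := by
      intro D hD h
      have : x ∈ D.supp := by rw [← h]; rfl
      exact hD (Eq.trans (Eq.symm this) hx)
    intro D D' h
    dsimp only at h
    split_ifs at h with h1 h2 h2
    · exact h1.trans h2.symm
    · exact absurd h (aux _ h2)
    · exact absurd h.symm (aux _ h1)
    · exact ConnectedComponent.supp_injective h
  have hrep : replaceComp ℍ C x = ℍ.image (fun D => if D = C then {x} else D.supp) := by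
    unfold replaceComp
    congr!
  rw [hrep]
  set f := fun D : Γ.ConnectedComponent => if D = C then {x} else D.supp with hfdef
  have hfC : f C = {x} := if_pos rfl
  have hmem : ∀ D, f D ∈ ConnectedComponent.supp '' Γ.singletonComps ∪ {{x}} ↔
      D ∈ Γ.singletonComps ∪ {C} := by
    intro D
    by_cases hD : D = C
    · subst hD
      simp [hfC]
    · have h1 : f D = D.supp := if_neg hD
      have h2 : D.supp ≠ {x} := by
        rw [← h1, ← hfC]; exact fun h => hD (hf h)
      simp [h1, h2, hD, ConnectedComponent.supp_injective.mem_set_image]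
  rw [isConnected_image_iff hf]
  refine and_congr_right fun _ => ⟨fun h M hM => ?_, fun h M hM => ?_⟩
  · obtain ⟨_, ⟨D, hD, rfl⟩, hDn⟩ := h (f '' M) ((isNontrivialModule23_image_iff hf).2 hM)
    exact ⟨D, hD, fun h' => hDn ((hmem D).2 h')⟩
  · obtain ⟨N, -, rfl⟩ := Set.subset_image_iff.1 hM.subset_vertexSet
    obtain ⟨D, hD, hDn⟩ := h N ((isNontrivialModule23_image_iff hf).1 hM)
    exact ⟨f D, ⟨D, hD, rfl⟩, fun h' => hDn ((hmem D).1 h')⟩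

omit hℍ in
-- If `w` is not next to `v` on its path, the neighbours of `v` survive the deletion of `w`, and so
-- does the decomposability caused by deleting `v`.
theorem adj_of_primalityGraph_adj (hcard : 5 ≤ (Γ.bullet φ ℍ).vertexSet.ncard) {v w : V}
    (hv : Γ.connectedComponentMk v ∉ Γ.singletonComps)
    (hvw : (Γ.bullet φ ℍ).primalityGraph.Adj v w) : Γ.Adj v w := by
  by_contra hadj
  have h := (primalityGraph_adj_iff rfl hcard).1 hvw
  have hpos : 0 < (Γ.connectedComponentMk v).supp.ncard := (Nat.zero_le _).trans_lt (φ.pos_lt rfl)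
  have hn1 : (Γ.connectedComponentMk v).supp.ncard ≠ 1 := hv
  refine φ.isBlockPosition.not_isIndecomposable (BulletHypergraph.isBlowUp φ) (X := {v, w}ᶜ) ?_
    (v := v) (by omega) (fun h => h (Or.inl rfl)) ?_ h.2
  · have h1 := Set.ncard_add_ncard_compl ({v, w} : Set V)
    have h2 := Set.ncard_insert_le v {w}
    rw [Set.ncard_singleton] at h2
    change 5 ≤ (Set.univ : Set V).ncard at hcard
    rw [Set.ncard_univ] at hcard
    omega
  · rintro u huv hu (rfl | rfl)
    · omega
    · exact hadj (φ.adj_iff.2 ⟨huv.symm, by omega⟩)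

omit hℍ in
theorem not_isIndecomposable_deleteVerts (hcard : 5 ≤ (Γ.bullet φ ℍ).vertexSet.ncard) {v : V}
    (hv : Γ.connectedComponentMk v ∉ Γ.singletonComps) :
    ¬ ((Γ.bullet φ ℍ).induce {v}ᶜ).IsIndecomposable := by
  have hpos : 0 < (Γ.connectedComponentMk v).supp.ncard := (Nat.zero_le _).trans_lt (φ.pos_lt rfl)
  have hn1 : (Γ.connectedComponentMk v).supp.ncard ≠ 1 := hv
  refine φ.isBlockPosition.not_isIndecomposable (BulletHypergraph.isBlowUp φ) (X := {v}ᶜ) ?_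
    (v := v) (by omega) (fun h => h rfl) ?_
  · have h1 := Set.ncard_add_ncard_compl ({v} : Set V)
    rw [Set.ncard_singleton] at h1
    change 5 ≤ (Set.univ : Set V).ncard at hcard
    rw [Set.ncard_univ] at hcard
    omega
  · rintro u huv hu rfl
    omega

end SimpleGraph

/-! ### Translation of the deletions that occur in the six conditions. -/

namespace SimpleGraph

open Hypergraph

variable {V : Type*} {Γ : SimpleGraph V} [Finite V] (φ : Γ.PathParam)
  {ℍ : Hypergraph Γ.ConnectedComponent}

theorem three_le_ncard_compl_pair (hcard : 5 ≤ (Γ.bullet φ ℍ).vertexSet.ncard) (v w : V) :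
    3 ≤ ({v, w}ᶜ : Set V).ncard := by
  have h1 := Set.ncard_add_ncard_compl ({v, w} : Set V)
  have h2 := Set.ncard_insert_le v {w}
  rw [Set.ncard_singleton] at h2
  change 5 ≤ (Set.univ : Set V).ncard at hcard
  rw [Set.ncard_univ] at hcard
  omega

theorem three_le_ncard_compl_singleton (hcard : 5 ≤ (Γ.bullet φ ℍ).vertexSet.ncard) (v : V) :
    3 ≤ ({v}ᶜ : Set V).ncard := by
  simpa using three_le_ncard_compl_pair φ hcard v v

omit [Finite V] in
theorem isPrime_bullet_induce_iff {X : Set V} (hX : 3 ≤ X.ncard) :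
    ((Γ.bullet φ ℍ).induce X).IsPrime ↔ ((Γ.bullet φ ℍ).induce X).IsIndecomposable := by
  have h : ((Γ.bullet φ ℍ).induce X).vertexSet = X := Set.univ_inter X
  unfold IsPrime
  rw [h]
  exact and_iff_left hX

omit [Finite V] in
theorem exists_mem_compl_supp (heven : ∀ C ∈ Γ.evenComps, 2 ≤ ((C.supp)ᶜ).ncard)
    {C : Γ.ConnectedComponent} (hC : C ∈ Γ.evenComps) (v : V) :
    ∃ x, Γ.connectedComponentMk x ≠ C ∧ x ≠ v := by
  obtain ⟨x, hx, hxv⟩ := Set.exists_ne_of_one_lt_ncard (heven C hC) v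
  exact ⟨x, hx, hxv⟩

variable (hℍ : Γ.BulletHypergraph ℍ) (hcard : 5 ≤ (Γ.bullet φ ℍ).vertexSet.ncard)
  (heven : ∀ C ∈ Γ.evenComps, 2 ≤ ((C.supp)ᶜ).ncard)
include hℍ hcard heven

theorem isPrime_bullet_iff : (Γ.bullet φ ℍ).IsPrime ↔ ℍ.IsConnected ∧
    ∀ M, ℍ.IsNontrivialModule23 M → (M \ Γ.singletonComps).Nonempty := by
  have := isPrime_bullet_induce_preimage_iff φ hℍ (S := Set.univ)
    (by rw [Set.preimage_univ]; change 5 ≤ (Set.univ : Set V).ncard at hcard; omega) fun C hC => by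
      obtain ⟨x, -⟩ := C.exists_rep
      obtain ⟨y, hy, -⟩ := exists_mem_compl_supp heven hC x
      exact ⟨_, trivial, hy⟩
  rwa [Set.preimage_univ, induce_univ, induce_univ] at this

theorem isIndecomposable_bullet_compl_singleton_iff {v : V}
    (hv : Γ.connectedComponentMk v ∈ Γ.singletonComps) :
    ((Γ.bullet φ ℍ).induce {v}ᶜ).IsIndecomposable ↔
      (ℍ.deleteVerts {Γ.connectedComponentMk v}).IsConnected ∧
      ∀ M, (ℍ.deleteVerts {Γ.connectedComponentMk v}).IsNontrivialModule23 M →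
        (M \ Γ.singletonComps).Nonempty := by
  have hc := three_le_ncard_compl_singleton φ hcard v
  have := isPrime_bullet_induce_preimage_iff φ hℍ (S := {Γ.connectedComponentMk v}ᶜ)
    (by rwa [preimage_compl_singleton hv]) fun C hC => by
      obtain ⟨y, hy, hyv⟩ := exists_mem_compl_supp heven hC v
      exact ⟨_, fun h => hyv (mem_singletonComps_mk.1 hv y h), hy⟩
  rwa [preimage_compl_singleton hv, isPrime_bullet_induce_iff φ hc,
    ← deleteVerts_eq_induce_compl hℍ.vertexSet_eq] at this

omit heven in
-- The condition on even components in `BulletGraph` ensures that no even block is left alone: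
-- another component with more than one vertex remains.
theorem isIndecomposable_bullet_compl_singletons_iff (hΓ : Γ.BulletGraph)
    (heven : ∀ C ∈ Γ.evenComps, 2 ≤ ((C.supp)ᶜ).ncard) {v w : V}
    (hv : Γ.connectedComponentMk v ∈ Γ.singletonComps)
    (hw : Γ.connectedComponentMk w ∈ Γ.singletonComps) :
    ((Γ.bullet φ ℍ).induce {v, w}ᶜ).IsIndecomposable ↔
      (ℍ.deleteVerts {Γ.connectedComponentMk v, Γ.connectedComponentMk w}).IsConnected ∧
      ∀ M, (ℍ.deleteVerts
        {Γ.connectedComponentMk v, Γ.connectedComponentMk w}).IsNontrivialModule23 M →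
        (M \ Γ.singletonComps).Nonempty := by
  have hc := three_le_ncard_compl_pair φ hcard v w
  have := isPrime_bullet_induce_preimage_iff φ hℍ
    (S := {Γ.connectedComponentMk v, Γ.connectedComponentMk w}ᶜ)
    (by rwa [preimage_compl_pair hv hw]) fun C hC => by
      obtain ⟨D, hD, hDC⟩ := hΓ.even_comp C hC (heven C hC)
      refine ⟨D, ?_, hDC⟩
      rintro (rfl | rfl)
      exacts [hD hv, hD hw]
  rwa [preimage_compl_pair hv hw, isPrime_bullet_induce_iff φ hc,
    ← deleteVerts_eq_induce_compl hℍ.vertexSet_eq] at this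

theorem isIndecomposable_bullet_compl_pair_iff_of_two (hconn : ℍ.IsConnected) {v w : V}
    (hvw : Γ.connectedComponentMk w = Γ.connectedComponentMk v) (hne : v ≠ w)
    (h2 : (Γ.connectedComponentMk v).supp.ncard = 2) :
    ((Γ.bullet φ ℍ).induce {v, w}ᶜ).IsIndecomposable ↔
      (ℍ.deleteVerts {Γ.connectedComponentMk v}).IsConnected ∧
      ∀ M, (ℍ.deleteVerts {Γ.connectedComponentMk v}).IsNontrivialModule23 M →
        (M \ Γ.singletonComps).Nonempty := by
  have hc := three_le_ncard_compl_pair φ hcard v w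
  have hE : Γ.connectedComponentMk v ∈ Γ.evenComps := by
    change Even _
    rw [h2]
    exact even_two
  have hset : Γ.connectedComponentMk ⁻¹' {Γ.connectedComponentMk v}ᶜ = {v, w}ᶜ := by
    rw [Set.preimage_compl]
    congr 1
    refine (Set.eq_of_subset_of_ncard_le ?_ ?_).symm
    · rintro x (rfl | rfl)
      exacts [rfl, hvw]
    · rw [Set.ncard_pair hne]
      exact h2.le
  have := isPrime_bullet_induce_preimage_iff φ hℍ (S := {Γ.connectedComponentMk v}ᶜ)
    (by rwa [hset]) fun C hC => by
      obtain ⟨x, hx, -⟩ := exists_mem_compl_supp heven hC v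
      by_cases hCv : C = Γ.connectedComponentMk v
      · exact ⟨_, fun h => hx (h.trans hCv.symm), hx⟩
      -- Another even component is joined in `ℍ` to an odd one, which survives because the deleted
      -- component is even.
      · obtain ⟨D, -, hD, -⟩ := Alternates.exists_edge_of_even (c := Γ.connectedComponentMk)
          (X := Set.univ) hℍ.isBlockPattern
          (by rwa [Set.image_univ_of_surjective surjective_mk, induce_univ]) hC
          (by rw [Set.image_univ_of_surjective surjective_mk]; trivial) ⟨x, trivial, hx⟩
        refine ⟨D, ?_, ?_⟩
        · rintro rfl; exact hD hE
        · rintro rfl; exact hD hC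
  rwa [hset, isPrime_bullet_induce_iff φ hc,
    ← deleteVerts_eq_induce_compl hℍ.vertexSet_eq] at this

theorem isIndecomposable_bullet_compl_pair_iff_of_three {v w : V} {C : Γ.ConnectedComponent}
    (hv : Γ.connectedComponentMk v = C) (hw : Γ.connectedComponentMk w = C)
    (hpos : φ.pos w = φ.pos v + 1) (h3 : C.supp.ncard = 3) {x : V}
    (hx : Γ.connectedComponentMk x = C) :
    ((Γ.bullet φ ℍ).induce {v, w}ᶜ).IsIndecomposable ↔
      (replaceComp ℍ C x).IsConnected ∧ ∀ M, (replaceComp ℍ C x).IsNontrivialModule23 M →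
        (M \ (ConnectedComponent.supp '' Γ.singletonComps ∪ {{x}})).Nonempty := by
  subst hv
  have hc := three_le_ncard_compl_pair φ hcard v w
  have := isPrime_bullet_induce_compl_pair_iff φ hℍ hc (fun C hC => by
      obtain ⟨x, hx, -⟩ := exists_mem_compl_supp heven hC v
      exact ⟨_, hx⟩) hw.symm hpos h3.ge
  rw [replaceComp_iff hx, ← isPrime_bullet_induce_iff φ hc, this]
  have hset : {C | C = Γ.connectedComponentMk v ∧ C.supp.ncard = 3} =
      {Γ.connectedComponentMk v} := by
    ext C
    exact ⟨fun h => h.1, fun h => ⟨h, by rw [show C = _ from h]; exact h3⟩⟩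
  rw [hset]

theorem isIndecomposable_bullet_compl_pair_iff_of_four {v w : V}
    (hvw : Γ.connectedComponentMk v = Γ.connectedComponentMk w)
    (hpos : φ.pos w = φ.pos v + 1) (h4 : 4 ≤ (Γ.connectedComponentMk v).supp.ncard) :
    ((Γ.bullet φ ℍ).induce {v, w}ᶜ).IsIndecomposable ↔ ℍ.IsConnected ∧
      ∀ M, ℍ.IsNontrivialModule23 M → (M \ Γ.singletonComps).Nonempty := by
  have hc := three_le_ncard_compl_pair φ hcard v w
  have := isPrime_bullet_induce_compl_pair_iff φ hℍ hc (fun C hC => by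
      obtain ⟨x, hx, -⟩ := exists_mem_compl_supp heven hC v
      exact ⟨_, hx⟩) hvw hpos (by omega)
  rw [← isPrime_bullet_induce_iff φ hc, this]
  have hset : {C | C = Γ.connectedComponentMk v ∧ C.supp.ncard = 3} = ∅ := by
    rw [Set.eq_empty_iff_forall_notMem]
    rintro C ⟨rfl, h⟩
    omega
  rw [hset, Set.union_empty]

omit [Finite V] hcard heven in
-- An edge of `ℍ` through the block of `w` that avoids the block of `v` lifts to an edge through `w`
-- avoiding `v`: the other two vertices are taken in an even block, or at even positions of two odd
-- blocks.
theorem isIsolated_deleteVerts {v w : V}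
    (hv : Γ.connectedComponentMk v ∈ Γ.singletonComps)
    (hw : Γ.connectedComponentMk w ∈ Γ.singletonComps)
    (h : ∀ b d, b ≠ v → d ≠ v → {w, b, d} ∉ (Γ.bullet φ ℍ).edgeSet) :
    (ℍ.deleteVerts {Γ.connectedComponentMk v}).IsIsolated (Γ.connectedComponentMk w) := by
  rw [deleteVerts_eq_induce_compl hℍ.vertexSet_eq]
  rintro ε ⟨hε, hεv⟩ hwε
  have hH := BulletHypergraph.isBlowUp (Γ := Γ) φ (ℍ := ℍ)
  have halt := φ.isBlockPosition.alternates_univ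
  have hne : ∀ x, Γ.connectedComponentMk x ∈ ε → x ≠ v := by
    rintro x hx rfl
    exact hεv hx rfl
  have hws : Γ.connectedComponentMk w ∈ singletonBlocks Γ.connectedComponentMk Set.univ :=
    ⟨w, trivial, rfl, fun y _ hy => mem_singletonComps_mk.1 hw y hy⟩
  obtain ⟨hwE, hw2, -⟩ := halt.singleton_spec (Set.mem_univ w) hws
  rcases hℍ.isBlockPattern.cases hε with ⟨i, hi, j, hj, rfl⟩ | ⟨i, hi, j, hj, k, hk, hij, hik, hjk, rfl⟩
  · obtain ⟨x, rfl⟩ := surjective_mk i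
    rcases hwε with hwi | rfl
    · exact hwE (hwi ▸ hi)
    · obtain ⟨y, -, hyx, he⟩ := halt.exists_partner hH (Set.mem_univ x) hi hwE hε hw2
      exact h x y (hne x (by simp)) (hne y (by simp [hyx])) (rotate_mem (rotate_mem he))
  · obtain ⟨a, b, d, hda, hdb, hab, hbd, hε'⟩ : ∃ a b d : Γ.ConnectedComponent,
        d ≠ a ∧ d ≠ b ∧ a ≠ b ∧ d = Γ.connectedComponentMk w ∧ ({i, j, k} : Set _) = {d, a, b} := by
      rcases hwε with hwi | hwj | hwk
      · exact ⟨j, k, i, hij, hik, hjk, hwi.symm, rfl⟩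
      · exact ⟨k, i, j, hjk, hij.symm, hik.symm, hwj.symm, triple_rotate _ _ _⟩
      · exact ⟨i, j, k, hik.symm, hjk.symm, hij, (show _ = k from hwk).symm,
          (triple_rotate _ _ _).symm⟩
    have hodd : ∀ l ∈ ({i, j, k} : Set Γ.ConnectedComponent), l ∉ Γ.evenComps := by
      rintro l (rfl | rfl | rfl) <;> assumption
    obtain ⟨x, rfl⟩ := surjective_mk a
    obtain ⟨y, rfl⟩ := surjective_mk b
    obtain ⟨x', -, hx, hx2⟩ := halt.exists_even (Set.mem_univ x)
    obtain ⟨y', -, hy, hy2⟩ := halt.exists_even (Set.mem_univ y)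
    subst hbd
    rw [hε'] at hε hodd hne
    rw [← hx, ← hy] at hε hodd hne
    rw [← hx] at hda hab
    rw [← hy] at hdb hab
    exact h x' y' (hne x' (by simp)) (hne y' (by simp)) (hH.triple_mem (Or.inr (Or.inr
      ⟨hda, hdb, hab, hwE, hodd _ (by simp), hodd _ (by simp), hε, hw2, hx2, hy2⟩)))

end SimpleGraph

/-! ### The equivalence. -/

theorem mainTheorem4 {V : Type*} [Finite V] (Γ : SimpleGraph V) (φ : Γ.PathParam)
    (hΓ : Γ.BulletGraph) (ℍ : Hypergraph Γ.ConnectedComponent) (hℍ : Γ.BulletHypergraph ℍ)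
    (hcard : 5 ≤ (Γ.bullet φ ℍ).vertexSet.ncard)
    (heven : ∀ C ∈ Γ.evenComps, 2 ≤ ((C.supp)ᶜ).ncard) :
    ((Γ.bullet φ ℍ).IsCritical ∧ (Γ.bullet φ ℍ).primalityGraph = Γ) ↔
      -- (C1)
      (ℍ.IsConnected ∧
      -- (C2)
      (∀ M, ℍ.IsNontrivialModule23 M → (M \ Γ.singletonComps).Nonempty) ∧
      -- (C3)
      (∀ v : V, Γ.connectedComponentMk v ∈ Γ.singletonComps →
        (ℍ.deleteVerts {Γ.connectedComponentMk v}).IsConnected →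
        ∃ M, (ℍ.deleteVerts {Γ.connectedComponentMk v}).IsNontrivialModule23 M ∧
          M ⊆ Γ.singletonComps \ {Γ.connectedComponentMk v}) ∧
      -- (C4)
      (∀ C ∈ Γ.evenComps, C.supp.ncard = 2 →
        (ℍ.deleteVerts {C}).IsConnected ∧
        ∀ M, (ℍ.deleteVerts {C}).IsNontrivialModule23 M → (M \ Γ.singletonComps).Nonempty) ∧
      -- (C5)
      (∀ C ∈ Γ.oddComps, ∀ hC : C.supp.ncard = 3,
        (SimpleGraph.replaceComp ℍ C (φ C ⟨0, by omega⟩ : V)).IsConnected ∧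
        ∀ M, (SimpleGraph.replaceComp ℍ C (φ C ⟨0, by omega⟩ : V)).IsNontrivialModule23 M →
          (M \ (SimpleGraph.ConnectedComponent.supp '' Γ.singletonComps ∪
            {{(φ C ⟨0, by omega⟩ : V)}})).Nonempty) ∧
      -- (C6)
      (∀ C ∈ Γ.singletonComps, ∀ D ∈ Γ.singletonComps \ {C},
        (ℍ.deleteVerts {C}).IsIsolated D → (ℍ.deleteVerts {C, D}).IsConnected →
        ∃ M, (ℍ.deleteVerts {C, D}).IsNontrivialModule23 M ∧
          M ⊆ Γ.singletonComps \ {C, D})) := by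
  have hV : (Γ.bullet φ ℍ).vertexSet = Set.univ := rfl
  have hadj := fun v w => Hypergraph.primalityGraph_adj_iff hV hcard (v := v) (w := w)
  -- A module of `ℍ - S` avoids `S`, so the obstruction to primality takes the form used in (C3) and
  -- (C6).
  have hbad : ∀ S : Set Γ.ConnectedComponent,
      (¬ ∀ M, (ℍ.deleteVerts S).IsNontrivialModule23 M → (M \ Γ.singletonComps).Nonempty) ↔
      ∃ M, (ℍ.deleteVerts S).IsNontrivialModule23 M ∧ M ⊆ Γ.singletonComps \ S := by
    intro S
    push Not
    refine exists_congr fun M => and_congr_right fun hM => ?_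
    rw [Set.sdiff_eq_empty]
    refine ⟨fun h i hi => ⟨h hi, fun hiS => ?_⟩, fun h i hi => (h hi).1⟩
    have := hM.subset_vertexSet hi
    rw [Hypergraph.deleteVerts_eq_induce_compl hℍ.vertexSet_eq] at this
    exact this.2 hiS
  constructor
  · rintro ⟨⟨hprime, hdel⟩, hP⟩
    obtain ⟨h1, h2⟩ := (SimpleGraph.isPrime_bullet_iff φ hℍ hcard heven).1 hprime
    have hind : ∀ v w, Γ.Adj v w → ((Γ.bullet φ ℍ).induce {v, w}ᶜ).IsIndecomposable := by
      intro v w hvw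
      rw [← hP] at hvw
      exact ((hadj v w).1 hvw).2
    have hconsec : ∀ (C : Γ.ConnectedComponent) (h : 1 < C.supp.ncard),
        Γ.Adj (φ C ⟨0, by omega⟩) (φ C ⟨1, h⟩) := by
      intro C h
      rw [φ.adj_iff, φ.mk_apply, φ.mk_apply, φ.pos_apply, φ.pos_apply]
      simp
    refine ⟨h1, h2, fun v hv hconn => ?_, fun C hC hC2 => ?_, fun C hC hC3 => ?_,
      fun C hC D hD _ hconn => ?_⟩
    · rw [← hbad]
      intro hcon
      refine hdel v trivial ?_
      rw [Hypergraph.deleteVerts_eq_induce_compl hV]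
      exact (SimpleGraph.isIndecomposable_bullet_compl_singleton_iff φ hℍ hcard heven hv).2
        ⟨hconn, hcon⟩
    · have hvw := hconsec C (by omega)
      have := (SimpleGraph.isIndecomposable_bullet_compl_pair_iff_of_two φ hℍ hcard heven h1
        (by rw [φ.mk_apply, φ.mk_apply]) hvw.ne (by rw [φ.mk_apply, hC2])).1 (hind _ _ hvw)
      rwa [φ.mk_apply] at this
    · have hvw := hconsec C (by omega)
      exact (SimpleGraph.isIndecomposable_bullet_compl_pair_iff_of_three φ hℍ hcard heven
        (φ.mk_apply C _) (φ.mk_apply C _) (by rw [φ.pos_apply, φ.pos_apply]) hC3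
        (φ.mk_apply C _)).1 (hind _ _ hvw)
    · obtain ⟨v, rfl⟩ := SimpleGraph.surjective_mk C
      obtain ⟨w, rfl⟩ := SimpleGraph.surjective_mk D
      rw [← hbad]
      intro hcon
      have hind := (SimpleGraph.isIndecomposable_bullet_compl_singletons_iff φ hℍ hcard hΓ heven
        hC hD.1).2 ⟨hconn, hcon⟩
      have hvw : (Γ.bullet φ ℍ).primalityGraph.Adj v w :=
        (hadj v w).2 ⟨fun h => hD.2 (h ▸ rfl), hind⟩
      rw [hP] at hvw
      exact hD.2 (φ.adj_iff.1 hvw).1.symm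
  · rintro ⟨h1, h2, h3, h4, h5, h6⟩
    have hprime := (SimpleGraph.isPrime_bullet_iff φ hℍ hcard heven).2 ⟨h1, h2⟩
    have hdel : ∀ v, ¬ ((Γ.bullet φ ℍ).induce {v}ᶜ).IsIndecomposable := by
      intro v
      by_cases hv : Γ.connectedComponentMk v ∈ Γ.singletonComps
      · rw [SimpleGraph.isIndecomposable_bullet_compl_singleton_iff φ hℍ hcard heven hv]
        rintro ⟨hconn, hcon⟩
        exact (hbad _).2 (h3 v hv hconn) hcon
      · exact SimpleGraph.not_isIndecomposable_deleteVerts φ hcard hv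
    refine ⟨⟨hprime, fun v _ => ?_⟩, ?_⟩
    · rw [Hypergraph.deleteVerts_eq_induce_compl hV]
      exact hdel v
    have hpos : ∀ v w, Γ.connectedComponentMk v = Γ.connectedComponentMk w →
        φ.pos w = φ.pos v + 1 → (Γ.bullet φ ℍ).primalityGraph.Adj v w := by
      intro v w hvw hp
      have hne : v ≠ w := by
        rintro rfl
        omega
      have hlt : φ.pos w < (Γ.connectedComponentMk v).supp.ncard := φ.pos_lt hvw.symm
      refine (hadj v w).2 ⟨hne, ?_⟩
      -- A path with two vertices vanishes, one with three becomes a single vertex, and a longer one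
      -- keeps at least two vertices and hence its role in the pattern.
      rcases Nat.lt_or_ge (Γ.connectedComponentMk v).supp.ncard 4 with hlt4 | hge
      · rcases Nat.lt_or_ge (Γ.connectedComponentMk v).supp.ncard 3 with hlt3 | hge3
        · have hC2 : (Γ.connectedComponentMk v).supp.ncard = 2 := by omega
          have hE : Γ.connectedComponentMk v ∈ Γ.evenComps := by
            change Even _
            rw [hC2]
            exact even_two
          exact (SimpleGraph.isIndecomposable_bullet_compl_pair_iff_of_two φ hℍ hcard heven h1
            hvw.symm hne hC2).2 (h4 _ hE hC2)
        · have hC3 : (Γ.connectedComponentMk v).supp.ncard = 3 := by omega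
          have hO : Γ.connectedComponentMk v ∈ Γ.oddComps := by
            change Odd _
            rw [hC3]
            decide
          exact (SimpleGraph.isIndecomposable_bullet_compl_pair_iff_of_three φ hℍ hcard heven
            rfl hvw.symm hp hC3 (φ.mk_apply _ _)).2 (h5 _ hO hC3)
      · exact (SimpleGraph.isIndecomposable_bullet_compl_pair_iff_of_four φ hℍ hcard heven hvw hp
          hge).2 ⟨h1, h2⟩
    have hsingle : ∀ v, Γ.connectedComponentMk v ∈ Γ.singletonComps →
        ∀ w, ¬ (Γ.bullet φ ℍ).primalityGraph.Adj v w := by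
      -- A neighbour in a larger component would also be a neighbour in `Γ`, hence in the same
      -- component.
      have hT : ∀ v, Γ.connectedComponentMk v ∈ Γ.singletonComps → ∀ w,
          (Γ.bullet φ ℍ).primalityGraph.Adj v w →
          Γ.connectedComponentMk w ∈ Γ.singletonComps := by
        intro v hv w hvw
        by_contra hw
        have h := SimpleGraph.adj_of_primalityGraph_adj φ hcard hw hvw.symm
        exact hw ((φ.adj_iff.1 h).1 ▸ hv)
      refine Hypergraph.not_primalityGraph_adj hV
        (SimpleGraph.BulletHypergraph.isBlowUp φ).ncard_eq_three hcard hprime.1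
        (T := {v | Γ.connectedComponentMk v ∈ Γ.singletonComps}) ?_ (fun v _ => hdel v) hT ?_
      · intro h
        obtain ⟨C, hC⟩ := hΓ.exists_nonsingleton
        obtain ⟨x, rfl⟩ := SimpleGraph.surjective_mk C
        exact hC (h.symm.subset (Set.mem_univ x))
      · intro v hv w hvw hiso
        have hw := hT v hv w hvw
        have hvw' := (hadj v w).1 hvw
        obtain ⟨hconn, hcon⟩ := (SimpleGraph.isIndecomposable_bullet_compl_singletons_iff φ hℍ
          hcard hΓ heven hv hw).1 hvw'.2
        exact (hbad _).2 (h6 _ hv _ ⟨hw, fun h =>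
          hvw'.1 (SimpleGraph.mem_singletonComps_mk.1 hv w h).symm⟩
          (SimpleGraph.isIsolated_deleteVerts φ hℍ hv hw hiso) hconn) hcon
    ext v w
    constructor
    · intro hvw
      by_cases hv : Γ.connectedComponentMk v ∈ Γ.singletonComps
      · exact absurd hvw (hsingle v hv w)
      · exact SimpleGraph.adj_of_primalityGraph_adj φ hcard hv hvw
    · intro hvw
      obtain ⟨hc, hp | hp⟩ := φ.adj_iff.1 hvw
      · exact hpos v w hc hp.symm
      · exact (hpos w v hc.symm hp.symm).symm
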